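/- Let $n\ge 3$, let $M$ be a closed (compact, without boundary), connected smooth $n$-manifold, and let $X_0:M\to\mathbb H^{n+1}$ be a smooth embedding into hyperbolic space such that the induced metric on $M_0=X_0(M)$ has positive sectional curvature. Then there is a constant $C>0$, depending only on $n$ and $M_0$, with the following property. Let $\Gamma_+=\{\kappa\in\mathbb R^n:\kappa_i>0 \text{ for all } i\}$ and let $F:\Gamma_+\to(0,\infty)$ be any smooth symmetric function such that (i) $F$ is strictly increasing in each variable, homogeneous of degree one, and $F(1,\dots,1)=1$; (ii) for all $\kappa\in\Gamma_+$ and all $y\in\mathbb R^n$, $$\sum_{k,\ell}\frac{\partial^2F}{\partial\kappa_k\partial\kappa_\ell}\,y_ky_\ell\;\ge\; F^{-1}\Big(\sum_k \frac{\partial F}{\partial\kappa_k}\,y_k\Big)^2-\sum_k\frac{1}{\kappa_k}\frac{\partial F}{\partial\kappa_k}\,y_k^2 .$$ Let $0<T<\infty$ and let $X:M\times[0,T)\to\mathbb H^{n+1}$ be a smooth family of immersions with $$\frac{\partial}{\partial t}X(x,t)=-F(\kappa(x,t))\,\nu(x,t),\qquad X(\cdot,0)=X_0,$$ where $\nu$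 is the outward unit normal and $\kappa_1\le\dots\le\kappa_n$ are the principal curvatures of $M_t=X(M,t)$, that is, the eigenvalues of the Weingarten map of $h(v,w)=\langle D_v\nu,w\rangle$. Then $$\kappa_n(x,t)\le C\,\kappa_1(x,t)\qquad\text{for all } x\in M,\ t\in[0,T).$$ -/

import Mathlib

open scoped Manifold ContDiff Topology
open Set

noncomputable section

namespace HypFlow

/-! ### Hyperbolic space (hyperboloid model) -/

/-- The linear space `ℝ^{n+2}` carrying the Minkowski form; `n` is the dimension of the
hypersurfaces, so that hyperbolic space has dimension `n + 1`. -/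
abbrev Mink (n : ℕ) : Type := EuclideanSpace ℝ (Fin (n + 2))

/-- The Minkowski form `⟪x, y⟫ = -x₀ y₀ + x₁ y₁ + ⋯ + x_{n+1} y_{n+1}`. -/
def lor {n : ℕ} (x y : Mink n) : ℝ :=
  (∑ i : Fin (n + 1), x i.succ * y i.succ) - x 0 * y 0

/-- Hyperbolic space `ℍ^{n+1}`: the upper sheet of the unit hyperboloid. Its tangent space at `p`
is `{v | lor p v = 0}`, its Riemannian metric is the restriction of `lor`. -/
def hyp (n : ℕ) : Set (Mink n) := {x | lor x x = -1 ∧ 0 < x 0}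

/-- The point at time `s` of the geodesic of `ℍ^{n+1}` that starts at `p` with unit velocity `v`. -/
def geod {n : ℕ} (p v : Mink n) (s : ℝ) : Mink n := Real.cosh s • p + Real.sinh s • v

/-- The region of `ℍ^{n+1}` enclosed by `K`: the union of the bounded connected components of the
complement of `K` in `ℍ^{n+1}`. -/
def enclosed {n : ℕ} (K : Set (Mink n)) : Set (Mink n) :=
  {p | p ∈ hyp n \ K ∧ Bornology.IsBounded (connectedComponentIn (hyp n \ K) p)}

/-- A unit normal vector `v` at the point `p` of the closed hypersurface `K` points outward: the
normal geodesic leaves the enclosed region when it passes through `p`. -/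
def IsOutward {n : ℕ} (K : Set (Mink n)) (p v : Mink n) : Prop :=
  ∀ᶠ s : ℝ in 𝓝[>] 0, geod p v (-s) ∈ enclosed K ∧ geod p v s ∉ enclosed K

/-! ### Intrinsic curvature in coordinates -/

/-- Coordinates on an `n`-manifold. -/
abbrev Coord (n : ℕ) : Type := EuclideanSpace ℝ (Fin n)

/-- `∂f/∂uⁱ` at the point `u`. -/
def pd {n : ℕ} (i : Fin n) (f : Coord n → ℝ) (u : Coord n) : ℝ :=
  fderiv ℝ f u (EuclideanSpace.single i 1)

/-- Christoffel symbols `Γᵏᵢⱼ = ½ gᵏˡ (∂ᵢ gⱼₗ + ∂ⱼ gᵢₗ - ∂ₗ gᵢⱼ)` of the metric `g`. -/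
def christoffel {n : ℕ} (g : Coord n → Matrix (Fin n) (Fin n) ℝ) (k i j : Fin n)
    (u : Coord n) : ℝ :=
  (1 / 2 : ℝ) * ∑ l, (g u)⁻¹ k l *
    (pd i (fun w => g w j l) u + pd j (fun w => g w i l) u - pd l (fun w => g w i j) u)

/-- Components of the Riemann curvature tensor, `R(∂ᵢ, ∂ⱼ)∂ₖ = ∑ₗ riem g l k i j ∂ₗ`, where
`R(X, Y)Z = ∇_X ∇_Y Z - ∇_Y ∇_X Z - ∇_{[X, Y]} Z`. -/
def riem {n : ℕ} (g : Coord n → Matrix (Fin n) (Fin n) ℝ) (l k i j : Fin n) (u : Coord n) : ℝ :=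
  pd i (christoffel g l j k) u - pd j (christoffel g l i k) u
    + ∑ m, (christoffel g l i m u * christoffel g m j k u
      - christoffel g l j m u * christoffel g m i k u)

/-- The value `g_u(v, w)` of the metric. -/
def metricVal {n : ℕ} (g : Coord n → Matrix (Fin n) (Fin n) ℝ) (u : Coord n)
    (v w : Coord n) : ℝ :=
  ∑ i, ∑ j, g u i j * v i * w j

/-- The sectional curvature `g(R(v, w)w, v) / (g(v, v) g(w, w) - g(v, w)²)` at `u` of the plane
spanned by `v` and `w`. -/
def secCurv {n : ℕ} (g : Coord n → Matrix (Fin n) (Fin n) ℝ) (u : Coord n)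
    (v w : Coord n) : ℝ :=
  (∑ i, ∑ j, ∑ k, ∑ l, ∑ p, g u l p * riem g l k i j u * v i * w j * w k * v p) /
    (metricVal g u v v * metricVal g u w w - metricVal g u v w ^ 2)

/-! ### Hypersurfaces of hyperbolic space -/

section Hypersurface

variable {n : ℕ} {M : Type*} [TopologicalSpace M] [ChartedSpace (EuclideanSpace ℝ (Fin n)) M]

/-- The differential of `Y : M → ℝ^{n+2}` at `x`. -/
def diff (Y : M → Mink n) (x : M) (v : TangentSpace (𝓡 n) x) : Mink n :=
  mfderiv (𝓡 n) 𝓘(ℝ, Mink n) Y x v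

/-- `X : M → ℍ^{n+1}` is a smooth immersion. -/
structure IsHypImmersion (X : M → Mink n) : Prop where
  mem_hyp : ∀ x, X x ∈ hyp n
  smooth : ContMDiff (𝓡 n) 𝓘(ℝ, Mink n) ∞ X
  injective_diff : ∀ x, Function.Injective (diff X x)

/-- `X : M → ℍ^{n+1}` is a smooth embedding. -/
structure IsHypEmbedding (X : M → Mink n) : Prop extends IsHypImmersion X where
  isEmbedding : Topology.IsEmbedding X

/-- The coefficients of the metric induced by the immersion `X` in the chart around `x₀`. -/
def coordMetric (X : M → Mink n) (x₀ : M) (u : Coord n) : Matrix (Fin n) (Fin n) ℝ :=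
  Matrix.of fun i j =>
    lor (fderiv ℝ (X ∘ (extChartAt (𝓡 n) x₀).symm) u (EuclideanSpace.single i 1))
      (fderiv ℝ (X ∘ (extChartAt (𝓡 n) x₀).symm) u (EuclideanSpace.single j 1))

/-- The metric induced by `X` has positive sectional curvature, at every point and for every
two-dimensional subspace of the tangent space. -/
def HasPosSecCurv (X : M → Mink n) : Prop :=
  ∀ (x : M) (v w : Coord n), LinearIndependent ℝ ![v, w] →
    0 < secCurv (coordMetric X x) (extChartAt (𝓡 n) x x) v w

/-- `ν` is a unit normal field along the immersion `X` into `ℍ^{n+1}`: it is tangent to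
`ℍ^{n+1}`, normal to the hypersurface, and of length one. -/
def IsUnitNormal (X ν : M → Mink n) : Prop :=
  ∀ x, lor (ν x) (X x) = 0 ∧ (∀ v, lor (ν x) (diff X x v) = 0) ∧ lor (ν x) (ν x) = 1

/-- The `i`-th vector of the coordinate basis of `T_x M`. -/
def coordVec (x : M) (i : Fin n) : TangentSpace (𝓡 n) x :=
  (EuclideanSpace.single i (1 : ℝ) : EuclideanSpace ℝ (Fin n))

/-- The matrix of the first fundamental form, `gᵢⱼ = ⟨∂ᵢ X, ∂ⱼ X⟩`. -/
def firstForm (X : M → Mink n) (x : M) : Matrix (Fin n) (Fin n) ℝ :=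
  Matrix.of fun i j => lor (diff X x (coordVec x i)) (diff X x (coordVec x j))

/-- The covariant derivative `D_v Y` in `ℍ^{n+1}` of a vector field `Y` along `X` that is tangent
to `ℍ^{n+1}`: the tangential part of the derivative in Minkowski space. -/
def covDeriv (X Y : M → Mink n) (x : M) (v : TangentSpace (𝓡 n) x) : Mink n :=
  diff Y x v + lor (diff Y x v) (X x) • X x

/-- The matrix of the second fundamental form, `hᵢⱼ = ⟨D_{∂ᵢ} ν, ∂ⱼ X⟩`. -/
def secondForm (X ν : M → Mink n) (x : M) : Matrix (Fin n) (Fin n) ℝ :=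
  Matrix.of fun i j => lor (covDeriv X ν x (coordVec x i)) (diff X x (coordVec x j))

/-- The matrix `g⁻¹ h` of the Weingarten map. -/
def weingarten (X ν : M → Mink n) (x : M) : Matrix (Fin n) (Fin n) ℝ :=
  (firstForm X x)⁻¹ * secondForm X ν x

/-- The principal curvatures `κ₁ ≤ ⋯ ≤ κₙ` at `x` (indexed from `0`): the eigenvalues of the
Weingarten map, repeated with their multiplicities, in increasing order. (The Weingarten map is
self-adjoint for the positive definite first fundamental form, so that there are `n` of them.) -/
def princCurv (X ν : M → Mink n) (x : M) (i : Fin n) : ℝ :=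
  ((weingarten X ν x).charpoly.roots.sort (· ≤ ·)).getD i 0

end Hypersurface

/-! ### The speed function and the flow -/

/-- The positive cone `Γ₊`. -/
def posCone (n : ℕ) : Set (Fin n → ℝ) := {κ | ∀ i, 0 < κ i}

/-- First partial derivative `∂F/∂κ_k`. -/
def dF {n : ℕ} (F : (Fin n → ℝ) → ℝ) (k : Fin n) (κ : Fin n → ℝ) : ℝ :=
  fderiv ℝ F κ (Pi.single k 1)

/-- Second partial derivative `∂²F/∂κ_k∂κ_l`. -/
def ddF {n : ℕ} (F : (Fin n → ℝ) → ℝ) (k l : Fin n) (κ : Fin n → ℝ) : ℝ :=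
  fderiv ℝ (dF F l) κ (Pi.single k 1)

/-- The assumptions on the speed function `F : Γ₊ → (0, ∞)`. Nothing is required of the values of
`F` outside `Γ₊`. -/
structure IsSpeed {n : ℕ} (F : (Fin n → ℝ) → ℝ) : Prop where
  pos : ∀ κ ∈ posCone n, 0 < F κ
  smooth : ContDiffOn ℝ ∞ F (posCone n)
  symmetric : ∀ κ ∈ posCone n, ∀ σ : Equiv.Perm (Fin n), F (κ ∘ σ) = F κ
  strictMono : ∀ κ ∈ posCone n, ∀ (i : Fin n) (s : ℝ), κ i < s → F κ < F (Function.update κ i s)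
  homogeneous : ∀ κ ∈ posCone n, ∀ c : ℝ, 0 < c → F (c • κ) = c * F κ
  normalized : F (fun _ => 1) = 1
  hessian : ∀ κ ∈ posCone n, ∀ y : Fin n → ℝ,
    (F κ)⁻¹ * (∑ k, dF F k κ * y k) ^ 2 - ∑ k, dF F k κ / κ k * y k ^ 2
      ≤ ∑ k, ∑ l, ddF F k l κ * y k * y l

/-- `X : [0, T) × M → ℍ^{n+1}` is a smooth solution of the flow `∂X/∂t = -F(κ) ν`, `X(0, ·) = X₀`,
where `ν` is the unit normal field, smooth on `[0, T) × M`, that points outward at time `0`. (By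
continuity it is the outward normal for as long as the hypersurfaces remain embedded.) -/
structure IsFlow {n : ℕ} {M : Type*} [TopologicalSpace M]
    [ChartedSpace (EuclideanSpace ℝ (Fin n)) M]
    (F : (Fin n → ℝ) → ℝ) (X₀ : M → Mink n) (T : ℝ) (X ν : ℝ → M → Mink n) : Prop where
  smooth : ContMDiffOn (𝓘(ℝ, ℝ).prod (𝓡 n)) 𝓘(ℝ, Mink n) ∞ (fun q : ℝ × M => X q.1 q.2)
    (Ico 0 T ×ˢ univ)
  smooth_normal : ContMDiffOn (𝓘(ℝ, ℝ).prod (𝓡 n)) 𝓘(ℝ, Mink n) ∞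
    (fun q : ℝ × M => ν q.1 q.2) (Ico 0 T ×ˢ univ)
  immersion : ∀ t ∈ Ico 0 T, IsHypImmersion (X t)
  normal : ∀ t ∈ Ico 0 T, IsUnitNormal (X t) (ν t)
  outward : ∀ x, IsOutward (range X₀) (X₀ x) (ν 0 x)
  initial : X 0 = X₀
  evolution : ∀ t ∈ Ico 0 T, ∀ x, HasDerivWithinAt (fun s => X s x)
    (-(F (princCurv (X t) (ν t) x) • ν t x)) (Ico 0 T) t

end HypFlow

end

/-! Write κ_0 ≤ … ≤ κ_{n-1} for the principal curvatures, indexed as in the code, with n = m + 3. By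
the Gauss equation the plane spanned by two principal directions has sectional curvature κ_a κ_b -
1, so on a convex hypersurface the smallest value is κ_0 κ_1 - 1. The heart of the proof is that Z =
κ_0 κ_1 - 1 - c F² stays positive along the flow for a small c > 0 (`IsFlow.pinching`). Since the
product of the κ_i is at most F^n (`IsSpeed.prod_le_pow`), the inequality c F² ≤ κ_0 κ_1 forces
κ_{n-1} ≤ c^{-n} κ_0 by algebra (`pinching_bound`).

Condition (ii) says that log F is a convex function of the log κ_i (`IsSpeed.log_le`). Its gradient
in these variables, w_k = κ_k F_k / F, is nonnegative, sums to 1, and increases with k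
(`IsSpeed.logGrad_mono`). Convexity also gives F ≤ κ_{n-1}, a bound uniform in F; compactness of M
then yields a c that depends on M_0 alone (`exists_pinching_initial`). Initial convexity holds
because any two principal curvatures have product above 1, hence a common sign, which connectedness
propagates from a highest point (`princCurv_pos_of_isOutward`).

At a first zero of Z the maximum principle must cope with eigenvalues that are not smooth where they
coincide. Three devices avoid differentiating them. The bound on κ_0 κ_1 is read as an inequality
between 2 × 2 Gram determinants of h and g for all pairs of tangent vectors (`gram_two_le`,
`pinchForm`); it is an equality at the two lowest eigenvectors, and moving these vectors along with
the point improves the second order condition. The speed is smooth because it is minus the normal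
component of ∂X/∂t. Finally log F is touched from below by a smooth barrier `logFlag`: as w is
increasing, Σ w_k log κ_k is a nonnegative combination of sums of the largest log κ_k, and each such
sum dominates the logarithm of the determinant of h relative to g on a coordinate subspace.

In normal coordinates, Simons' identity (`HypGermNormal.simons`) and the evolution of g and h turn
the resulting conditions into one inequality. Its gradient terms are nonnegative
(`gradient_terms_nonneg`; here n ≥ 3 enters through w_1 ≤ 1/2) and its zeroth order terms are
strictly positive (`zeroth_order_terms_pos`), which contradicts Z reaching zero from above
(`false_of_jet_conditions`). -/

noncomputable section

namespace HypFlow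

/-! ### Linear algebra: eigenvalues of a symmetric form relative to a positive definite one -/

open Matrix in
theorem exists_orthogonal_diagonal {n : ℕ} {A : Matrix (Fin n) (Fin n) ℝ} (hA : A.IsHermitian) :
    ∃ U : Matrix (Fin n) (Fin n) ℝ, Uᵀ * U = 1 ∧ Uᵀ * A * U = diagonal hA.eigenvalues := by
  refine ⟨hA.eigenvectorUnitary, ?_, ?_⟩
  · have := Unitary.coe_star_mul_self hA.eigenvectorUnitary
    rwa [Matrix.star_eq_conjTranspose, conjTranspose_eq_transpose_of_trivial] at this
  · have := hA.conjStarAlgAut_star_eigenvectorUnitary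
    rw [Unitary.conjStarAlgAut_star_apply, Matrix.star_eq_conjTranspose,
      conjTranspose_eq_transpose_of_trivial] at this
    simpa [Function.comp_def] using this

open Matrix in
theorem exists_transpose_mul_mul_eq_one {n : ℕ} {G : Matrix (Fin n) (Fin n) ℝ} (hG : G.PosDef) :
    ∃ S : Matrix (Fin n) (Fin n) ℝ, Sᵀ * G * S = 1 := by
  obtain ⟨U, hU, hd⟩ := exists_orthogonal_diagonal hG.isHermitian
  refine ⟨U * diagonal fun i => (√(hG.isHermitian.eigenvalues i))⁻¹, ?_⟩
  rw [transpose_mul, diagonal_transpose]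
  have : ∀ D : Matrix (Fin n) (Fin n) ℝ, D * Uᵀ * G * (U * D) = D * (Uᵀ * G * U) * D := by
    intro D; simp only [Matrix.mul_assoc]
  rw [this, hd, diagonal_mul_diagonal, diagonal_mul_diagonal, ← diagonal_one]
  congr 1
  ext i
  have h := hG.eigenvalues_pos i
  have h2 := Real.mul_self_sqrt h.le
  have h3 : √(hG.isHermitian.eigenvalues i) ≠ 0 := (Real.sqrt_pos.2 h).ne'
  field_simp
  nlinarith

/-- The eigenvalues of `G⁻¹ H`, in increasing order. -/
def genEig {n : ℕ} (G H : Matrix (Fin n) (Fin n) ℝ) (i : Fin n) : ℝ :=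
  ((G⁻¹ * H).charpoly.roots.sort (· ≤ ·)).getD i 0

-- The two matrices are conjugate by `J`, hence have the same characteristic polynomial. This makes
-- principal curvatures independent of the chart.
open Matrix in
theorem genEig_transpose_mul_mul {n : ℕ} (G H J : Matrix (Fin n) (Fin n) ℝ)
    (hJ : IsUnit J.det) : genEig (Jᵀ * G * J) (Jᵀ * H * J) = genEig G H := by
  have hJt : IsUnit Jᵀ.det := by rwa [det_transpose]
  have h : (Jᵀ * G * J)⁻¹ * (Jᵀ * H * J) = J⁻¹ * (G⁻¹ * H * J) := by
    rw [Matrix.mul_inv_rev, Matrix.mul_inv_rev]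
    calc J⁻¹ * (G⁻¹ * Jᵀ⁻¹) * (Jᵀ * H * J) = J⁻¹ * G⁻¹ * (Jᵀ⁻¹ * Jᵀ) * H * J := by
          simp only [Matrix.mul_assoc]
      _ = _ := by rw [nonsing_inv_mul _ hJt]; simp only [Matrix.mul_assoc, Matrix.one_mul]
  funext i
  unfold genEig
  rw [h, charpoly_mul_comm, Matrix.mul_assoc, mul_nonsing_inv _ hJ, Matrix.mul_one]

open Matrix in
theorem genEig_one_of_isHermitian {n : ℕ} {A : Matrix (Fin n) (Fin n) ℝ} (hA : A.IsHermitian) :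
    genEig 1 A = hA.eigenvalues ∘ Tuple.sort hA.eigenvalues := by
  have hs : (A.charpoly.roots.sort (· ≤ ·)) =
      List.ofFn (hA.eigenvalues ∘ Tuple.sort hA.eigenvalues) := by
    have h1 : A.charpoly.roots =
        (List.ofFn (hA.eigenvalues ∘ Tuple.sort hA.eigenvalues) : Multiset ℝ) := by
      rw [hA.roots_charpoly_eq_eigenvalues, ← List.map_ofFn]
      have h2 : (List.ofFn (Tuple.sort hA.eigenvalues) : Multiset (Fin n))
          = (Finset.univ : Finset (Fin n)).val := by
        rw [← Fin.univ_val_map]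
        exact congrArg Finset.val (Finset.map_univ_equiv (Tuple.sort hA.eigenvalues))
      rw [← Multiset.map_coe, h2]
      rfl
    rw [h1, Multiset.coe_sort]
    apply List.mergeSort_of_pairwise
    simp_rw [decide_eq_true_eq, ← List.sortedLE_iff_pairwise]
    exact (Tuple.monotone_sort hA.eigenvalues).sortedLE_ofFn
  funext i
  simp [genEig, hs]

open Matrix in
/-- Simultaneous diagonalization of a positive definite and a symmetric form. -/
theorem exists_simultaneous_diagonal {n : ℕ} {G H : Matrix (Fin n) (Fin n) ℝ} (hG : G.PosDef)
    (hH : H.IsHermitian) :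
    Monotone (genEig G H) ∧ ∃ P : Matrix (Fin n) (Fin n) ℝ, IsUnit P.det ∧
      Pᵀ * G * P = 1 ∧ Pᵀ * H * P = diagonal (genEig G H) := by
  obtain ⟨S, hS⟩ := exists_transpose_mul_mul_eq_one hG
  have hSd : IsUnit S.det := by
    have := congrArg det hS
    rw [det_mul, det_one] at this
    exact IsUnit.of_mul_eq_one _ (by rw [mul_comm]; exact this)
  have hA : (Sᵀ * H * S).IsHermitian := by
    have := isHermitian_conjTranspose_mul_mul S hH
    rwa [conjTranspose_eq_transpose_of_trivial] at this
  have hgen : genEig G H = hA.eigenvalues ∘ Tuple.sort hA.eigenvalues := by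
    rw [← genEig_transpose_mul_mul G H S hSd, hS, genEig_one_of_isHermitian hA]
  obtain ⟨U, hU, hd⟩ := exists_orthogonal_diagonal hA
  set σ := Tuple.sort hA.eigenvalues
  refine ⟨hgen ▸ Tuple.monotone_sort _, S * (U.submatrix id σ), ?_⟩
  have key : ∀ B : Matrix (Fin n) (Fin n) ℝ, (S * (U.submatrix id σ))ᵀ * B * (S * (U.submatrix id σ))
      = (Uᵀ * (Sᵀ * B * S) * U).submatrix σ σ := by
    intro B
    rw [transpose_mul, transpose_submatrix]
    ext i j
    simp only [Matrix.mul_assoc, submatrix_apply]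
    simp only [Matrix.mul_apply, submatrix_apply, id]
  have h1 : (S * (U.submatrix id σ))ᵀ * G * (S * (U.submatrix id σ)) = 1 := by
    rw [key, hS, Matrix.mul_one, hU, submatrix_one_equiv]
  refine ⟨?_, h1, ?_⟩
  · have := congrArg det h1
    rw [det_mul, det_one] at this
    exact IsUnit.of_mul_eq_one _ (by rw [mul_comm]; exact this)
  · rw [key, hd, submatrix_diagonal_equiv, hgen]

theorem genEig_monotone {n : ℕ} {G H : Matrix (Fin n) (Fin n) ℝ} (hG : G.PosDef)
    (hH : H.IsHermitian) : Monotone (genEig G H) := (exists_simultaneous_diagonal hG hH).1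

open Matrix in
theorem dotProduct_transpose_mul_mul {m n : Type*} [Fintype m] [Fintype n] (L : Matrix n m ℝ)
    (A : Matrix n n ℝ) (y z : m → ℝ) :
    y ⬝ᵥ ((Lᵀ * A * L) *ᵥ z) = (L *ᵥ y) ⬝ᵥ (A *ᵥ (L *ᵥ z)) := by
  rw [← mulVec_mulVec, ← mulVec_mulVec, dotProduct_mulVec, vecMul_transpose]

open Matrix in
theorem posDef_iff_quadratic {m : Type*} [Fintype m] {A : Matrix m m ℝ} :
    A.PosDef ↔ A.IsHermitian ∧ ∀ y, y ≠ 0 → 0 < y ⬝ᵥ (A *ᵥ y) := by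
  rw [posDef_iff_dotProduct_mulVec]
  simp

-- The source has dimension `k + l > n`, so the difference of the two maps has a kernel. This
-- dimension count is the engine of the min-max arguments below.
open Matrix in
theorem exists_mulVec_eq_mulVec {n k l : ℕ} (L : Matrix (Fin n) (Fin k) ℝ)
    (K : Matrix (Fin n) (Fin l) ℝ) (h : n < k + l) :
    ∃ y z, (y ≠ 0 ∨ z ≠ 0) ∧ L *ᵥ y = K *ᵥ z := by
  let f : ((Fin k → ℝ) × (Fin l → ℝ)) →ₗ[ℝ] (Fin n → ℝ) := L.mulVecLin.coprod (-K.mulVecLin)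
  have : LinearMap.ker f ≠ ⊥ := by
    apply LinearMap.ker_ne_bot_of_finrank_lt
    simpa using h
  obtain ⟨p, hp, hp0⟩ := Submodule.exists_mem_ne_zero_of_ne_bot this
  refine ⟨p.1, p.2, ?_, ?_⟩
  · by_contra! hc
    exact hp0 (Prod.ext hc.1 hc.2)
  · have : L *ᵥ p.1 + -(K *ᵥ p.2) = 0 := by simpa [f] using hp
    rwa [← sub_eq_add_neg, sub_eq_zero] at this

open Matrix in
theorem exists_mulVec_pad {n k l : ℕ} {P : Matrix (Fin n) (Fin n) ℝ} (hP : IsUnit P.det)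
    (L : Matrix (Fin n) (Fin k) ℝ) {e : Fin l → Fin n} (hinj : Function.Injective e)
    (h : n < k + l) (A : Matrix (Fin n) (Fin n) ℝ)
    (hL : ∀ y, y ≠ 0 → 0 < (L *ᵥ y) ⬝ᵥ (A *ᵥ (L *ᵥ y))) :
    ∃ z : Fin n → ℝ, (∀ j, (∀ a, e a ≠ j) → z j = 0) ∧ 0 < z ⬝ᵥ ((Pᵀ * A * P) *ᵥ z) := by
  obtain ⟨y, z, hyz, he⟩ := exists_mulVec_eq_mulVec L (P.submatrix id e) h
  have hz : (P.submatrix id e) *ᵥ z = P *ᵥ (fun j => ∑ a, if e a = j then z a else 0) := by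
    ext b
    simp only [mulVec, dotProduct, submatrix_apply, id, Finset.mul_sum]
    rw [Finset.sum_comm]
    simp
  set z' : Fin n → ℝ := fun j => ∑ a, if e a = j then z a else 0
  have hzz : ∀ a, z' (e a) = z a := by
    intro a
    have : ∀ b, e b = e a ↔ b = a := fun b => hinj.eq_iff
    simp [z', this]
  refine ⟨z', fun j hj => Finset.sum_eq_zero fun a _ => if_neg (hj a), ?_⟩
  have hy : y ≠ 0 := by
    rintro rfl
    simp only [ne_eq, not_true_eq_false, false_or] at hyz
    rw [mulVec_zero, hz] at he
    have h1 : z' = 0 := by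
      apply Matrix.mulVec_injective_iff_isUnit.2 ((isUnit_iff_isUnit_det _).2 hP)
      rw [← he, mulVec_zero]
    exact hyz (funext fun a => by rw [← hzz, h1]; rfl)
  rw [dotProduct_transpose_mul_mul, ← hz, ← he]
  exact hL y hy

-- One half of Courant–Fischer: the range of `L` has dimension `n - i`, so it meets the span of the
-- eigenvectors with index at most `i`, where `H ≤ κ_i G`. Positivity on the range already makes `L`
-- injective.
open Matrix in
theorem lt_genEig_of_pos {n k : ℕ} {G H : Matrix (Fin n) (Fin n) ℝ} (hG : G.PosDef)
    (hH : H.IsHermitian) (i : Fin n) (hk : k + i = n) (L : Matrix (Fin n) (Fin k) ℝ) (c : ℝ)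
    (hL : ∀ y, y ≠ 0 → 0 < (L *ᵥ y) ⬝ᵥ ((H - c • G) *ᵥ (L *ᵥ y))) : c < genEig G H i := by
  obtain ⟨hm, P, hP, hP1, hP2⟩ := exists_simultaneous_diagonal hG hH
  set κ := genEig G H
  have hi : (i : ℕ) + 1 ≤ n := i.2
  obtain ⟨z, hz0, h⟩ := exists_mulVec_pad hP L (Fin.castLE_injective hi) (by omega) _ hL
  rw [Matrix.mul_sub, Matrix.sub_mul, Matrix.mul_smul, Matrix.smul_mul, hP1, hP2] at h
  by_contra hc
  push Not at hc
  refine absurd h (not_lt.2 ?_)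
  rw [← Matrix.diagonal_one, ← Matrix.diagonal_smul, Matrix.diagonal_sub]
  simp only [dotProduct, mulVec_diagonal]
  apply Finset.sum_nonpos
  intro j _
  by_cases hj : i < j
  · have : z j = 0 := by
      apply hz0
      intro a ha
      have := congrArg Fin.val ha
      have := Fin.lt_def.1 hj
      simp at *
      omega
    simp [this]
  · have := hm (not_lt.1 hj)
    simp only [Pi.smul_apply, smul_eq_mul, mul_one]
    nlinarith [mul_self_nonneg (z j)]

/-- The indices `≥ m`. -/
def tailIdx {n : ℕ} (m : ℕ) (a : Fin (n - m)) : Fin n := ⟨m + a, by omega⟩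

theorem tailIdx_injective {n : ℕ} (m : ℕ) : Function.Injective (tailIdx (n := n) m) := by
  intro a b h
  have := congrArg Fin.val h
  simp only [tailIdx] at this
  exact Fin.ext (by omega)

theorem exists_tailIdx_eq {n m : ℕ} {j : Fin n} (h : m ≤ j) : ∃ a, tailIdx m a = j :=
  ⟨⟨j - m, by omega⟩, Fin.ext (by simp only [tailIdx]; omega)⟩

theorem sum_tailIdx {n : ℕ} (m : ℕ) (φ : Fin n → ℝ) :
    ∑ a, φ (tailIdx m a) = ∑ i : Fin n, if m ≤ i then φ i else 0 := by
  rw [← Finset.sum_filter]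
  apply Finset.sum_bij (fun a _ => tailIdx m a)
  · intro a _; simp [tailIdx]
  · intro a _ b _ h; exact tailIdx_injective m h
  · intro j hj
    obtain ⟨a, ha⟩ := exists_tailIdx_eq (Finset.mem_filter.1 hj).2
    exact ⟨a, Finset.mem_univ _, ha⟩
  · intros; rfl

open Matrix in
theorem genEig_lt_of_pos {n k : ℕ} {G H : Matrix (Fin n) (Fin n) ℝ} (hG : G.PosDef)
    (hH : H.IsHermitian) (i : Fin n) (hk : k = i + 1) (L : Matrix (Fin n) (Fin k) ℝ) (c : ℝ)
    (hL : ∀ y, y ≠ 0 → 0 < (L *ᵥ y) ⬝ᵥ ((c • G - H) *ᵥ (L *ᵥ y))) : genEig G H i < c := by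
  obtain ⟨hm, P, hP, hP1, hP2⟩ := exists_simultaneous_diagonal hG hH
  set κ := genEig G H
  obtain ⟨z, hz0, h⟩ := exists_mulVec_pad hP L (tailIdx_injective i) (by omega) _ hL
  rw [Matrix.mul_sub, Matrix.sub_mul, Matrix.mul_smul, Matrix.smul_mul, hP1, hP2] at h
  by_contra hc
  push Not at hc
  refine absurd h (not_lt.2 ?_)
  rw [← Matrix.diagonal_one, ← Matrix.diagonal_smul, Matrix.diagonal_sub]
  simp only [dotProduct, mulVec_diagonal]
  apply Finset.sum_nonpos
  intro j _
  by_cases hj : j < i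
  · have : z j = 0 := by
      apply hz0
      intro a ha
      have := congrArg Fin.val ha
      have := Fin.lt_def.1 hj
      simp only [tailIdx] at *
      omega
    simp [this]
  · have := hm (not_lt.1 hj)
    simp only [Pi.smul_apply, smul_eq_mul, mul_one]
    nlinarith [mul_self_nonneg (z j)]

open Matrix in
theorem mulVec_submatrix_pad {n k l : ℕ} (P : Matrix (Fin k) (Fin n) ℝ) (e : Fin l → Fin n)
    (y : Fin l → ℝ) :
    (P.submatrix id e) *ᵥ y = P *ᵥ (fun j => ∑ a, if e a = j then y a else 0) := by
  ext b
  simp only [mulVec, dotProduct, submatrix_apply, id, Finset.mul_sum]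
  rw [Finset.sum_comm]
  simp

-- Cauchy interlacing, with the eigenvalues aligned at the top: `j` and `i` are equally far from the
-- last index of their respective ranges. The test space in the min-max bound is spanned by the top
-- eigenvectors of the compression.
open Matrix in
theorem genEig_le_of_compression {n p : ℕ} {G H : Matrix (Fin n) (Fin n) ℝ} (hG : G.PosDef)
    (hH : H.IsHermitian) (L : Matrix (Fin n) (Fin p) ℝ) (hL : (Lᵀ * G * L).PosDef)
    (j : Fin p) (i : Fin n) (hij : (j : ℕ) + n = i + p) :
    genEig (Lᵀ * G * L) (Lᵀ * H * L) j ≤ genEig G H i := by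
  have hH' : (Lᵀ * H * L).IsHermitian := by
    have := isHermitian_conjTranspose_mul_mul L hH
    rwa [conjTranspose_eq_transpose_of_trivial] at this
  obtain ⟨hm, P, hP, hP1, hP2⟩ := exists_simultaneous_diagonal hL hH'
  set κ' := genEig (Lᵀ * G * L) (Lᵀ * H * L)
  refine le_of_forall_lt fun c hc => ?_
  refine lt_genEig_of_pos hG hH i (k := p - j) (by omega) (L * P.submatrix id (tailIdx j)) c ?_
  intro y hy
  rw [← mulVec_mulVec, mulVec_submatrix_pad, ← dotProduct_transpose_mul_mul,
    ← dotProduct_transpose_mul_mul]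
  have : Pᵀ * (Lᵀ * (H - c • G) * L) * P = diagonal κ' - c • 1 := by
    rw [← hP1, ← hP2]
    simp only [Matrix.mul_sub, Matrix.sub_mul, Matrix.mul_smul, Matrix.smul_mul]
  rw [this, ← Matrix.diagonal_one, ← Matrix.diagonal_smul, Matrix.diagonal_sub]
  set z : Fin p → ℝ := fun b => ∑ a, if tailIdx j a = b then y a else 0
  have hzz : ∀ a, z (tailIdx j a) = y a := by
    intro a
    have : ∀ b, tailIdx j b = tailIdx j a ↔ b = a := fun b => (tailIdx_injective (j : ℕ)).eq_iff
    simp [z, this]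
  simp only [dotProduct, mulVec_diagonal, Pi.smul_apply, smul_eq_mul, mul_one]
  obtain ⟨a, ha⟩ := Function.ne_iff.1 hy
  have hpos : ∀ b : Fin p, j ≤ b → 0 < κ' b - c := fun b hb => by linarith [hm hb]
  have hzero : ∀ b : Fin p, ¬ j ≤ b → z b = 0 := by
    intro b hb
    apply Finset.sum_eq_zero
    intro a _
    rw [if_neg]
    rintro rfl
    exact hb (Fin.le_def.2 (by simp [tailIdx]))
  apply Finset.sum_pos'
  · intro b _
    by_cases hb : j ≤ b
    · nlinarith [hpos b hb, mul_self_nonneg (z b), mul_nonneg (hpos b hb).le (mul_self_nonneg (z b))]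
    · simp [hzero b hb]
  · refine ⟨tailIdx j a, Finset.mem_univ _, ?_⟩
    rw [hzz]
    have h1 := hpos (tailIdx j a) (Fin.le_def.2 (by simp [tailIdx]))
    have h2 : 0 < y a * y a := mul_self_pos.2 ha
    nlinarith [mul_pos h1 h2]

open Matrix in
theorem det_eq_prod_genEig {n : ℕ} {G H : Matrix (Fin n) (Fin n) ℝ} (hG : G.PosDef)
    (hH : H.IsHermitian) : H.det = (∏ i, genEig G H i) * G.det := by
  obtain ⟨hm, P, hP, hP1, hP2⟩ := exists_simultaneous_diagonal hG hH
  have h1 := congrArg det hP1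
  have h2 := congrArg det hP2
  rw [det_mul, det_mul, det_transpose] at h1 h2
  rw [det_diagonal] at h2
  rw [det_one] at h1
  rw [← h2]
  linear_combination (-H.det) * h1

open Matrix in
theorem genEig_pos_of_posDef {n : ℕ} {G H : Matrix (Fin n) (Fin n) ℝ} (hG : G.PosDef)
    (hH : H.PosDef) (i : Fin n) : 0 < genEig G H i := by
  obtain ⟨hm, P, hP, hP1, hP2⟩ := exists_simultaneous_diagonal hG hH.isHermitian
  have h := hH.conjTranspose_mul_mul_same (B := P)
    (Matrix.mulVec_injective_iff_isUnit.2 ((isUnit_iff_isUnit_det _).2 hP))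
  rw [conjTranspose_eq_transpose_of_trivial, hP2, posDef_diagonal_iff] at h
  exact h i

open Matrix in
theorem posDef_of_genEig_pos {n : ℕ} {G H : Matrix (Fin n) (Fin n) ℝ} (hG : G.PosDef)
    (hH : H.IsHermitian) (h : ∀ i, 0 < genEig G H i) : H.PosDef := by
  obtain ⟨hm, P, hP, hP1, hP2⟩ := exists_simultaneous_diagonal hG hH
  have h1 : (Pᵀ * H * P).PosDef := by rw [hP2, posDef_diagonal_iff]; exact h
  have h2 := h1.conjTranspose_mul_mul_same (B := P⁻¹)
    (Matrix.mulVec_injective_iff_isUnit.2 (by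
      rw [Matrix.isUnit_nonsing_inv_iff]; exact (isUnit_iff_isUnit_det _).2 hP))
  have hPt : IsUnit Pᵀ.det := by rwa [det_transpose]
  rw [conjTranspose_eq_transpose_of_trivial] at h2
  have : P⁻¹ᵀ * (Pᵀ * H * P) * P⁻¹ = H := by
    calc P⁻¹ᵀ * (Pᵀ * H * P) * P⁻¹ = (P * P⁻¹)ᵀ * H * (P * P⁻¹) := by
          rw [transpose_mul]; simp only [Matrix.mul_assoc]
      _ = H := by rw [mul_nonsing_inv _ hP]; simp
  rwa [this] at h2

open Matrix in
theorem posDef_tail {n : ℕ} {A : Matrix (Fin n) (Fin n) ℝ} (hA : A.PosDef) (m : ℕ) :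
    (A.submatrix (tailIdx m) (tailIdx m)).PosDef := hA.submatrix (tailIdx_injective m)

open Matrix in
/-- The determinant of a compression to the last coordinates is bounded by the product of the
largest eigenvalues. -/
theorem log_det_tail_le {n : ℕ} {G H : Matrix (Fin n) (Fin n) ℝ} (hG : G.PosDef)
    (hH : H.PosDef) (J : Matrix (Fin n) (Fin n) ℝ) (hJ : (Jᵀ * G * J).PosDef) (m : ℕ) :
    Real.log ((Jᵀ * H * J).submatrix (tailIdx m) (tailIdx m)).det
      - Real.log ((Jᵀ * G * J).submatrix (tailIdx m) (tailIdx m)).det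
      ≤ ∑ i : Fin n, if m ≤ i then Real.log (genEig G H i) else 0 := by
  rw [← sum_tailIdx m (fun i => Real.log (genEig G H i))]
  set L := J.submatrix id (tailIdx (n := n) m)
  have hsub : ∀ A : Matrix (Fin n) (Fin n) ℝ,
      (Jᵀ * A * J).submatrix (tailIdx m) (tailIdx m) = Lᵀ * A * L := by
    intro A
    ext i j
    simp [L, Matrix.mul_apply]
  have hGL : (Lᵀ * G * L).PosDef := by rw [← hsub]; exact posDef_tail hJ m
  have hLinj : Function.Injective L.mulVec := by
    intro y z hyz
    by_contra hne
    have h1 := (posDef_iff_quadratic.1 hGL).2 (y - z) (sub_ne_zero.2 hne)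
    rw [dotProduct_transpose_mul_mul, mulVec_sub, sub_eq_zero.2 hyz] at h1
    simp at h1
  have hHL : (Lᵀ * H * L).PosDef := by
    have := hH.conjTranspose_mul_mul_same hLinj
    rwa [conjTranspose_eq_transpose_of_trivial] at this
  rw [hsub, hsub, det_eq_prod_genEig hGL hHL.isHermitian,
    Real.log_mul (Finset.prod_ne_zero_iff.2 fun i _ => (genEig_pos_of_posDef hGL hHL i).ne')
      hGL.det_pos.ne', add_sub_cancel_right,
    Real.log_prod (fun i _ => (genEig_pos_of_posDef hGL hHL i).ne')]
  apply Finset.sum_le_sum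
  intro a _
  apply Real.log_le_log (genEig_pos_of_posDef hGL hHL a)
  -- Index `a` among `n - m` eigenvalues and index `m + a` among `n` have the same distance from the
  -- top.
  apply genEig_le_of_compression hG hH.isHermitian L hGL
  simp only [tailIdx]
  omega

open Matrix Filter in
theorem eventually_posDef {α : Type*} {l : Filter α} {m : Type*} [Fintype m]
    {A : α → Matrix m m ℝ} {A₀ : Matrix m m ℝ} (hA : Tendsto A l (𝓝 A₀)) (hA₀ : A₀.PosDef)
    (hs : ∀ᶠ a in l, (A a).IsHermitian) : ∀ᶠ a in l, (A a).PosDef := by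
  classical
  have h1 : ∀ᶠ B in 𝓝 A₀, ∀ y ∈ Metric.sphere (0 : m → ℝ) 1, 0 < y ⬝ᵥ (B *ᵥ y) := by
    apply (isCompact_sphere (0 : m → ℝ) 1).eventually_forall_of_forall_eventually
    intro y hy
    have hc : Continuous fun p : Matrix m m ℝ × (m → ℝ) => p.2 ⬝ᵥ (p.1 *ᵥ p.2) := by fun_prop
    refine hc.continuousAt.eventually (lt_mem_nhds ?_)
    exact (posDef_iff_quadratic.1 hA₀).2 y (by rintro rfl; simp at hy)
  filter_upwards [hs, hA.eventually h1] with a ha1 ha2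
  refine posDef_iff_quadratic.2 ⟨ha1, fun y hy => ?_⟩
  have hn : 0 < ‖y‖ := norm_pos_iff.2 hy
  have h := ha2 (‖y‖⁻¹ • y) (by
    rw [mem_sphere_zero_iff_norm, norm_smul, norm_inv, norm_norm, inv_mul_cancel₀ hn.ne'])
  rw [mulVec_smul, smul_dotProduct, dotProduct_smul, smul_eq_mul, smul_eq_mul] at h
  have h2 : 0 < ‖y‖⁻¹ := inv_pos.2 hn
  exact (mul_pos_iff_of_pos_left h2).1 ((mul_pos_iff_of_pos_left h2).1 h)

open Matrix in
theorem isHermitian_transpose_mul_mul {m n : Type*} [Fintype n]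
    {A : Matrix n n ℝ} (hA : A.IsHermitian) (L : Matrix n m ℝ) : (Lᵀ * A * L).IsHermitian := by
  have := isHermitian_conjTranspose_mul_mul L hA
  rwa [conjTranspose_eq_transpose_of_trivial] at this

-- Each one-sided bound on an eigenvalue is witnessed by definiteness on a span of eigenvectors of
-- the limit pair. Definiteness is open, so the same span serves as a test space for nearby pairs.
open Matrix Filter in
theorem tendsto_genEig {α : Type*} {l : Filter α} {n : ℕ} {G H : α → Matrix (Fin n) (Fin n) ℝ}
    {G₀ H₀ : Matrix (Fin n) (Fin n) ℝ} (hG : Tendsto G l (𝓝 G₀)) (hH : Tendsto H l (𝓝 H₀))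
    (hG₀ : G₀.PosDef) (hH₀ : H₀.IsHermitian) (hGs : ∀ᶠ a in l, (G a).IsHermitian)
    (hHs : ∀ᶠ a in l, (H a).IsHermitian) (i : Fin n) :
    Tendsto (fun a => genEig (G a) (H a) i) l (𝓝 (genEig G₀ H₀ i)) := by
  obtain ⟨hm, P, hP, hP1, hP2⟩ := exists_simultaneous_diagonal hG₀ hH₀
  have hGp := eventually_posDef hG hG₀ hGs
  have hsub : ∀ {k : ℕ} (e : Fin k → Fin n) (A : Matrix (Fin n) (Fin n) ℝ),
      (P.submatrix id e)ᵀ * A * P.submatrix id e = (Pᵀ * A * P).submatrix e e := by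
    intro k e A
    ext i j
    simp [Matrix.mul_apply]
  refine tendsto_order.2 ⟨fun c hc => ?_, fun c hc => ?_⟩
  · have h1 : Tendsto (fun a => (P.submatrix id (tailIdx i))ᵀ * (H a - c • G a) *
        P.submatrix id (tailIdx (n := n) i)) l
        (𝓝 ((P.submatrix id (tailIdx i))ᵀ * (H₀ - c • G₀) * P.submatrix id (tailIdx i))) := by
      have hc : Continuous fun A : Matrix (Fin n) (Fin n) ℝ =>
        (P.submatrix id (tailIdx i))ᵀ * A * P.submatrix id (tailIdx (n := n) i) := by fun_prop
      exact (hc.tendsto _).comp (hH.sub (hG.const_smul c))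
    have h2 := eventually_posDef h1 (by
      rw [hsub, Matrix.mul_sub, Matrix.sub_mul, Matrix.mul_smul, Matrix.smul_mul, hP1, hP2,
        ← Matrix.diagonal_one, ← Matrix.diagonal_smul, Matrix.diagonal_sub,
        submatrix_diagonal _ _ (tailIdx_injective _), posDef_diagonal_iff]
      intro a
      have : genEig G₀ H₀ i ≤ genEig G₀ H₀ (tailIdx i a) :=
        hm (Fin.le_def.2 (by simp [tailIdx]))
      simp only [Function.comp_apply, Pi.smul_apply, smul_eq_mul, mul_one]
      linarith)
      (by filter_upwards [hGs, hHs] with a ha hb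
          exact isHermitian_transpose_mul_mul (hb.sub (by
            rw [IsHermitian, conjTranspose_smul, ha.eq, star_trivial])) _)
    filter_upwards [hGp, hHs, h2] with a ha hb hab
    refine lt_genEig_of_pos ha hb i (by omega) (P.submatrix id (tailIdx i)) c fun y hy => ?_
    rw [← dotProduct_transpose_mul_mul]
    exact (posDef_iff_quadratic.1 hab).2 y hy
  · have hi : (i : ℕ) + 1 ≤ n := i.2
    have h1 : Tendsto (fun a => (P.submatrix id (Fin.castLE hi))ᵀ * (c • G a - H a) *
        P.submatrix id (Fin.castLE hi)) l
        (𝓝 ((P.submatrix id (Fin.castLE hi))ᵀ * (c • G₀ - H₀) * P.submatrix id (Fin.castLE hi))) := by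
      have hc : Continuous fun A : Matrix (Fin n) (Fin n) ℝ =>
        (P.submatrix id (Fin.castLE hi))ᵀ * A * P.submatrix id (Fin.castLE hi) := by fun_prop
      exact (hc.tendsto _).comp ((hG.const_smul c).sub hH)
    have h2 := eventually_posDef h1 (by
      rw [hsub, Matrix.mul_sub, Matrix.sub_mul, Matrix.mul_smul, Matrix.smul_mul, hP1, hP2,
        ← Matrix.diagonal_one, ← Matrix.diagonal_smul, Matrix.diagonal_sub,
        submatrix_diagonal _ _ (Fin.castLE_injective _), posDef_diagonal_iff]
      intro a
      have : genEig G₀ H₀ (Fin.castLE hi a) ≤ genEig G₀ H₀ i :=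
        hm (Fin.le_def.2 (by simp; omega))
      simp only [Function.comp_apply, Pi.smul_apply, smul_eq_mul, mul_one]
      linarith)
      (by filter_upwards [hGs, hHs] with a ha hb
          exact isHermitian_transpose_mul_mul (IsHermitian.sub (by
            rw [IsHermitian, conjTranspose_smul, ha.eq, star_trivial]) hb) _)
    filter_upwards [hGp, hHs, h2] with a ha hb hab
    refine genEig_lt_of_pos ha hb i rfl (P.submatrix id (Fin.castLE hi)) c fun y hy => ?_
    rw [← dotProduct_transpose_mul_mul]
    exact (posDef_iff_quadratic.1 hab).2 y hy

/-- Lagrange's identity with weights. -/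
theorem weighted_lagrange {n : ℕ} (κ x y : Fin n → ℝ) :
    (∑ a, κ a * x a ^ 2) * (∑ a, κ a * y a ^ 2) - (∑ a, κ a * x a * y a) ^ 2
      = (1 / 2) * ∑ a, ∑ b, κ a * κ b * (x a * y b - x b * y a) ^ 2 := by
  have h1 : ∑ a, ∑ b, κ a * κ b * (x a * y b - x b * y a) ^ 2
      = ∑ a, ∑ b, ((κ a * x a ^ 2) * (κ b * y b ^ 2) + (κ a * y a ^ 2) * (κ b * x b ^ 2)
        - 2 * ((κ a * x a * y a) * (κ b * x b * y b))) := by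
    refine Finset.sum_congr rfl fun a _ => Finset.sum_congr rfl fun b _ => by ring
  rw [h1]
  simp only [Finset.sum_sub_distrib, Finset.sum_add_distrib, ← Finset.mul_sum, ← Finset.sum_mul]
  ring

open Matrix in
/-- The `2 × 2` Gram determinants of two forms are compared by the product of the two smallest
eigenvalues. -/
theorem gram_two_le {n : ℕ} {G H : Matrix (Fin n) (Fin n) ℝ} (hG : G.PosDef)
    (hH : H.IsHermitian) (c : ℝ) (hc : ∀ a b, a ≠ b → c ≤ genEig G H a * genEig G H b)
    (v w : Fin n → ℝ) :
    c * ((v ⬝ᵥ (G *ᵥ v)) * (w ⬝ᵥ (G *ᵥ w)) - (v ⬝ᵥ (G *ᵥ w)) ^ 2)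
      ≤ (v ⬝ᵥ (H *ᵥ v)) * (w ⬝ᵥ (H *ᵥ w)) - (v ⬝ᵥ (H *ᵥ w)) ^ 2 := by
  obtain ⟨hm, P, hP, hP1, hP2⟩ := exists_simultaneous_diagonal hG hH
  have hPv : ∀ v, P *ᵥ (P⁻¹ *ᵥ v) = v := fun v => by
    rw [mulVec_mulVec, mul_nonsing_inv _ hP, one_mulVec]
  have hq : ∀ (A : Matrix (Fin n) (Fin n) ℝ) v w, v ⬝ᵥ (A *ᵥ w)
      = (P⁻¹ *ᵥ v) ⬝ᵥ ((Pᵀ * A * P) *ᵥ (P⁻¹ *ᵥ w)) := fun A v w => by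
    rw [dotProduct_transpose_mul_mul, hPv, hPv]
  set x := P⁻¹ *ᵥ v
  set y := P⁻¹ *ᵥ w
  have hd : ∀ (κ x y : Fin n → ℝ), x ⬝ᵥ (diagonal κ *ᵥ y) = ∑ a, κ a * x a * y a := by
    intro κ x y
    simp only [dotProduct, mulVec_diagonal]
    exact Finset.sum_congr rfl fun a _ => by ring
  have e := weighted_lagrange (genEig G H) x y
  have e1 := weighted_lagrange (fun _ => 1) x y
  simp only [hq _ v v, hq _ w w, hq _ v w, hP1, hP2]
  rw [← Matrix.diagonal_one]
  simp only [hd]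
  have hsq : ∀ (κ x : Fin n → ℝ), ∑ a, κ a * x a * x a = ∑ a, κ a * x a ^ 2 := fun κ x =>
    Finset.sum_congr rfl fun a _ => by ring
  simp only [hsq]
  -- In eigenvector coordinates both Gram determinants are sums of the same squared minors, one
  -- weighted by `κ_a κ_b` and the other by 1. The comparison is termwise, and the minors with `a =
  -- b` vanish.
  rw [e, e1, mul_left_comm, Finset.mul_sum]
  refine mul_le_mul_of_nonneg_left (Finset.sum_le_sum fun a _ => ?_) (by norm_num)
  rw [Finset.mul_sum]
  refine Finset.sum_le_sum fun b _ => ?_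
  by_cases hab : a = b
  · subst hab; simp
  · nlinarith [hc a b hab, sq_nonneg (x a * y b - x b * y a)]

/-! ### The speed function: log-convexity and its consequences -/

theorem isOpen_posCone (n : ℕ) : IsOpen (posCone n) := by
  have : posCone n = Set.univ.pi fun _ => Ioi 0 := by ext; simp [posCone]
  rw [this]
  exact isOpen_set_pi Set.finite_univ fun _ _ => isOpen_Ioi

theorem fderiv_eq_sum_dF {n : ℕ} (F : (Fin n → ℝ) → ℝ) (κ y : Fin n → ℝ) :
    fderiv ℝ F κ y = ∑ k, dF F k κ * y k := by
  conv_lhs => rw [pi_eq_sum_univ' y]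
  rw [map_sum]
  refine Finset.sum_congr rfl fun k _ => ?_
  rw [map_smul, smul_eq_mul, mul_comm, dF]

namespace IsSpeed

variable {n : ℕ} {F : (Fin n → ℝ) → ℝ} (hF : IsSpeed F) {κ κ₀ : Fin n → ℝ}
include hF

theorem contDiffAt (hκ : κ ∈ posCone n) : ContDiffAt ℝ ∞ F κ :=
  hF.smooth.contDiffAt ((isOpen_posCone n).mem_nhds hκ)

theorem hasFDerivAt (hκ : κ ∈ posCone n) : HasFDerivAt F (fderiv ℝ F κ) κ :=
  ((hF.contDiffAt hκ).differentiableAt (by simp)).hasFDerivAt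

theorem hasDerivAt_comp (γ : ℝ → Fin n → ℝ) (γ' : Fin n → ℝ) (s : ℝ) (hγ : HasDerivAt γ γ' s)
    (hs : γ s ∈ posCone n) : HasDerivAt (fun s => F (γ s)) (∑ k, dF F k (γ s) * γ' k) s := by
  rw [← fderiv_eq_sum_dF]
  exact (hF.hasFDerivAt hs).comp_hasDerivAt s hγ

theorem hasDerivAt_dF_comp (l : Fin n) (γ : ℝ → Fin n → ℝ) (γ' : Fin n → ℝ) (s : ℝ)
    (hγ : HasDerivAt γ γ' s) (hs : γ s ∈ posCone n) :
    HasDerivAt (fun s => dF F l (γ s)) (∑ k, ddF F k l (γ s) * γ' k) s := by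
  have h1 : ContDiffAt ℝ ∞ (dF F l) (γ s) :=
    ((hF.contDiffAt hs).fderiv_right (m := ∞) (by simp)).clm_apply contDiffAt_const
  have h2 := (h1.differentiableAt (by simp)).hasFDerivAt.comp_hasDerivAt s hγ
  rw [fderiv_eq_sum_dF] at h2
  exact h2

theorem dF_nonneg (hκ : κ ∈ posCone n) (k : Fin n) : 0 ≤ dF F k κ := by
  have h1 : HasDerivAt (fun s : ℝ => κ + s • Pi.single k (1 : ℝ)) (Pi.single k (1 : ℝ)) 0 := by
    simpa using ((hasDerivAt_id (0 : ℝ)).smul_const (Pi.single k (1 : ℝ))).const_add κ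
  have h2 := hF.hasDerivAt_comp _ _ 0 h1 (by simpa using hκ)
  have h3 : ∑ j, dF F j (κ + (0 : ℝ) • Pi.single k (1 : ℝ)) * (Pi.single k (1 : ℝ) : Fin n → ℝ) j
      = dF F k κ := by simp [Pi.single_apply]
  rw [h3] at h2
  refine ge_of_tendsto h2.tendsto_slope_zero_right ?_
  filter_upwards [self_mem_nhdsWithin] with s hs
  have hs : 0 < s := hs
  have h4 := hF.strictMono κ hκ k (κ k + s) (by linarith)
  have h5 : Function.update κ k (κ k + s) = κ + s • Pi.single k (1 : ℝ) := by
    ext j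
    by_cases h : j = k
    · subst h; simp
    · simp [h]
  rw [h5] at h4
  simp only [zero_add, zero_smul, add_zero, smul_eq_mul]
  exact mul_nonneg (inv_nonneg.2 hs.le) (by linarith)

omit hF in
/-- The gradient of `log F` in the logarithmic variables. -/
def _root_.HypFlow.logGrad (F : (Fin n → ℝ) → ℝ) (κ : Fin n → ℝ) (k : Fin n) : ℝ :=
  dF F k κ * κ k / F κ

theorem logGrad_nonneg (hκ : κ ∈ posCone n) (k : Fin n) : 0 ≤ logGrad F κ k :=
  div_nonneg (mul_nonneg (hF.dF_nonneg hκ k) (hκ k).le) (hF.pos κ hκ).le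

theorem sum_logGrad (hκ : κ ∈ posCone n) : ∑ k, logGrad F κ k = 1 := by
  have h1 : HasDerivAt (fun s : ℝ => s • κ) κ 1 := by
    simpa using (hasDerivAt_id (1 : ℝ)).smul_const κ
  have h2 := hF.hasDerivAt_comp _ _ 1 h1 (by simpa using hκ)
  have h3 : HasDerivAt (fun s : ℝ => F (s • κ)) (F κ) 1 := by
    have h4 : HasDerivAt (fun s : ℝ => s * F κ) (F κ) 1 := by
      simpa using (hasDerivAt_id (1 : ℝ)).mul_const (F κ)
    refine h4.congr_of_eventuallyEq ?_
    filter_upwards [lt_mem_nhds (zero_lt_one' ℝ)] with s hs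
    exact hF.homogeneous κ hκ s hs
  have h5 := h2.unique h3
  rw [one_smul] at h5
  simp only [logGrad]
  rw [← Finset.sum_div, h5, div_self (hF.pos κ hκ).ne']

/-- `log F` is convex in the logarithmic variables. -/
theorem log_le (hκ₀ : κ₀ ∈ posCone n) (hκ : κ ∈ posCone n) :
    Real.log (F κ₀) + ∑ k, logGrad F κ₀ k * (Real.log (κ k) - Real.log (κ₀ k))
      ≤ Real.log (F κ) := by
  set y : Fin n → ℝ := fun k => Real.log (κ k) - Real.log (κ₀ k) with hy
  -- The segment from `κ₀` to `κ` in logarithmic coordinates; the claim is that `log F` lies above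
  -- its tangent along it.
  set γ : ℝ → Fin n → ℝ := fun s k => Real.exp (Real.log (κ₀ k) + s * y k) with hγ
  have hpos : ∀ s, γ s ∈ posCone n := fun s k => Real.exp_pos _
  have hγ0 : γ 0 = κ₀ := by
    ext k; simp [hγ, Real.exp_log (hκ₀ k)]
  have hγ1 : γ 1 = κ := by
    ext k; simp [hγ, hy, Real.exp_log (hκ k)]
  have hγk : ∀ s k, HasDerivAt (fun s => γ s k) (γ s k * y k) s := by
    intro s k
    have := (((hasDerivAt_id s).mul_const (y k)).const_add (Real.log (κ₀ k))).exp
    simpa [hγ] using this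
  have hγd : ∀ s, HasDerivAt γ (fun k => γ s k * y k) s := fun s => hasDerivAt_pi.2 (hγk s)
  set φ' : ℝ → ℝ := fun s => (∑ k, dF F k (γ s) * (γ s k * y k)) / F (γ s) with hφ'
  have hφ : ∀ s, HasDerivAt (fun s => Real.log (F (γ s))) (φ' s) s := fun s =>
    (hF.hasDerivAt_comp γ _ s (hγd s) (hpos s)).log (hF.pos _ (hpos s)).ne'
  have hnum : ∀ s, HasDerivAt (fun s => ∑ k, dF F k (γ s) * (γ s k * y k))
      (∑ k, ((∑ l, ddF F l k (γ s) * (γ s l * y l)) * (γ s k * y k)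
        + dF F k (γ s) * (γ s k * y k * y k))) s := by
    intro s
    refine HasDerivAt.fun_sum fun k _ => ?_
    exact (hF.hasDerivAt_dF_comp k γ _ s (hγd s) (hpos s)).mul ((hγk s k).mul_const (y k))
  have hφ'd : ∀ s, HasDerivAt φ' (((∑ k, ((∑ l, ddF F l k (γ s) * (γ s l * y l)) * (γ s k * y k)
        + dF F k (γ s) * (γ s k * y k * y k))) * F (γ s)
        - (∑ k, dF F k (γ s) * (γ s k * y k)) * (∑ k, dF F k (γ s) * (γ s k * y k)))
        / F (γ s) ^ 2) s := fun s =>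
    (hnum s).div (hF.hasDerivAt_comp γ _ s (hγd s) (hpos s)) (hF.pos _ (hpos s)).ne'
  have hmono : Monotone φ' := by
    apply monotone_of_deriv_nonneg (fun s => (hφ'd s).differentiableAt)
    intro s
    rw [(hφ'd s).deriv]
    apply div_nonneg _ (sq_nonneg _)
    -- Tested on the velocity of `γ`, the last term of the Hessian condition is cancelled by the
    -- acceleration `γ_k y_k²`, leaving exactly that the second derivative of `log F` along `γ` is
    -- nonnegative.
    have h := hF.hessian (γ s) (hpos s) (fun k => γ s k * y k)
    have hp := hF.pos _ (hpos s)
    set A := ∑ k, dF F k (γ s) * (γ s k * y k)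
    have e1 : ∑ k, dF F k (γ s) / γ s k * (γ s k * y k) ^ 2
        = ∑ k, dF F k (γ s) * (γ s k * y k * y k) := by
      refine Finset.sum_congr rfl fun k _ => ?_
      have := (hpos s k).ne'
      field_simp
    have e2 : ∑ k, ∑ l, ddF F k l (γ s) * (γ s k * y k) * (γ s l * y l)
        = ∑ k, (∑ l, ddF F l k (γ s) * (γ s l * y l)) * (γ s k * y k) := by
      rw [Finset.sum_comm]
      simp only [Finset.sum_mul]
    rw [e1, e2] at h
    rw [Finset.sum_add_distrib]
    have h2 := mul_le_mul_of_nonneg_right h hp.le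
    rw [sub_mul] at h2
    have h3 : (F (γ s))⁻¹ * A ^ 2 * F (γ s) = A * A := by
      field_simp
    rw [h3] at h2
    linarith
  obtain ⟨c, hc, hce⟩ := exists_hasDerivAt_eq_slope (fun s => Real.log (F (γ s))) φ'
    zero_lt_one (fun s _ => (hφ s).continuousAt.continuousWithinAt) (fun s _ => hφ s)
  rw [hγ0, hγ1, sub_zero, div_one] at hce
  have h0 : φ' 0 = ∑ k, logGrad F κ₀ k * (Real.log (κ k) - Real.log (κ₀ k)) := by
    simp only [hφ', hγ0, logGrad]
    rw [Finset.sum_div]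
    refine Finset.sum_congr rfl fun k _ => ?_
    simp only [hy]
    ring
  have := hmono hc.1.le
  linarith

theorem dF_eq_of_eq (hκ : κ ∈ posCone n) {k l : Fin n} (heq : κ k = κ l) :
    dF F k κ = dF F l κ := by
  have hswap : κ ∘ Equiv.swap k l = κ := by
    ext j
    by_cases h1 : j = k
    · subst h1; simp [heq]
    by_cases h2 : j = l
    · subst h2; simp [heq]
    simp [Equiv.swap_apply_of_ne_of_ne h1 h2]
  have hd : ∀ i, HasDerivAt (fun s : ℝ => F (κ + s • Pi.single i (1 : ℝ))) (dF F i κ) 0 := by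
    intro i
    have h1 : HasDerivAt (fun s : ℝ => κ + s • Pi.single i (1 : ℝ)) (Pi.single i (1 : ℝ)) 0 := by
      simpa using ((hasDerivAt_id (0 : ℝ)).smul_const (Pi.single i (1 : ℝ))).const_add κ
    have h2 := hF.hasDerivAt_comp _ _ 0 h1 (by simpa using hκ)
    simpa [Pi.single_apply] using h2
  have h3 : HasDerivAt (fun s : ℝ => F (κ + s • Pi.single k (1 : ℝ))) (dF F l κ) 0 := by
    refine (hd l).congr_of_eventuallyEq ?_
    have hcont : Continuous fun s : ℝ => κ + s • Pi.single k (1 : ℝ) := by fun_prop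
    filter_upwards [hcont.continuousAt.preimage_mem_nhds
      ((isOpen_posCone n).mem_nhds (by simpa using hκ))] with s hs
    rw [← hF.symmetric _ hs (Equiv.swap k l)]
    congr 1
    ext j
    have := congrFun hswap j
    simp only [Function.comp_apply] at this
    simp only [Function.comp_apply, Pi.add_apply, Pi.smul_apply, this, Pi.single_apply]
    congr 2
    simp only [Equiv.swap_apply_eq_iff, Equiv.swap_apply_left]
  exact (hd k).unique h3

/-- Interchanging two entries leaves `F` unchanged, so the tangent inequality at `κ` evaluated at
the swapped point reads `(w_k - w_l)(log κ_l - log κ_k) ≤ 0`. Equal entries are handled by symmetry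
of the derivatives. Monotone weights are what makes the barrier `logFlag` available. -/
theorem logGrad_mono (hκ : κ ∈ posCone n) (hm : Monotone κ) : Monotone (logGrad F κ) := by
  intro k l hkl
  rcases eq_or_ne k l with rfl | hne
  · exact le_rfl
  rcases (hm hkl).eq_or_lt with heq | hlt
  · have := hF.dF_eq_of_eq hκ heq
    simp only [logGrad, this, heq, le_refl]
  · have hs : κ ∘ Equiv.swap k l ∈ posCone n := fun j => hκ _
    have h := hF.log_le hκ hs
    rw [hF.symmetric κ hκ] at h
    have hlog := Real.log_lt_log (hκ k) hlt
    have hsum : ∑ j, logGrad F κ j * (Real.log ((κ ∘ Equiv.swap k l) j) - Real.log (κ j))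
        = (logGrad F κ k - logGrad F κ l) * (Real.log (κ l) - Real.log (κ k)) := by
      rw [← Finset.sum_subset (Finset.subset_univ {k, l})]
      · rw [Finset.sum_pair hne]
        simp
        ring
      · intro j _ hj
        simp only [Finset.mem_insert, Finset.mem_singleton, not_or] at hj
        simp [Equiv.swap_apply_of_ne_of_ne hj.1 hj.2]
    rw [hsum] at h
    by_contra hcon
    push Not at hcon
    nlinarith [mul_pos (sub_pos.2 hcon) (sub_pos.2 hlog)]

/-- The tangent at `κ` evaluated at `(1, …, 1)` bounds `log F(κ)` by a weighted mean of the `log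
κ_k`. This upper bound is the same for all speeds, which keeps the final constant independent of
`F`. -/
theorem le_of_forall_le (hκ : κ ∈ posCone n) {b : ℝ} (hb : ∀ i, κ i ≤ b) (hb0 : 0 < b) :
    F κ ≤ b := by
  have h := hF.log_le (κ := fun _ => 1) hκ (fun _ => zero_lt_one)
  rw [hF.normalized] at h
  simp only [Real.log_one, zero_sub, mul_neg, Finset.sum_neg_distrib] at h
  have h2 : ∑ k, logGrad F κ k * Real.log (κ k) ≤ Real.log b := by
    calc _ ≤ ∑ k, logGrad F κ k * Real.log b := Finset.sum_le_sum fun k _ =>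
          mul_le_mul_of_nonneg_left (Real.log_le_log (hκ k) (hb k)) (hF.logGrad_nonneg hκ k)
      _ = _ := by rw [← Finset.sum_mul, hF.sum_logGrad hκ, one_mul]
  exact (Real.log_le_log_iff (hF.pos κ hκ) hb0).1 (by linarith)

/-- The tangent at `(1, …, 1)`, where symmetry makes all weights `1/n`: `F` is at least the
geometric mean. -/
theorem prod_le_pow (hn : n ≠ 0) (hκ : κ ∈ posCone n) : ∏ k, κ k ≤ F κ ^ n := by
  have h1 : (fun _ => 1 : Fin n → ℝ) ∈ posCone n := fun _ => zero_lt_one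
  have hn' : (n : ℝ) ≠ 0 := Nat.cast_ne_zero.2 hn
  have hw : ∀ k, logGrad F (fun _ => 1) k = 1 / n := by
    intro k
    have h2 := hF.sum_logGrad h1
    have h3 : ∀ l, logGrad F (fun _ => 1) l = logGrad F (fun _ => 1) k := fun l => by
      simp only [logGrad, hF.dF_eq_of_eq h1 (k := l) (l := k) rfl]
    rw [Finset.sum_congr rfl fun l _ => h3 l, Finset.sum_const, Finset.card_univ, Fintype.card_fin,
      nsmul_eq_mul] at h2
    field_simp
    linarith
  have h := hF.log_le h1 hκ
  simp only [hF.normalized, hw, Real.log_one, sub_zero, zero_add, ← Finset.mul_sum] at h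
  rw [← Real.log_prod fun k _ => (hκ k).ne'] at h
  have hp : 0 < ∏ k, κ k := Finset.prod_pos fun k _ => hκ k
  rw [← Real.log_le_log_iff hp (pow_pos (hF.pos κ hκ) n), Real.log_pow]
  have h5 : (n : ℝ) * (1 / n * Real.log (∏ k, κ k)) = Real.log (∏ k, κ k) := by field_simp
  rw [← h5]
  exact mul_le_mul_of_nonneg_left h (Nat.cast_nonneg n)

end IsSpeed

/-- Put `x = κ_0`, `y = κ_1`, `z = κ_{n-1}`. The product of all curvatures is at least `x y^{n-2} z`
and at most `F^n`, so `c^n (x y^{n-2} z)² ≤ (xy)^n`. The right side is at most `xz · x² y^{2n-4}`,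
by `x ≤ y` used `n - 3` times and `y ≤ z` used once; cancellation leaves `c^n z ≤ x`. -/
theorem pinching_bound {m : ℕ} {F : (Fin (m + 3) → ℝ) → ℝ} (hF : IsSpeed F)
    {κ : Fin (m + 3) → ℝ} (hκ : κ ∈ posCone (m + 3)) (hm : Monotone κ) {c : ℝ} (hc : 0 < c)
    (h : c * F κ ^ 2 ≤ κ 0 * κ 1) : κ (Fin.last (m + 2)) ≤ (c ^ (m + 3))⁻¹ * κ 0 := by
  have hx := hκ 0
  have hy := hκ 1
  have hz := hκ (Fin.last (m + 2))
  have hxy : κ 0 ≤ κ 1 := hm (Fin.zero_le _)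
  have hyz : κ 1 ≤ κ (Fin.last (m + 2)) := hm (Fin.le_last _)
  have hprod : κ 0 * κ 1 ^ (m + 1) * κ (Fin.last (m + 2)) ≤ ∏ k, κ k := by
    rw [Fin.prod_univ_succ, Fin.prod_univ_castSucc, ← mul_assoc]
    refine mul_le_mul_of_nonneg_right (mul_le_mul_of_nonneg_left ?_ hx.le) hz.le
    calc κ 1 ^ (m + 1) = ∏ j : Fin (m + 1), κ 1 := by simp
      _ ≤ _ := by
        refine Finset.prod_le_prod (fun _ _ => hy.le) fun j _ => hm ?_
        rw [Fin.le_def]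
        simp
  have hFn := hF.prod_le_pow (by omega) hκ
  have hF0 := hF.pos κ hκ
  set x := κ 0
  set y := κ 1
  set z := κ (Fin.last (m + 2))
  have h1 : c ^ (m + 3) * (x * y ^ (m + 1) * z) ^ 2 ≤ (x * y) ^ (m + 3) := by
    calc c ^ (m + 3) * (x * y ^ (m + 1) * z) ^ 2 ≤ c ^ (m + 3) * (F κ ^ (m + 3)) ^ 2 := by
          have := hprod.trans hFn
          gcongr
      _ = (c * F κ ^ 2) ^ (m + 3) := by rw [mul_pow]; ring
      _ ≤ _ := pow_le_pow_left₀ (by positivity) h _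
  have h2 : (x * y) ^ (m + 3) ≤ (x * z) * (x ^ 2 * y ^ (2 * m + 2)) := by
    calc (x * y) ^ (m + 3) = x ^ m * (x ^ 3 * y ^ (m + 2) * y) := by ring
      _ ≤ y ^ m * (x ^ 3 * y ^ (m + 2) * z) := by gcongr
      _ = _ := by ring
  have h3 : (c ^ (m + 3) * z) * (z * x ^ 2 * y ^ (2 * m + 2))
      ≤ x * (z * x ^ 2 * y ^ (2 * m + 2)) := by
    calc _ = c ^ (m + 3) * (x * y ^ (m + 1) * z) ^ 2 := by ring
      _ ≤ _ := h1.trans h2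
      _ = _ := by ring
  have h4 := le_of_mul_le_mul_right h3 (by positivity)
  rw [inv_mul_eq_div, le_div_iff₀ (by positivity)]
  linarith

/-! ### Algebraic inequalities at a first zero of the pinching quantity -/

theorem quadratic_head_nonneg {x y w F c f s : ℝ} (hx : 0 < x) (hy : 0 < y) (hF : 0 < F)
    (hc : 0 < c) (hw0 : 0 ≤ w) (hw : w ≤ 1 / 2) (hcF : c * F ^ 2 = x * y - 1)
    (hs : s = 2 * c * F * f) :
    0 ≤ y * f ^ 2 / F ^ 2 - w * s ^ 2 / (x ^ 2 * y) + 2 * c * w * f ^ 2 / x := by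
  have hP : 1 < x * y := by nlinarith [mul_pos hc (pow_pos hF 2)]
  have h1 : y * f ^ 2 / F ^ 2 - w * s ^ 2 / (x ^ 2 * y) + 2 * c * w * f ^ 2 / x
      = f ^ 2 / (F ^ 2 * x ^ 2 * y) *
        (x ^ 2 * y ^ 2 - 4 * w * (c * F ^ 2) ^ 2 + 2 * w * (c * F ^ 2) * (x * y)) := by
    rw [hs]; field_simp; ring
  rw [h1, hcF]
  apply mul_nonneg (by positivity)
  set P := x * y
  have h2 : x ^ 2 * y ^ 2 = P ^ 2 := by simp only [P]; ring
  rw [h2]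
  -- The bracket is affine in `w`, with values `P²` at `w = 0` and `3P - 2` at `w = 1/2`. Both are
  -- positive since `P > 1`.
  nlinarith [mul_nonneg hw0 (sub_nonneg.2 hP.le), mul_nonneg (sub_nonneg.2 hw) (sq_nonneg (P - 1)),
    mul_nonneg (mul_nonneg hw0 (sub_nonneg.2 hP.le)) (sub_nonneg.2 hP.le)]

/-- The part of the gradient terms with all indices in `{0, 1}`; `a, b, d, e` stand for the
derivatives of `h` with indices 000, 001, 011, 111. The expression regroups into the squares of the
first order conditions, handled by `quadratic_head_nonneg`, plus terms with the nonnegative factor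
`w₁ - w₀`. -/
theorem head_nonneg {x y w₀ w₁ F c f₀ f₁ a b d e : ℝ} (hx : 0 < x) (hy : 0 < y) (hF : 0 < F)
    (hc : 0 < c) (hw0 : 0 ≤ w₀) (hw01 : w₀ ≤ w₁) (hw : w₁ ≤ 1 / 2) (hcF : c * F ^ 2 = x * y - 1)
    (h0 : y * a + x * d = 2 * c * F * f₀) (h1 : y * b + x * e = 2 * c * F * f₁) :
    0 ≤ y * f₀ ^ 2 / F ^ 2 + x * f₁ ^ 2 / F ^ 2
      - y * (w₀ * a ^ 2 / (x * x) + 2 * (w₀ * b ^ 2 / (x * y)) + w₁ * d ^ 2 / (y * y))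
      - x * (w₀ * b ^ 2 / (x * x) + 2 * (w₀ * d ^ 2 / (x * y)) + w₁ * e ^ 2 / (y * y))
      + w₀ / x * (2 * c * f₀ ^ 2 - 2 * a * d + 2 * b ^ 2)
      + w₁ / y * (2 * c * f₁ ^ 2 - 2 * b * e + 2 * d ^ 2) := by
  have e0 := quadratic_head_nonneg hx hy hF hc hw0 (hw01.trans hw) hcF h0
  have e1 := quadratic_head_nonneg (x := y) (y := x) hy hx hF hc (hw0.trans hw01) hw
    (by rw [hcF]; ring) h1
  have r0 : 0 ≤ (w₁ - w₀) * d ^ 2 / y := by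
    have := sub_nonneg.2 hw01
    positivity
  have r1 : 0 ≤ (w₁ - w₀) * b ^ 2 / x := by
    have := sub_nonneg.2 hw01
    positivity
  have key : y * f₀ ^ 2 / F ^ 2 + x * f₁ ^ 2 / F ^ 2
      - y * (w₀ * a ^ 2 / (x * x) + 2 * (w₀ * b ^ 2 / (x * y)) + w₁ * d ^ 2 / (y * y))
      - x * (w₀ * b ^ 2 / (x * x) + 2 * (w₀ * d ^ 2 / (x * y)) + w₁ * e ^ 2 / (y * y))
      + w₀ / x * (2 * c * f₀ ^ 2 - 2 * a * d + 2 * b ^ 2)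
      + w₁ / y * (2 * c * f₁ ^ 2 - 2 * b * e + 2 * d ^ 2)
    = (y * f₀ ^ 2 / F ^ 2 - w₀ * (y * a + x * d) ^ 2 / (x ^ 2 * y) + 2 * c * w₀ * f₀ ^ 2 / x)
      + (x * f₁ ^ 2 / F ^ 2 - w₁ * (y * b + x * e) ^ 2 / (y ^ 2 * x) + 2 * c * w₁ * f₁ ^ 2 / y)
      + (w₁ - w₀) * d ^ 2 / y + (w₁ - w₀) * b ^ 2 / x := by
    field_simp; ring
  rw [key]
  linarith

/-- The arithmetic-geometric mean inequality: `4xy·ad ≤ (ya + xd)² = 4(xy - 1)·c f²`. -/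
theorem mul_le_of_linear_relation {x y F c f a d : ℝ} (hx : 0 < x) (hy : 0 < y)
    (hcF : c * F ^ 2 = x * y - 1) (hc : 0 < c) (h : y * a + x * d = 2 * c * F * f) :
    a * d ≤ c * f ^ 2 := by
  have h1 : 4 * (x * y) * (a * d) ≤ (y * a + x * d) ^ 2 := by nlinarith [sq_nonneg (y * a - x * d)]
  rw [h] at h1
  have h2 : (2 * c * F * f) ^ 2 = 4 * (x * y - 1) * (c * f ^ 2) := by rw [← hcF]; ring
  have h3 : 0 ≤ c * f ^ 2 := by positivity
  have h4 : (x * y) * (a * d) ≤ (x * y) * (c * f ^ 2) := by nlinarith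
  exact le_of_mul_le_mul_left h4 (mul_pos hx hy)

theorem sum_univ_two_add {m : ℕ} (φ : Fin (m + 3) → ℝ) :
    ∑ k, φ k = φ 0 + φ 1 + ∑ j : Fin (m + 1), φ j.succ.succ := by
  rw [Fin.sum_univ_succ, Fin.sum_univ_succ, ← add_assoc]
  rfl

theorem double_sum_univ_two_add {m : ℕ} (S : Fin (m + 3) → Fin (m + 3) → ℝ)
    (hS : ∀ k l, S k l = S l k) :
    ∑ k, ∑ l, S k l = S 0 0 + 2 * S 0 1 + S 1 1 + 2 * ∑ j : Fin (m + 1), S 0 j.succ.succ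
      + 2 * ∑ j : Fin (m + 1), S 1 j.succ.succ
      + ∑ k : Fin (m + 1), ∑ l : Fin (m + 1), S k.succ.succ l.succ.succ := by
  simp only [sum_univ_two_add, Finset.sum_add_distrib, hS 1 0, hS (Fin.succ _) 0,
    hS (Fin.succ _) 1]
  ring

/-- `T` is the derivative of `h`, totally symmetric by Codazzi. Split the indices into `{0, 1}` and
the rest. The block with all indices in `{0, 1}` is `head_nonneg`, which needs `w₁ ≤ 1/2`; this
holds because `w₁ ≤ w₂` and the weights sum to 1. Terms with one index above 1 in the double sums
cancel exactly against the gains from moving the test vectors; those with two such indices are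
dominated by `htt`. -/
theorem gradient_terms_nonneg {m : ℕ} {κ w f : Fin (m + 3) → ℝ} {F c : ℝ}
    {T : Fin (m + 3) → Fin (m + 3) → Fin (m + 3) → ℝ} (hκ : ∀ i, 0 < κ i)
    (hw0 : ∀ i, 0 ≤ w i) (hwm : Monotone w) (hws : ∑ i, w i = 1) (hF : 0 < F) (hc : 0 < c)
    (hcF : c * F ^ 2 = κ 0 * κ 1 - 1) (hT1 : ∀ k i j, T k i j = T i k j)
    (hT2 : ∀ k i j, T k i j = T k j i)
    (h1 : ∀ k, κ 1 * T k 0 0 + κ 0 * T k 1 1 = 2 * c * F * f k) :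
    0 ≤ κ 1 * f 0 ^ 2 / F ^ 2 + κ 0 * f 1 ^ 2 / F ^ 2
      - κ 1 * ∑ k, ∑ l, w (min k l) * T 0 k l ^ 2 / (κ k * κ l)
      - κ 0 * ∑ k, ∑ l, w (min k l) * T 1 k l ^ 2 / (κ k * κ l)
      + ∑ k, w k / κ k * (2 * c * f k ^ 2 - 2 * T k 0 0 * T k 1 1 + 2 * T k 0 1 ^ 2
        + 2 * κ 1 * ∑ j : Fin (m + 1), T k 0 j.succ.succ ^ 2 / κ j.succ.succ
        + 2 * κ 0 * ∑ j : Fin (m + 1), T k 1 j.succ.succ ^ 2 / κ j.succ.succ) := by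
  have hw1 : w 1 ≤ 1 / 2 := by
    rw [Fin.sum_univ_succ, Fin.sum_univ_succ, Fin.sum_univ_succ] at hws
    have e2 : w 1 ≤ w (Fin.succ (Fin.succ (0 : Fin (m + 1)))) := hwm (by
      rw [Fin.le_def, Fin.val_one]; exact Nat.succ_le_succ (Nat.zero_le _))
    have e3 : 0 ≤ ∑ i : Fin m, w i.succ.succ.succ := Finset.sum_nonneg fun i _ => hw0 _
    have e4 := hw0 0
    simp only [Fin.succ_zero_eq_one] at hws e2
    linarith
  have hhead := head_nonneg (hκ 0) (hκ 1) hF hc (hw0 0) (hwm (Fin.zero_le 1)) hw1 hcF (h1 0) (h1 1)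
  have htail : ∀ j : Fin (m + 1), 0 ≤ w j.succ.succ / κ j.succ.succ *
      (2 * c * f j.succ.succ ^ 2 - 2 * T j.succ.succ 0 0 * T j.succ.succ 1 1
        + 2 * T j.succ.succ 0 1 ^ 2) := by
    intro j
    have := mul_le_of_linear_relation (hκ 0) (hκ 1) hcF hc (h1 j.succ.succ)
    refine mul_nonneg (div_nonneg (hw0 _) (hκ _).le) ?_
    nlinarith [sq_nonneg (T j.succ.succ 0 1)]
  -- Replacing `w (min k l)` by `w k` is enough, with a factor 2 to spare.
  have htt : ∀ (i : Fin (m + 3)), ∑ k : Fin (m + 1), ∑ l : Fin (m + 1),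
        w (min k.succ.succ l.succ.succ) * T i k.succ.succ l.succ.succ ^ 2
          / (κ k.succ.succ * κ l.succ.succ)
      ≤ ∑ k : Fin (m + 1), w k.succ.succ / κ k.succ.succ *
        (2 * ∑ j : Fin (m + 1), T k.succ.succ i j.succ.succ ^ 2 / κ j.succ.succ) := by
    intro i
    refine Finset.sum_le_sum fun k _ => ?_
    rw [Finset.mul_sum, Finset.mul_sum]
    refine Finset.sum_le_sum fun l _ => ?_
    have e1 : w (min k.succ.succ l.succ.succ) ≤ w k.succ.succ := hwm (min_le_left _ _)
    have e2 := hκ k.succ.succ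
    have e3 := hκ l.succ.succ
    have e4 := hw0 k.succ.succ
    rw [hT1 k.succ.succ i]
    have e5 : w k.succ.succ / κ k.succ.succ * (2 * (T i k.succ.succ l.succ.succ ^ 2 / κ l.succ.succ))
      = 2 * w k.succ.succ * T i k.succ.succ l.succ.succ ^ 2 / (κ k.succ.succ * κ l.succ.succ) := by
      field_simp
    rw [e5]
    gcongr
    linarith
  have hsum : 0 ≤ ∑ j : Fin (m + 1), w j.succ.succ / κ j.succ.succ *
      (2 * c * f j.succ.succ ^ 2 - 2 * T j.succ.succ 0 0 * T j.succ.succ 1 1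
        + 2 * T j.succ.succ 0 1 ^ 2) := Finset.sum_nonneg fun j _ => htail j
  have t0 := mul_le_mul_of_nonneg_left (htt 0) (hκ 1).le
  have t1 := mul_le_mul_of_nonneg_left (htt 1) (hκ 0).le
  have hsymm : ∀ i k l, w (min k l) * T i k l ^ 2 / (κ k * κ l)
      = w (min l k) * T i l k ^ 2 / (κ l * κ k) := by
    intro i k l
    rw [min_comm, hT2 i k l, mul_comm (κ k)]
  have hmin0 : ∀ j : Fin (m + 1), min 0 j.succ.succ = (0 : Fin (m + 3)) := fun j =>
    min_eq_left (Fin.zero_le _)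
  have hmin1 : ∀ j : Fin (m + 1), min 1 j.succ.succ = (1 : Fin (m + 3)) := fun j =>
    min_eq_left (by rw [Fin.le_def, Fin.val_one]; simp)
  have hrow : ∀ (i a : Fin (m + 3)), (∀ j : Fin (m + 1), min a j.succ.succ = a) →
      ∑ j : Fin (m + 1), w (min a j.succ.succ) * T i a j.succ.succ ^ 2 / (κ a * κ j.succ.succ)
        = w a / κ a * ∑ j : Fin (m + 1), T i a j.succ.succ ^ 2 / κ j.succ.succ := by
    intro i a ha
    rw [Finset.mul_sum]
    refine Finset.sum_congr rfl fun j _ => ?_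
    rw [ha]
    have := (hκ a).ne'
    have := (hκ j.succ.succ).ne'
    field_simp
  rw [double_sum_univ_two_add _ (hsymm 0), double_sum_univ_two_add _ (hsymm 1),
    hrow 0 0 hmin0, hrow 0 1 hmin1, hrow 1 0 hmin0, hrow 1 1 hmin1, sum_univ_two_add]
  have hsplit : ∑ k : Fin (m + 1), w k.succ.succ / κ k.succ.succ *
        (2 * c * f k.succ.succ ^ 2 - 2 * T k.succ.succ 0 0 * T k.succ.succ 1 1
        + 2 * T k.succ.succ 0 1 ^ 2
        + 2 * κ 1 * ∑ j : Fin (m + 1), T k.succ.succ 0 j.succ.succ ^ 2 / κ j.succ.succ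
        + 2 * κ 0 * ∑ j : Fin (m + 1), T k.succ.succ 1 j.succ.succ ^ 2 / κ j.succ.succ)
      = ∑ j : Fin (m + 1), w j.succ.succ / κ j.succ.succ *
      (2 * c * f j.succ.succ ^ 2 - 2 * T j.succ.succ 0 0 * T j.succ.succ 1 1
        + 2 * T j.succ.succ 0 1 ^ 2)
        + κ 1 * ∑ k : Fin (m + 1), w k.succ.succ / κ k.succ.succ *
        (2 * ∑ j : Fin (m + 1), T k.succ.succ 0 j.succ.succ ^ 2 / κ j.succ.succ)
        + κ 0 * ∑ k : Fin (m + 1), w k.succ.succ / κ k.succ.succ *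
        (2 * ∑ j : Fin (m + 1), T k.succ.succ 1 j.succ.succ ^ 2 / κ j.succ.succ) := by
    rw [Finset.mul_sum, Finset.mul_sum, ← Finset.sum_add_distrib, ← Finset.sum_add_distrib]
    exact Finset.sum_congr rfl fun k _ => by ring
  rw [hsplit]
  have hm01 : min 0 1 = (0 : Fin (m + 3)) := min_eq_left (Fin.zero_le _)
  rw [min_self, min_self, hm01, hT1 1 0 0, hT2 0 1 0, hT1 1 0 1]
  have hT101 : ∀ j : Fin (m + 1), T 1 0 j.succ.succ = T 0 1 j.succ.succ := fun j => hT1 1 0 _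
  simp only [hT101]
  have ek0 := (hκ 0).ne'
  have ek1 := (hκ 1).ne'
  have ea : w 0 / κ 0 * κ 0 = w 0 := div_mul_cancel₀ _ ek0
  have eb : w 1 / κ 1 * κ 1 = w 1 := div_mul_cancel₀ _ ek1
  rw [hT1 1 0 0, hT2 0 1 0] at hhead
  linarith

/-- By Euler's relation `F = Σ F_k κ_k`, with `F_k = F w_k / κ_k`, everything collapses to `Σ F_k ·
2((κ_k - κ_0)(κ_k - κ_1) + κ_0 κ_1 - 1)`. No `κ_k` lies strictly between `κ_0` and `κ_1`, and `κ_0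
κ_1 - 1 = c F² > 0`. -/
theorem zeroth_order_terms_pos {m : ℕ} {κ w : Fin (m + 3) → ℝ} {F c : ℝ} (hκ : ∀ i, 0 < κ i)
    (hm : Monotone κ) (hw0 : ∀ i, 0 ≤ w i) (hws : ∑ i, w i = 1) (hF : 0 < F) (hc : 0 < c)
    (hcF : c * F ^ 2 = κ 0 * κ 1 - 1) :
    0 < κ 1 * ∑ k, F * w k / κ k * ((κ 0 * κ k - 1) * (κ k - κ 0))
      + κ 0 * ∑ k, F * w k / κ k * ((κ 1 * κ k - 1) * (κ k - κ 1))
      + κ 1 * (-F * κ 0 ^ 2 - F) + κ 0 * (-F * κ 1 ^ 2 - F)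
      + 2 * (κ 0 * κ 1) * F * (κ 0 + κ 1)
      - 2 * c * F * ∑ k, F * w k / κ k * (F * κ k ^ 2 - F) := by
  have hP : 0 < κ 0 * κ 1 - 1 := by rw [← hcF]; positivity
  have hFs : F = ∑ k, F * w k / κ k * κ k := by
    rw [Finset.sum_congr rfl fun k _ => div_mul_cancel₀ (F * w k) (hκ k).ne', ← Finset.mul_sum,
      hws, mul_one]
  have hrw : κ 1 * ∑ k, F * w k / κ k * ((κ 0 * κ k - 1) * (κ k - κ 0))
      + κ 0 * ∑ k, F * w k / κ k * ((κ 1 * κ k - 1) * (κ k - κ 1))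
      + κ 1 * (-F * κ 0 ^ 2 - F) + κ 0 * (-F * κ 1 ^ 2 - F)
      + 2 * (κ 0 * κ 1) * F * (κ 0 + κ 1)
      - 2 * c * F * ∑ k, F * w k / κ k * (F * κ k ^ 2 - F)
      = ∑ k, F * w k / κ k * (2 * ((κ k - κ 0) * (κ k - κ 1) + (κ 0 * κ 1 - 1))) := by
    have e1 : κ 1 * (-F * κ 0 ^ 2 - F) + κ 0 * (-F * κ 1 ^ 2 - F)
        + 2 * (κ 0 * κ 1) * F * (κ 0 + κ 1)
        = ∑ k, F * w k / κ k * (κ k * (κ 1 * (κ 0 ^ 2 - 1) + κ 0 * (κ 1 ^ 2 - 1))) := by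
      simp only [← mul_assoc]
      rw [← Finset.sum_mul, ← hFs]
      ring
    have e2 : 2 * c * F * ∑ k, F * w k / κ k * (F * κ k ^ 2 - F)
        = ∑ k, F * w k / κ k * (2 * (κ 0 * κ 1 - 1) * (κ k ^ 2 - 1)) := by
      rw [← hcF, Finset.mul_sum]
      exact Finset.sum_congr rfl fun k _ => by ring
    have e3 : ∀ A B : ℝ, A + B + κ 1 * (-F * κ 0 ^ 2 - F) + κ 0 * (-F * κ 1 ^ 2 - F)
      + 2 * (κ 0 * κ 1) * F * (κ 0 + κ 1) = A + B + (κ 1 * (-F * κ 0 ^ 2 - F)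
        + κ 0 * (-F * κ 1 ^ 2 - F) + 2 * (κ 0 * κ 1) * F * (κ 0 + κ 1)) := fun A B => by ring
    rw [e3, e1, e2, Finset.mul_sum, Finset.mul_sum, ← Finset.sum_add_distrib,
      ← Finset.sum_add_distrib, ← Finset.sum_sub_distrib]
    exact Finset.sum_congr rfl fun k _ => by ring
  rw [hrw]
  have hq : ∀ k, 0 ≤ (κ k - κ 0) * (κ k - κ 1) := by
    intro k
    rcases eq_or_ne k 0 with rfl | h
    · simp
    · have h1 : κ 1 ≤ κ k := hm (by
        rw [Fin.le_def, Fin.val_one]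
        exact Nat.one_le_iff_ne_zero.2 (fun hk => h (Fin.ext hk)))
      have h0 : κ 0 ≤ κ k := hm (Fin.zero_le _)
      exact mul_nonneg (by linarith) (by linarith)
  obtain ⟨k, -, hk⟩ : ∃ k ∈ Finset.univ, 0 < w k := by
    by_contra! hcon
    have := Finset.sum_nonpos hcon
    linarith
  refine Finset.sum_pos' (fun k _ => ?_) ⟨k, Finset.mem_univ _, ?_⟩
  · exact mul_nonneg (div_nonneg (mul_nonneg hF.le (hw0 k)) (hκ k).le) (by linarith [hq k])
  · exact mul_pos (div_pos (mul_pos hF hk) (hκ k)) (by linarith [hq k])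

/-- The pointwise inequality behind the maximum principle: the first and second order conditions at
a first zero of the pinching quantity are contradictory. -/
theorem false_of_jet_conditions {m : ℕ} {κ w f ff : Fin (m + 3) → ℝ} {F c ft : ℝ}
    {T : Fin (m + 3) → Fin (m + 3) → Fin (m + 3) → ℝ} {hh gg : Fin (m + 3) → Fin (m + 3) → ℝ}
    (hκ : ∀ i, 0 < κ i) (hm : Monotone κ) (hw0 : ∀ i, 0 ≤ w i) (hwm : Monotone w)
    (hws : ∑ i, w i = 1) (hF : 0 < F) (hc : 0 < c)
    (hcF : c * F ^ 2 = κ 0 * κ 1 - 1) (hT1 : ∀ k i j, T k i j = T i k j)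
    (hT2 : ∀ k i j, T k i j = T k j i)
    (h1 : ∀ k, κ 1 * T k 0 0 + κ 0 * T k 1 1 = 2 * c * F * f k)
    (h2 : ∀ k, ∀ r s : Fin (m + 1) → ℝ, 0 ≤
      κ 1 * (hh 0 k - 4 * ∑ j, r j * T k 0 j.succ.succ + 2 * ∑ j, r j ^ 2 * κ j.succ.succ)
      + κ 0 * (hh 1 k - 4 * ∑ j, s j * T k 1 j.succ.succ + 2 * ∑ j, s j ^ 2 * κ j.succ.succ)
      + 2 * T k 0 0 * T k 1 1 - 2 * T k 0 1 ^ 2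
      - κ 0 * κ 1 * (gg 0 k + 2 * ∑ j, r j ^ 2 + (gg 1 k + 2 * ∑ j, s j ^ 2))
      - 2 * c * (f k ^ 2 + F * ff k))
    (h3 : ∀ i, i = 0 ∨ i = 1 → ∑ k, w k * (hh k i / κ k - gg k i)
      - ∑ k, ∑ l, w (min k l) * T i k l ^ 2 / (κ k * κ l) ≤ ff i / F - (f i / F) ^ 2)
    (h4 : ft ≤ ∑ k, F * w k / κ k * (ff k + F * κ k ^ 2 - F))
    (h5 : κ 1 * (ff 0 - F * κ 0 ^ 2 - F) + κ 0 * (ff 1 - F * κ 1 ^ 2 - F)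
      + 2 * (κ 0 * κ 1) * F * (κ 0 + κ 1) - 2 * c * F * ft ≤ 0)
    (h6 : ∀ i k, i ≠ k → (hh k i - κ k * gg k i) - (hh i k - κ i * gg i k)
      = (κ i * κ k - 1) * (κ k - κ i)) : False := by
  -- The hypotheses in analytic terms: `h1` and `h2` are the spatial first and second order
  -- conditions for the pinching form, with `r` and `s` the free motion of the test vectors; `h3`
  -- and `h4` come from the barrier below `log F`; `h5` is the time derivative of the pinching form;
  -- `h6` is Simons' identity. The factor `F w_k / κ_k` plays the role of `∂F/∂κ_k`.
  have hgrad := gradient_terms_nonneg hκ hw0 hwm hws hF hc hcF hT1 hT2 h1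
  have hzero := zeroth_order_terms_pos hκ hm hw0 hws hF hc hcF
  have h6' : ∀ i k, hh k i - κ k * gg k i
      = (hh i k - κ i * gg i k) + (κ i * κ k - 1) * (κ k - κ i) := by
    intro i k
    rcases eq_or_ne i k with rfl | h
    · ring
    · linarith [h6 i k h]
  have h3' : ∀ i, i = 0 ∨ i = 1 → ∑ k, F * w k / κ k * (hh i k - κ i * gg i k)
      + ∑ k, F * w k / κ k * ((κ i * κ k - 1) * (κ k - κ i))
      + f i ^ 2 / F - F * ∑ k, ∑ l, w (min k l) * T i k l ^ 2 / (κ k * κ l) ≤ ff i := by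
    intro i hi
    have h := mul_le_mul_of_nonneg_left (h3 i hi) hF.le
    have e1 : F * (ff i / F - (f i / F) ^ 2) = ff i - f i ^ 2 / F := by field_simp
    have e2 : F * ∑ k, w k * (hh k i / κ k - gg k i)
        = ∑ k, F * w k / κ k * (hh i k - κ i * gg i k)
          + ∑ k, F * w k / κ k * ((κ i * κ k - 1) * (κ k - κ i)) := by
      rw [Finset.mul_sum, ← Finset.sum_add_distrib]
      refine Finset.sum_congr rfl fun k _ => ?_
      rw [← mul_add, ← h6' i k]
      have := (hκ k).ne'
      field_simp
    rw [mul_sub, e1, e2] at h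
    linarith
  have a0 := mul_le_mul_of_nonneg_left (h3' 0 (Or.inl rfl)) (hκ 1).le
  have a1 := mul_le_mul_of_nonneg_left (h3' 1 (Or.inr rfl)) (hκ 0).le
  have a4 := mul_le_mul_of_nonneg_left h4 (by positivity : 0 ≤ 2 * c * F)
  -- the spatial second order condition in the optimal direction
  have h2' : ∀ k, 2 * c * f k ^ 2 - 2 * T k 0 0 * T k 1 1 + 2 * T k 0 1 ^ 2
        + 2 * κ 1 * ∑ j : Fin (m + 1), T k 0 j.succ.succ ^ 2 / κ j.succ.succ
        + 2 * κ 0 * ∑ j : Fin (m + 1), T k 1 j.succ.succ ^ 2 / κ j.succ.succ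
      ≤ κ 1 * (hh 0 k - κ 0 * gg 0 k) + κ 0 * (hh 1 k - κ 1 * gg 1 k) - 2 * c * F * ff k := by
    intro k
    have h := h2 k (fun j => T k 0 j.succ.succ / κ j.succ.succ)
      (fun j => T k 1 j.succ.succ / κ j.succ.succ)
    have e1 : ∀ i : Fin (m + 3), ∑ j : Fin (m + 1), T k i j.succ.succ / κ j.succ.succ
        * T k i j.succ.succ = ∑ j : Fin (m + 1), T k i j.succ.succ ^ 2 / κ j.succ.succ := fun i =>
      Finset.sum_congr rfl fun j _ => by ring
    have e2 : ∀ i : Fin (m + 3), ∑ j : Fin (m + 1), (T k i j.succ.succ / κ j.succ.succ) ^ 2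
        * κ j.succ.succ = ∑ j : Fin (m + 1), T k i j.succ.succ ^ 2 / κ j.succ.succ := fun i =>
      Finset.sum_congr rfl fun j _ => by
        have := (hκ j.succ.succ).ne'
        field_simp
    rw [e1, e1, e2, e2] at h
    -- The change in length of the moved vectors enters with a favourable sign and is dropped.
    have e3 : ∀ i : Fin (m + 3), 0 ≤ κ 0 * κ 1 *
        ∑ j : Fin (m + 1), (T k i j.succ.succ / κ j.succ.succ) ^ 2 := fun i =>
      mul_nonneg (mul_pos (hκ 0) (hκ 1)).le (Finset.sum_nonneg fun _ _ => sq_nonneg _)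
    linarith [e3 0, e3 1]
  have h2s := Finset.sum_le_sum fun k (_ : k ∈ Finset.univ) =>
    mul_le_mul_of_nonneg_left (h2' k) (div_nonneg (mul_nonneg hF.le (hw0 k)) (hκ k).le)
  have e5 : ∑ k, F * w k / κ k * (κ 1 * (hh 0 k - κ 0 * gg 0 k) + κ 0 * (hh 1 k - κ 1 * gg 1 k)
      - 2 * c * F * ff k) = κ 1 * ∑ k, F * w k / κ k * (hh 0 k - κ 0 * gg 0 k)
      + κ 0 * ∑ k, F * w k / κ k * (hh 1 k - κ 1 * gg 1 k)
      - 2 * c * F * ∑ k, F * w k / κ k * ff k := by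
    rw [Finset.mul_sum, Finset.mul_sum, Finset.mul_sum, ← Finset.sum_add_distrib,
      ← Finset.sum_sub_distrib]
    exact Finset.sum_congr rfl fun k _ => by ring
  have e6 : ∑ k, F * w k / κ k * (ff k + F * κ k ^ 2 - F)
      = ∑ k, F * w k / κ k * ff k + ∑ k, F * w k / κ k * (F * κ k ^ 2 - F) := by
    rw [← Finset.sum_add_distrib]
    exact Finset.sum_congr rfl fun k _ => by ring
  rw [e5] at h2s
  rw [e6] at a4
  have hgradF := mul_nonneg hF.le hgrad
  have e7 : ∀ φ : Fin (m + 3) → ℝ, ∑ k, F * w k / κ k * φ k = F * ∑ k, w k / κ k * φ k := by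
    intro φ
    rw [Finset.mul_sum]
    exact Finset.sum_congr rfl fun k _ => by ring
  have e8 : F * (κ 1 * f 0 ^ 2 / F ^ 2) = κ 1 * (f 0 ^ 2 / F) := by field_simp
  have e9 : F * (κ 0 * f 1 ^ 2 / F ^ 2) = κ 0 * (f 1 ^ 2 / F) := by field_simp
  rw [mul_add, mul_sub, mul_sub, mul_add, e8, e9, ← e7] at hgradF
  linarith

/-! ### Second order jets of functions of one variable -/

/-- `φ(0) = a`, `φ'(0) = b` and `φ''(0) = c`. -/
def HasJet (φ : ℝ → ℝ) (a b c : ℝ) : Prop :=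
  ∃ φ' : ℝ → ℝ, (∀ᶠ s in 𝓝 0, HasDerivAt φ (φ' s) s) ∧ φ 0 = a ∧ φ' 0 = b ∧ HasDerivAt φ' c 0

namespace HasJet

variable {φ ψ : ℝ → ℝ} {a b c a' b' c' : ℝ}

theorem const (a : ℝ) : HasJet (fun _ => a) a 0 0 :=
  ⟨fun _ => 0, Filter.Eventually.of_forall fun _ => hasDerivAt_const _ _, rfl, rfl,
    hasDerivAt_const _ _⟩

theorem id : HasJet (fun s => s) 0 1 0 :=
  ⟨fun _ => 1, Filter.Eventually.of_forall fun _ => hasDerivAt_id _, rfl, rfl,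
    hasDerivAt_const _ _⟩

theorem add (h : HasJet φ a b c) (h' : HasJet ψ a' b' c') :
    HasJet (fun s => φ s + ψ s) (a + a') (b + b') (c + c') := by
  obtain ⟨φ', h1, rfl, rfl, h4⟩ := h
  obtain ⟨ψ', k1, rfl, rfl, k4⟩ := h'
  refine ⟨fun s => φ' s + ψ' s, ?_, rfl, rfl, h4.add k4⟩
  filter_upwards [h1, k1] with s hs ks using hs.add ks

theorem mul (h : HasJet φ a b c) (h' : HasJet ψ a' b' c') :
    HasJet (fun s => φ s * ψ s) (a * a') (b * a' + a * b') (c * a' + 2 * b * b' + a * c') := by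
  obtain ⟨φ', h1, rfl, rfl, h4⟩ := h
  obtain ⟨ψ', k1, rfl, rfl, k4⟩ := h'
  refine ⟨fun s => φ' s * ψ s + φ s * ψ' s, ?_, rfl, rfl, ?_⟩
  · filter_upwards [h1, k1] with s hs ks using hs.mul ks
  · exact ((h4.fun_mul k1.self_of_nhds).fun_add (h1.self_of_nhds.fun_mul k4)).congr_deriv (by ring)

theorem congr_jet (h : HasJet φ a b c) (ha : a = a') (hb : b = b') (hc : c = c') :
    HasJet φ a' b' c' := by subst ha hb hc; exact h

theorem congr (h : HasJet φ a b c) (h' : ∀ s, ψ s = φ s) : HasJet ψ a b c := by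
  have : ψ = φ := funext h'
  rwa [this]

theorem const_mul (k : ℝ) (h : HasJet φ a b c) :
    HasJet (fun s => k * φ s) (k * a) (k * b) (k * c) :=
  ((const k).mul h).congr_jet (by ring) (by ring) (by ring)

theorem sub (h : HasJet φ a b c) (h' : HasJet ψ a' b' c') :
    HasJet (fun s => φ s - ψ s) (a - a') (b - b') (c - c') :=
  ((h.add (h'.const_mul (-1))).congr fun s => by ring).congr_jet (by ring) (by ring) (by ring)

theorem sum {ι : Type*} (s : Finset ι) {φ : ι → ℝ → ℝ} {a b c : ι → ℝ}
    (h : ∀ i ∈ s, HasJet (φ i) (a i) (b i) (c i)) :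
    HasJet (fun t => ∑ i ∈ s, φ i t) (∑ i ∈ s, a i) (∑ i ∈ s, b i) (∑ i ∈ s, c i) := by
  classical
  induction s using Finset.induction_on with
  | empty => simpa using const 0
  | insert i s hi ih =>
    simp only [Finset.sum_insert hi]
    exact (h i (Finset.mem_insert_self i s)).add (ih fun j hj => h j (Finset.mem_insert_of_mem hj))

theorem sq (h : HasJet φ a b c) :
    HasJet (fun s => φ s ^ 2) (a ^ 2) (2 * a * b) (2 * b ^ 2 + 2 * a * c) :=
  ((h.mul h).congr fun s => by ring).congr_jet (by ring) (by ring) (by ring)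

theorem log (h : HasJet φ a b c) (ha : 0 < a) :
    HasJet (fun s => Real.log (φ s)) (Real.log a) (b / a) (c / a - (b / a) ^ 2) := by
  obtain ⟨φ', h1, rfl, rfl, h4⟩ := h
  have h0 := h1.self_of_nhds
  refine ⟨fun s => φ' s / φ s, ?_, rfl, rfl, ?_⟩
  · filter_upwards [h1, h0.continuousAt.eventually (lt_mem_nhds ha)] with s hs hp
      using hs.log hp.ne'
  · refine (h4.fun_div h0 ha.ne').congr_deriv ?_
    have := ha.ne'
    field_simp

theorem hasDerivAt (h : HasJet φ a b c) : HasDerivAt φ b 0 := by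
  obtain ⟨φ', h1, rfl, rfl, h4⟩ := h
  exact h1.self_of_nhds

/-- If the second derivative at a minimum were negative, the point would also be a local maximum, so
`φ` would vanish near 0 and the second derivative would be 0. -/
theorem nonneg (h : HasJet φ 0 b c) (hp : ∀ᶠ s in 𝓝 0, 0 ≤ φ s) : b = 0 ∧ 0 ≤ c := by
  have hd := h.hasDerivAt
  obtain ⟨φ', h1, h2, rfl, h4⟩ := h
  have hmin : IsLocalMin φ 0 := by
    filter_upwards [hp] with s hs
    rwa [h2]
  have hb := hmin.hasDerivAt_eq_zero hd
  refine ⟨hb, ?_⟩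
  by_contra hc
  push Not at hc
  have hev : deriv φ =ᶠ[𝓝 0] φ' := by
    filter_upwards [h1] with s hs using hs.deriv
  have h5 : deriv (deriv φ) 0 < 0 := by
    rw [hev.deriv_eq, h4.deriv]; exact hc
  have hmax := isLocalMax_of_deriv_deriv_neg h5 (by rw [hd.deriv, hb]) hd.continuousAt
  have hz : φ =ᶠ[𝓝 0] fun _ => 0 := by
    filter_upwards [hp, hmax] with s hs ht
    rw [h2] at ht
    exact le_antisymm ht hs
  have hz1 : deriv φ =ᶠ[𝓝 0] deriv fun _ => (0 : ℝ) := hz.deriv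
  have hz2 : deriv (deriv φ) 0 = 0 := by
    rw [hz1.deriv_eq]
    simp
  linarith

end HasJet

theorem nonpos_of_hasDerivAt_left {φ : ℝ → ℝ} {b : ℝ} (h : HasDerivAt φ b 0) (h0 : φ 0 = 0)
    (hp : ∀ᶠ s in 𝓝[<] 0, 0 ≤ φ s) : b ≤ 0 := by
  refine le_of_tendsto h.tendsto_slope_zero_left ?_
  filter_upwards [hp, self_mem_nhdsWithin] with s hs hs0
  have hs0 : s < 0 := hs0
  simp only [zero_add, h0, sub_zero, smul_eq_mul]
  exact mul_nonpos_of_nonpos_of_nonneg (inv_nonpos.2 hs0.le) hs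

/-! ### The logarithm of a determinant -/

/-- Jacobi's formula: differentiate the Leibniz expansion and recognize determinants with one column
replaced, that is, Cramer's rule. -/
theorem hasDerivAt_det {ι : Type*} [Fintype ι] [DecidableEq ι] {M : ℝ → Matrix ι ι ℝ}
    {M' : Matrix ι ι ℝ} {s : ℝ} (h : ∀ i j, HasDerivAt (fun s => M s i j) (M' i j) s) :
    HasDerivAt (fun s => (M s).det) (∑ i, ∑ j, (M s).adjugate i j * M' j i) s := by
  simp only [Matrix.det_apply]
  have h1 : HasDerivAt (fun s => ∑ σ : Equiv.Perm ι, Equiv.Perm.sign σ • ∏ i, M s (σ i) i)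
      (∑ σ : Equiv.Perm ι, Equiv.Perm.sign σ •
        ∑ i, (∏ j ∈ Finset.univ.erase i, M s (σ j) j) • M' (σ i) i) s := by
    refine HasDerivAt.fun_sum fun σ _ => HasDerivAt.fun_const_smul _ ?_
    exact HasDerivAt.fun_finsetProd fun i _ => h (σ i) i
  convert h1 using 1
  have h2 : ∀ i, ∑ j, (M s).adjugate i j * M' j i
      = ((M s).updateCol i fun j => M' j i).det := by
    intro i
    rw [← Matrix.cramer_apply, Matrix.cramer_eq_adjugate_mulVec]
    rfl
  simp only [h2, Matrix.det_apply, Finset.smul_sum]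
  rw [Finset.sum_comm]
  refine Finset.sum_congr rfl fun σ _ => Finset.sum_congr rfl fun i _ => ?_
  congr 1
  rw [← Finset.prod_erase_mul _ _ (Finset.mem_univ i)]
  rw [Matrix.updateCol_self, smul_eq_mul]
  congr 1
  refine Finset.prod_congr rfl fun j hj => ?_
  rw [Matrix.updateCol_ne (Finset.ne_of_mem_erase hj)]

theorem differentiableAt_det {ι : Type*} [Fintype ι] [DecidableEq ι] {M : ℝ → Matrix ι ι ℝ}
    {s : ℝ} (h : ∀ i j, DifferentiableAt ℝ (fun s => M s i j) s) :
    DifferentiableAt ℝ (fun s => (M s).det) s :=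
  (hasDerivAt_det (M' := fun i j => deriv (fun s => M s i j) s)
    fun i j => (h i j).hasDerivAt).differentiableAt

theorem hasJet_log_det {ι : Type*} [Fintype ι] [DecidableEq ι] {M : ℝ → Matrix ι ι ℝ}
    {a : ι → ℝ} {B C : ι → ι → ℝ} (ha : ∀ i, 0 < a i)
    (h : ∀ i j, HasJet (fun s => M s i j) (Matrix.diagonal a i j) (B i j) (C i j)) :
    HasJet (fun s => Real.log (M s).det) (∑ i, Real.log (a i)) (∑ i, B i i / a i)
      (∑ i, C i i / a i - ∑ i, ∑ j, B i j * B j i / (a i * a j)) := by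
  choose M' h1 h2 h3 h4 using h
  have hM0 : M 0 = Matrix.diagonal a := by ext i j; exact h2 i j
  have hdet0 : (M 0).det = ∏ i, a i := by rw [hM0, Matrix.det_diagonal]
  have hdpos : 0 < (M 0).det := by rw [hdet0]; exact Finset.prod_pos fun i _ => ha i
  have hev : ∀ᶠ s in 𝓝 (0 : ℝ), ∀ i j, HasDerivAt (fun s => M s i j) (M' i j s) s := by
    simp only [Filter.eventually_all]; exact h1
  have hdet : ∀ᶠ s in 𝓝 (0 : ℝ), HasDerivAt (fun s => (M s).det)
      (∑ i, ∑ j, (M s).adjugate i j * M' j i s) s := by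
    filter_upwards [hev] with s hs using hasDerivAt_det (M' := fun i j => M' i j s) hs
  have hd0 := hdet.self_of_nhds
  set N : ι → ι → ℝ → ℝ := fun i j s => (M s).adjugate i j / (M s).det with hN
  have hNd : ∀ i j, DifferentiableAt ℝ (N i j) 0 := by
    intro i j
    refine DifferentiableAt.fun_div ?_ hd0.differentiableAt hdpos.ne'
    simp only [Matrix.adjugate_apply]
    refine differentiableAt_det fun k l => ?_
    simp only [Matrix.updateRow_apply]
    split_ifs
    · exact differentiableAt_const _
    · exact (h1 k l).self_of_nhds.differentiableAt
  have hinv : ∀ i j, N i j 0 = if i = j then (a i)⁻¹ else 0 := by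
    intro i j
    have : N i j 0 = (M 0)⁻¹ i j := by
      rw [Matrix.inv_def, Matrix.smul_apply, smul_eq_mul, Ring.inverse_eq_inv']
      exact div_eq_inv_mul _ _
    rw [this, hM0, Matrix.inv_diagonal, Matrix.diagonal_apply]
    split_ifs with hij
    · subst hij
      have hu : IsUnit a := Pi.isUnit_iff.2 fun i => (ha i).ne'.isUnit
      rw [Ring.inverse_of_isUnit hu]
      have := congrFun hu.unit.inv_mul i
      simp only [Pi.mul_apply, Pi.one_apply, IsUnit.unit_spec] at this
      exact eq_inv_of_mul_eq_one_left this
    · rfl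
  -- `N` is the inverse of `M` near 0. Its derivative comes from differentiating `N M = 1`, and
  -- gives the quadratic term in the second derivative of `log det`.
  have hNderiv : ∀ i j, HasDerivAt (N i j) (-(B i j / (a i * a j))) 0 := by
    intro i j
    have e1 : HasDerivAt (fun s => ∑ k, N i k s * M s k j)
        (∑ k, (deriv (N i k) 0 * M 0 k j + N i k 0 * M' k j 0)) 0 :=
      HasDerivAt.fun_sum fun k _ => (hNd i k).hasDerivAt.mul (h1 k j).self_of_nhds
    have e2 : (fun s => ∑ k, N i k s * M s k j) =ᶠ[𝓝 0] fun _ => (1 : Matrix ι ι ℝ) i j := by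
      filter_upwards [hd0.continuousAt.eventually (lt_mem_nhds hdpos)] with s hs
      have := congrFun (congrFun (Matrix.adjugate_mul (M s)) i) j
      rw [Matrix.mul_apply, Matrix.smul_apply, smul_eq_mul] at this
      simp only [hN, div_mul_eq_mul_div, ← Finset.sum_div]
      rw [this, mul_div_cancel_left₀ _ hs.ne']
    have e3 := e1.unique ((hasDerivAt_const (0 : ℝ) ((1 : Matrix ι ι ℝ) i j)).congr_of_eventuallyEq e2)
    simp only [h2, hinv, h3, Matrix.diagonal_apply, mul_ite, mul_zero, ite_mul, zero_mul,
      Finset.sum_add_distrib, Finset.sum_ite_eq, Finset.sum_ite_eq', Finset.mem_univ, if_true] at e3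
    have e4 : deriv (N i j) 0 = -(B i j / (a i * a j)) := by
      have := (ha i).ne'
      have := (ha j).ne'
      field_simp
      field_simp at e3
      linarith
    rw [← e4]
    exact (hNd i j).hasDerivAt
  refine ⟨fun s => ∑ i, ∑ j, N i j s * M' j i s, ?_, ?_, ?_, ?_⟩
  · filter_upwards [hdet, hd0.continuousAt.eventually (lt_mem_nhds hdpos)] with s hs hp
    convert hs.log hp.ne' using 1
    simp only [hN, Finset.sum_div, div_mul_eq_mul_div]
  · show Real.log (M 0).det = _
    rw [hdet0, Real.log_prod fun i _ => (ha i).ne']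
  · simp only [hinv, ite_mul, zero_mul, Finset.sum_ite_eq, Finset.mem_univ, if_true, h3]
    exact Finset.sum_congr rfl fun i _ => by rw [div_eq_inv_mul]
  · have e1 : HasDerivAt (fun s => ∑ i, ∑ j, N i j s * M' j i s)
        (∑ i, ∑ j, (-(B i j / (a i * a j)) * M' j i 0 + N i j 0 * C j i)) 0 :=
      HasDerivAt.fun_sum fun i _ => HasDerivAt.fun_sum fun j _ => (hNderiv i j).mul (h4 j i)
    convert e1 using 1
    simp only [hinv, ite_mul, zero_mul, Finset.sum_add_distrib, Finset.sum_ite_eq, Finset.mem_univ,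
      if_true, h3]
    rw [add_comm, sub_eq_add_neg]
    simp only [← Finset.sum_neg_distrib]
    congr 1
    · exact Finset.sum_congr rfl fun i _ => by rw [div_eq_inv_mul]
    · exact Finset.sum_congr rfl fun i _ => Finset.sum_congr rfl fun j _ => by ring

/-! ### The Minkowski form -/

/-- The Minkowski form as a continuous bilinear map. -/
def lorL (n : ℕ) : Mink n →L[ℝ] Mink n →L[ℝ] ℝ :=
  LinearMap.toContinuousLinearMap
    ((LinearMap.toContinuousLinearMap (𝕜 := ℝ) (E := Mink n) (F' := ℝ)).toLinearMap ∘ₗ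
      LinearMap.mk₂ ℝ (lor (n := n))
        (by intro x y z; simp only [lor, PiLp.add_apply, add_mul, Finset.sum_add_distrib]; ring)
        (by intro c x y
            simp only [lor, PiLp.smul_apply, smul_eq_mul, mul_assoc, ← Finset.mul_sum]; ring)
        (by intro x y z; simp only [lor, PiLp.add_apply, mul_add, Finset.sum_add_distrib]; ring)
        (by intro c x y
            simp only [lor, PiLp.smul_apply, smul_eq_mul, mul_left_comm _ c, ← Finset.mul_sum]
            ring))

theorem lorL_apply {n : ℕ} (x y : Mink n) : lorL n x y = lor x y := rfl

section lor

variable {n : ℕ} (x y z : Mink n) (c : ℝ)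

theorem lor_comm : lor x y = lor y x := by
  simp only [lor, mul_comm]

theorem lor_add_left : lor (x + y) z = lor x z + lor y z := by simp [← lorL_apply]
theorem lor_add_right : lor x (y + z) = lor x y + lor x z := by simp [← lorL_apply]
theorem lor_neg_left : lor (-x) y = -lor x y := by simp [← lorL_apply]
theorem lor_neg_right : lor x (-y) = -lor x y := by simp [← lorL_apply]
theorem lor_smul_left : lor (c • x) y = c * lor x y := by simp [← lorL_apply]
theorem lor_smul_right : lor x (c • y) = c * lor x y := by simp [← lorL_apply]
theorem lor_zero_left : lor 0 x = 0 := by simp [← lorL_apply]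
theorem lor_sum_left {ι : Type*} (s : Finset ι) (f : ι → Mink n) :
    lor (∑ i ∈ s, f i) x = ∑ i ∈ s, lor (f i) x := by simp [← lorL_apply]
theorem lor_sum_right {ι : Type*} (s : Finset ι) (f : ι → Mink n) :
    lor x (∑ i ∈ s, f i) = ∑ i ∈ s, lor x (f i) := by simp [← lorL_apply]

end lor

/-- A vector of Minkowski space is determined by its products with a point of hyperbolic space, a
unit normal and a basis of the tangent space of the hypersurface. -/
theorem eq_of_lor_eq {n : ℕ} {p N : Mink n} {E : Fin n → Mink n} (hp : lor p p = -1)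
    (hN : lor N N = 1) (hNp : lor N p = 0) (hpE : ∀ i, lor p (E i) = 0)
    (hNE : ∀ i, lor N (E i) = 0)
    (hg : IsUnit (Matrix.of fun i j => lor (E i) (E j)).det) {Y Z : Mink n}
    (h1 : lor Y p = lor Z p) (h2 : lor Y N = lor Z N) (h3 : ∀ i, lor Y (E i) = lor Z (E i)) :
    Y = Z := by
  let φ : Mink n →ₗ[ℝ] ℝ × ℝ × (Fin n → ℝ) :=
    { toFun := fun Y => (lor Y p, lor Y N, fun i => lor Y (E i))
      map_add' := fun x y => by simp only [lor_add_left]; rfl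
      map_smul' := fun c x => by simp only [lor_smul_left]; rfl }
  have hsurj : Function.Surjective φ := by
    rintro ⟨a, b, c⟩
    set g : Matrix (Fin n) (Fin n) ℝ := Matrix.of fun i j => lor (E i) (E j) with hgdef
    set d := Matrix.vecMul c g⁻¹
    -- The sign of the first coefficient reflects `lor p p = -1`. Surjectivity suffices, since
    -- source and target both have dimension `n + 2`.
    refine ⟨-a • p + b • N + ∑ i, d i • E i, ?_⟩
    have e1 : ∀ j, ∑ i, d i * lor (E i) (E j) = c j := by
      intro j
      have : Matrix.vecMul d g = c := by
        rw [Matrix.vecMul_vecMul, Matrix.nonsing_inv_mul _ hg, Matrix.vecMul_one]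
      exact congrFun this j
    have hpN : lor p N = 0 := by rw [lor_comm, hNp]
    have hEp : ∀ i, lor (E i) p = 0 := fun i => by rw [lor_comm, hpE]
    have hEN : ∀ i, lor (E i) N = 0 := fun i => by rw [lor_comm, hNE]
    refine Prod.ext ?_ (Prod.ext ?_ (funext fun j => ?_))
    · simp [φ, lor_add_left, lor_smul_left, lor_sum_left, hp, hNp, hEp, lor_neg_left]
    · simp [φ, lor_add_left, lor_smul_left, lor_sum_left, hN, hpN, hEN, lor_neg_left]
    · simp [φ, lor_add_left, lor_smul_left, lor_sum_left, hpE, hNE, e1, lor_neg_left]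
  have hinj : Function.Injective φ :=
    (LinearMap.injective_iff_surjective_of_finrank_eq_finrank (by simp; omega)).2 hsurj
  exact hinj (Prod.ext h1 (Prod.ext h2 (funext h3)))

/-! ### Directional derivatives of germs -/

section dird

variable {E Y : Type*} [NormedAddCommGroup E] [NormedSpace ℝ E] [NormedAddCommGroup Y]
  [NormedSpace ℝ Y]

/-- The derivative of `f` in the direction `v`. -/
def dird (v : E) (f : E → Y) (z : E) : Y := fderiv ℝ f z v

theorem dird_contDiffAt {f : E → Y} {z : E} (hf : ContDiffAt ℝ ∞ f z) (v : E) :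
    ContDiffAt ℝ ∞ (dird v f) z :=
  (hf.fderiv_right (m := ∞) (by simp)).clm_apply contDiffAt_const

theorem contDiffAt_lor {n : ℕ} {A B : E → Mink n} {z : E} (hA : ContDiffAt ℝ ∞ A z)
    (hB : ContDiffAt ℝ ∞ B z) : ContDiffAt ℝ ∞ (fun z => lor (A z) (B z)) z := by
  have h1 : ContDiffAt ℝ ∞ (fun z => lorL n (A z)) z := (lorL n).contDiff.contDiffAt.comp z hA
  exact h1.clm_apply hB

theorem eventually_contDiffAt {f : E → Y} {z : E} (hf : ContDiffAt ℝ ∞ f z) (m : ℕ) :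
    ∀ᶠ y in 𝓝 z, ContDiffAt ℝ m f y :=
  (hf.of_le (m := m) (by exact_mod_cast le_top)).eventually (by simp)

theorem eventually_differentiableAt {f : E → Y} {z : E} (hf : ContDiffAt ℝ ∞ f z) :
    ∀ᶠ y in 𝓝 z, DifferentiableAt ℝ f y := by
  filter_upwards [eventually_contDiffAt hf 1] with y hy using hy.differentiableAt (by simp)

theorem dird_congr {f g : E → Y} {z : E} (h : f =ᶠ[𝓝 z] g) (v : E) :
    dird v f =ᶠ[𝓝 z] dird v g := by
  filter_upwards [h.fderiv (𝕜 := ℝ)] with y hy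
  simp only [dird, hy]

theorem dird_lor_at {n : ℕ} {A B : E → Mink n} {z : E} (hA : DifferentiableAt ℝ A z)
    (hB : DifferentiableAt ℝ B z) (v : E) :
    dird v (fun z => lor (A z) (B z)) z = lor (dird v A z) (B z) + lor (A z) (dird v B z) := by
  have h := (lorL n).hasFDerivAt_of_bilinear hA.hasFDerivAt hB.hasFDerivAt
  have h2 := congrArg (fun L => L v) h.fderiv
  refine h2.trans ?_
  simp [dird, lorL_apply, add_comm]

theorem dird_lor {n : ℕ} {A B : E → Mink n} {z : E} (hA : ContDiffAt ℝ ∞ A z)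
    (hB : ContDiffAt ℝ ∞ B z) (v : E) :
    dird v (fun z => lor (A z) (B z)) =ᶠ[𝓝 z]
      fun z => lor (dird v A z) (B z) + lor (A z) (dird v B z) := by
  filter_upwards [eventually_differentiableAt hA, eventually_differentiableAt hB] with y h1 h2
    using dird_lor_at h1 h2 v

theorem dird_comm {f : E → Y} {z : E} (hf : ContDiffAt ℝ ∞ f z) (v w : E) :
    dird v (dird w f) =ᶠ[𝓝 z] dird w (dird v f) := by
  have key : ∀ y, ContDiffAt ℝ 2 f y → ∀ v w, dird v (dird w f) y = fderiv ℝ (fderiv ℝ f) y v w := by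
    intro y hy v w
    have h1 : DifferentiableAt ℝ (fderiv ℝ f) y :=
      (hy.fderiv_right (m := 1) (by norm_num)).differentiableAt (by simp)
    have h2 : dird w f = fun y => fderiv ℝ f y w := rfl
    rw [h2, dird, fderiv_clm_apply h1 (differentiableAt_const w)]
    simp
  filter_upwards [eventually_contDiffAt hf 2] with y hy
  have hy : ContDiffAt ℝ 2 f y := by exact_mod_cast hy
  rw [key y hy, key y hy]
  exact (hy.isSymmSndFDerivAt (by simp)).eq v w

theorem dird_const_of_eventuallyEq {f : E → Y} {z : E} {c : Y} (h : f =ᶠ[𝓝 z] fun _ => c) (v : E) :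
    dird v f =ᶠ[𝓝 z] fun _ => 0 := by
  filter_upwards [dird_congr h v] with y hy
  rw [hy]
  simp [dird]

theorem dird_smul {f : E → ℝ} {A : E → Y} {z : E} (hf : ContDiffAt ℝ ∞ f z)
    (hA : ContDiffAt ℝ ∞ A z) (v : E) :
    dird v (fun z => f z • A z) =ᶠ[𝓝 z] fun z => dird v f z • A z + f z • dird v A z := by
  filter_upwards [eventually_differentiableAt hf, eventually_differentiableAt hA] with y h1 h2
  simp only [dird]
  rw [fderiv_fun_smul h1 h2]
  simp [add_comm]

theorem dird_neg_apply (f : E → Y) (v z : E) : dird v (fun z => -f z) z = -dird v f z := by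
  simp [dird, fderiv_fun_neg]

theorem hasDerivAt_line {φ : E → Y} {z v : E} {s : ℝ} (h : DifferentiableAt ℝ φ (z + s • v)) :
    HasDerivAt (fun s : ℝ => φ (z + s • v)) (dird v φ (z + s • v)) s := by
  have h1 : HasDerivAt (fun s : ℝ => z + s • v) v s := by
    simpa using ((hasDerivAt_id s).smul_const v).const_add z
  exact h.hasFDerivAt.comp_hasDerivAt s h1

theorem tendsto_line (z v : E) : Filter.Tendsto (fun s : ℝ => z + s • v) (𝓝 0) (𝓝 z) := by
  have : Continuous fun s : ℝ => z + s • v := by fun_prop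
  simpa using this.tendsto 0

theorem hasJet_line {φ : E → ℝ} {z : E} (h : ContDiffAt ℝ ∞ φ z) (v : E) :
    HasJet (fun s => φ (z + s • v)) (φ z) (dird v φ z) (dird v (dird v φ) z) := by
  refine ⟨fun s => dird v φ (z + s • v), ?_, by simp, by simp, ?_⟩
  · filter_upwards [(tendsto_line z v).eventually (eventually_differentiableAt h)] with s hs
      using hasDerivAt_line hs
  · have h2 : DifferentiableAt ℝ (dird v φ) (z + (0 : ℝ) • v) := by
      simpa using (eventually_differentiableAt (dird_contDiffAt h v)).self_of_nhds
    simpa using hasDerivAt_line h2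

end dird

/-! ### Germs of hypersurfaces -/

section germ

variable {E : Type*} [NormedAddCommGroup E] [NormedSpace ℝ E] {n : ℕ}

/-- A germ at `z` of a smooth family of hypersurfaces `W` of hyperbolic space with unit normal `V`;
the vectors `e i` span the directions tangent to the hypersurfaces. -/
structure HypGerm (W V : E → Mink n) (e : Fin n → E) (z : E) : Prop where
  smooth : ContDiffAt ℝ ∞ W z
  smooth_normal : ContDiffAt ℝ ∞ V z
  norm : ∀ᶠ y in 𝓝 z, lor (W y) (W y) = -1
  norm_normal : ∀ᶠ y in 𝓝 z, lor (V y) (V y) = 1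
  normal : ∀ᶠ y in 𝓝 z, lor (V y) (W y) = 0
  normal_dird : ∀ i, ∀ᶠ y in 𝓝 z, lor (V y) (dird (e i) W y) = 0

namespace HypGerm

variable {W V : E → Mink n} {e : Fin n → E} {z : E} (h : HypGerm W V e z)
include h

theorem lor_dird (v : E) : ∀ᶠ y in 𝓝 z, lor (W y) (dird v W y) = 0 := by
  filter_upwards [dird_const_of_eventuallyEq h.norm v, dird_lor h.smooth h.smooth v] with y h1 h2
  rw [h1, lor_comm _ (W y)] at h2
  linarith

theorem lor_normal_dird_normal (v : E) : ∀ᶠ y in 𝓝 z, lor (V y) (dird v V y) = 0 := by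
  filter_upwards [dird_const_of_eventuallyEq h.norm_normal v,
    dird_lor h.smooth_normal h.smooth_normal v] with y h1 h2
  rw [h1, lor_comm _ (V y)] at h2
  linarith

theorem lor_dird_normal_add (v : E) :
    ∀ᶠ y in 𝓝 z, lor (dird v V y) (W y) + lor (V y) (dird v W y) = 0 := by
  filter_upwards [dird_const_of_eventuallyEq h.normal v,
    dird_lor h.smooth_normal h.smooth v] with y h1 h2
  rw [h1] at h2
  exact h2.symm

theorem lor_dird_normal (i : Fin n) : ∀ᶠ y in 𝓝 z, lor (dird (e i) V y) (W y) = 0 := by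
  filter_upwards [h.lor_dird_normal_add (e i), h.normal_dird i] with y h1 h2
  rw [h2] at h1
  linarith

/-- Differentiating the orthogonality of normal and tangent vectors. -/
theorem lor_dird_normal_dird (v : E) (j : Fin n) : ∀ᶠ y in 𝓝 z,
    lor (dird v V y) (dird (e j) W y) = -lor (V y) (dird v (dird (e j) W) y) := by
  filter_upwards [dird_const_of_eventuallyEq (h.normal_dird j) v,
    dird_lor h.smooth_normal (dird_contDiffAt h.smooth (e j)) v] with y h1 h2
  rw [h1] at h2
  linarith

theorem second_symm (i j : Fin n) : ∀ᶠ y in 𝓝 z,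
    lor (dird (e i) V y) (dird (e j) W y) = lor (dird (e j) V y) (dird (e i) W y) := by
  filter_upwards [h.lor_dird_normal_dird (e i) j, h.lor_dird_normal_dird (e j) i,
    dird_comm h.smooth (e i) (e j)] with y h1 h2 h3
  rw [h1, h2, h3]

theorem lor_dird_dird (v w : E) : ∀ᶠ y in 𝓝 z,
    lor (W y) (dird v (dird w W) y) = -lor (dird v W y) (dird w W y) := by
  filter_upwards [dird_const_of_eventuallyEq (h.lor_dird w) v,
    dird_lor h.smooth (dird_contDiffAt h.smooth w) v] with y h1 h2
  rw [h1] at h2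
  linarith

end HypGerm

end germ

/-! ### Normal coordinates: Codazzi, Simons' identity, evolution of the fundamental forms -/

section germ

variable {E : Type*} [NormedAddCommGroup E] [NormedSpace ℝ E] {n : ℕ}

theorem dird_lor_self {A B : E → Mink n} {z : E} (hA : ContDiffAt ℝ ∞ A z)
    (hB : ContDiffAt ℝ ∞ B z) (v : E) :
    dird v (fun z => lor (A z) (B z)) z = lor (dird v A z) (B z) + lor (A z) (dird v B z) :=
  (dird_lor hA hB v).self_of_nhds

theorem dird_smul_self {f : E → ℝ} {A : E → Mink n} {z : E} (hf : ContDiffAt ℝ ∞ f z)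
    (hA : ContDiffAt ℝ ∞ A z) (v : E) :
    dird v (fun z => f z • A z) z = dird v f z • A z + f z • dird v A z :=
  (dird_smul hf hA v).self_of_nhds

theorem dird_eq_zero {f : E → ℝ} {z : E} {c : ℝ} (h : ∀ᶠ y in 𝓝 z, f y = c) (v : E) :
    dird v f z = 0 :=
  (dird_const_of_eventuallyEq (c := c) h v).self_of_nhds

theorem dird_dird_lor {A B : E → Mink n} {z : E} (hA : ContDiffAt ℝ ∞ A z)
    (hB : ContDiffAt ℝ ∞ B z) (v : E) :
    dird v (dird v fun z => lor (A z) (B z)) z = lor (dird v (dird v A) z) (B z)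
      + 2 * lor (dird v A z) (dird v B z) + lor (A z) (dird v (dird v B) z) := by
  rw [(dird_congr (dird_lor hA hB v) v).self_of_nhds]
  have h1 := dird_lor_self (dird_contDiffAt hA v) hB v
  have h2 := dird_lor_self hA (dird_contDiffAt hB v) v
  have e : dird v (fun z => lor (dird v A z) (B z) + lor (A z) (dird v B z)) z
      = dird v (fun z => lor (dird v A z) (B z)) z + dird v (fun z => lor (A z) (dird v B z)) z := by
    simp only [dird]
    rw [fderiv_fun_add]
    · rfl
    · exact (contDiffAt_lor (dird_contDiffAt hA v) hB).differentiableAt (by simp)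
    · exact (contDiffAt_lor hA (dird_contDiffAt hB v)).differentiableAt (by simp)
  rw [e, h1, h2]
  ring

/-- Coefficients of the first fundamental form of a germ. -/
def fstCoeff (W : E → Mink n) (e : Fin n → E) (i j : Fin n) (y : E) : ℝ :=
  lor (dird (e i) W y) (dird (e j) W y)

/-- Coefficients of the second fundamental form of a germ. -/
def sndCoeff (W V : E → Mink n) (e : Fin n → E) (i j : Fin n) (y : E) : ℝ :=
  lor (dird (e i) V y) (dird (e j) W y)

/-- A germ of a hypersurface in coordinates that are normal at the base point and diagonalize the
second fundamental form there. -/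
structure HypGermNormal (W V : E → Mink n) (e : Fin n → E) (z : E) (κ : Fin n → ℝ) : Prop extends
    HypGerm W V e z where
  fst_eq : ∀ i j, fstCoeff W e i j z = if i = j then 1 else 0
  snd_eq : ∀ i j, sndCoeff W V e i j z = if i = j then κ i else 0
  christoffel_eq : ∀ i j k, lor (dird (e i) (dird (e j) W) z) (dird (e k) W z) = 0

theorem HypGerm.fst_contDiffAt {W V : E → Mink n} {e : Fin n → E} {z : E} (h : HypGerm W V e z)
    (i j : Fin n) : ContDiffAt ℝ ∞ (fstCoeff W e i j) z :=
  contDiffAt_lor (dird_contDiffAt h.smooth _) (dird_contDiffAt h.smooth _)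

theorem HypGerm.snd_contDiffAt {W V : E → Mink n} {e : Fin n → E} {z : E} (h : HypGerm W V e z)
    (i j : Fin n) : ContDiffAt ℝ ∞ (sndCoeff W V e i j) z :=
  contDiffAt_lor (dird_contDiffAt h.smooth_normal _) (dird_contDiffAt h.smooth _)

namespace HypGermNormal

variable {W V : E → Mink n} {e : Fin n → E} {z : E} {κ : Fin n → ℝ} (h : HypGermNormal W V e z κ)
include h

theorem ext_lor {Y Z : Mink n} (h1 : lor Y (W z) = lor Z (W z)) (h2 : lor Y (V z) = lor Z (V z))
    (h3 : ∀ i, lor Y (dird (e i) W z) = lor Z (dird (e i) W z)) : Y = Z := by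
  refine eq_of_lor_eq (E := fun i => dird (e i) W z) h.norm.self_of_nhds
    h.norm_normal.self_of_nhds h.normal.self_of_nhds (fun i => (h.lor_dird _).self_of_nhds)
    (fun i => (h.normal_dird i).self_of_nhds) ?_ h1 h2 h3
  have : (Matrix.of fun i j => lor (dird (e i) W z) (dird (e j) W z)) = 1 := by
    ext i j
    rw [Matrix.one_apply]
    exact h.fst_eq i j
  rw [this]
  simp

theorem dird_normal (i : Fin n) : dird (e i) V z = κ i • dird (e i) W z := by
  apply h.ext_lor
  · rw [lor_smul_left, (h.lor_dird_normal i).self_of_nhds, lor_comm, (h.lor_dird _).self_of_nhds,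
      mul_zero]
  · rw [lor_smul_left, lor_comm, (h.lor_normal_dird_normal _).self_of_nhds, lor_comm,
      (h.normal_dird i).self_of_nhds, mul_zero]
  · intro j
    rw [lor_smul_left]
    have h1 := h.snd_eq i j
    have h2 := h.fst_eq i j
    simp only [sndCoeff, fstCoeff] at h1 h2
    rw [h1, h2]
    simp

theorem dird_dird (i j : Fin n) : dird (e i) (dird (e j) W) z
    = (if i = j then -κ i else 0) • V z + (if i = j then (1 : ℝ) else 0) • W z := by
  have hVW := h.normal.self_of_nhds
  have hWV : lor (W z) (V z) = 0 := by rw [lor_comm, hVW]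
  apply h.ext_lor
  · rw [lor_add_left, lor_smul_left, lor_smul_left, hVW, h.norm.self_of_nhds, lor_comm,
      (h.lor_dird_dird (e i) (e j)).self_of_nhds]
    have h2 := h.fst_eq i j
    simp only [fstCoeff] at h2
    rw [h2]; ring
  · rw [lor_add_left, lor_smul_left, lor_smul_left, hWV, h.norm_normal.self_of_nhds, lor_comm]
    have h1 := (h.lor_dird_normal_dird (e i) j).self_of_nhds
    have h2 := h.snd_eq i j
    simp only [sndCoeff] at h2
    rw [h2] at h1
    split_ifs at h1 ⊢ <;> linarith
  · intro k
    rw [h.christoffel_eq, lor_add_left, lor_smul_left, lor_smul_left,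
      (h.normal_dird k).self_of_nhds, (h.lor_dird _).self_of_nhds]
    ring

theorem dird_fst (i j k : Fin n) : dird (e k) (fstCoeff W e i j) z = 0 := by
  have h1 := (dird_lor_self (dird_contDiffAt h.smooth (e i)) (dird_contDiffAt h.smooth (e j))
    (e k))
  refine h1.trans ?_
  rw [h.christoffel_eq, lor_comm, h.christoffel_eq, add_zero]

theorem dird_snd (i j k : Fin n) : dird (e k) (sndCoeff W V e i j) z
    = -lor (V z) (dird (e k) (dird (e i) (dird (e j) W)) z) := by
  have h1 : sndCoeff W V e i j =ᶠ[𝓝 z] fun y => -lor (V y) (dird (e i) (dird (e j) W) y) :=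
    h.lor_dird_normal_dird (e i) j
  rw [(dird_congr h1 (e k)).self_of_nhds, dird_neg_apply, (dird_lor_self h.smooth_normal
    (dird_contDiffAt (dird_contDiffAt h.smooth (e j)) (e i)) (e k)), h.dird_normal,
    lor_smul_left, lor_comm, h.christoffel_eq]
  ring

/-- The Codazzi equation: at the base point the derivative of `h` is the normal component of a third
derivative of `W`, and directional derivatives commute. -/
theorem dird_snd_symm (i j k : Fin n) : dird (e k) (sndCoeff W V e i j) z
    = dird (e i) (sndCoeff W V e k j) z := by
  rw [h.dird_snd, h.dird_snd, (dird_comm (dird_contDiffAt h.smooth (e j)) (e k) (e i)).self_of_nhds]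

theorem dird_snd_symm' (i j k : Fin n) : dird (e k) (sndCoeff W V e i j) z
    = dird (e k) (sndCoeff W V e j i) z := by
  have h1 : sndCoeff W V e i j =ᶠ[𝓝 z] sndCoeff W V e j i := h.second_symm i j
  exact (dird_congr h1 (e k)).self_of_nhds

theorem lor_dird_normal_self (i : Fin n) :
    lor (dird (e i) V z) (dird (e i) V z) = κ i ^ 2 := by
  have h2 := h.fst_eq i i
  simp only [fstCoeff, if_true] at h2
  rw [h.dird_normal, lor_smul_left, lor_smul_right, h2]
  ring

theorem lor_normal_dird_dird_normal (i : Fin n) :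
    lor (V z) (dird (e i) (dird (e i) V) z) = -κ i ^ 2 := by
  have h1 := (dird_eq_zero (h.lor_normal_dird_normal (e i)) (e i))
  rw [(dird_lor_self h.smooth_normal (dird_contDiffAt h.smooth_normal (e i)) (e i)),
    h.lor_dird_normal_self] at h1
  linarith

theorem lor_dird_dird_normal (i : Fin n) :
    lor (dird (e i) (dird (e i) V) z) (W z) = -κ i := by
  have h1 := (dird_eq_zero (h.lor_dird_normal i) (e i))
  rw [(dird_lor_self (dird_contDiffAt h.smooth_normal (e i)) h.smooth (e i))] at h1
  have h2 := h.snd_eq i i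
  simp only [sndCoeff, if_true] at h2
  rw [h2] at h1
  linarith

theorem dird_dird_fst {i k : Fin n} (hik : i ≠ k) :
    dird (e k) (dird (e k) (fstCoeff W e i i)) z
      = 2 * lor (dird (e i) W z) (dird (e i) (dird (e k) (dird (e k) W)) z) := by
  have hWi := dird_contDiffAt h.smooth (e i)
  have h1 := dird_dird_lor hWi hWi (e k)
  have h2 : dird (e k) (dird (e k) (dird (e i) W)) z = dird (e i) (dird (e k) (dird (e k) W)) z := by
    rw [(dird_congr (dird_comm h.smooth (e k) (e i)) (e k)).self_of_nhds,
      (dird_comm (dird_contDiffAt h.smooth (e k)) (e k) (e i)).self_of_nhds]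
  refine h1.trans ?_
  rw [h.dird_dird k i, if_neg hik.symm, if_neg hik.symm, zero_smul, zero_smul, add_zero,
    lor_zero_left, h2, lor_comm]
  ring

/-- Differentiate `h_kk = -lor V (∂_k ∂_k W)` twice. All terms except the last are known at the base
point, and the last involves a fourth derivative that is symmetric in `i` and `k`. -/
theorem dird_dird_snd {i k : Fin n} (hik : i ≠ k) :
    dird (e i) (dird (e i) (sndCoeff W V e k k)) z
      = -(κ k * κ i ^ 2) + κ i - κ i * dird (e k) (dird (e k) (fstCoeff W e i i)) z
        - lor (V z) (dird (e i) (dird (e i) (dird (e k) (dird (e k) W))) z) := by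
  have h1 : sndCoeff W V e k k =ᶠ[𝓝 z] fun y => -lor (V y) (dird (e k) (dird (e k) W) y) :=
    h.lor_dird_normal_dird (e k) k
  have hA := dird_contDiffAt (dird_contDiffAt h.smooth (e k)) (e k)
  rw [(dird_congr (dird_congr h1 (e i)) (e i)).self_of_nhds]
  have h2 : dird (e i) (fun y => -lor (V y) (dird (e k) (dird (e k) W) y))
      = fun y => -dird (e i) (fun y => lor (V y) (dird (e k) (dird (e k) W) y)) y :=
    funext fun y => dird_neg_apply _ _ _
  rw [h2, dird_neg_apply, dird_dird_lor h.smooth_normal hA, h.dird_dird_fst hik, h.dird_dird k k,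
    h.dird_normal i]
  simp only [if_true, lor_add_right, lor_smul_right, lor_smul_left]
  rw [lor_comm _ (V z), h.lor_normal_dird_dird_normal, h.lor_dird_dird_normal]
  ring

/-- Simons' identity in normal coordinates. -/
theorem simons {i k : Fin n} (hik : i ≠ k) :
    (dird (e i) (dird (e i) (sndCoeff W V e k k)) z
        - κ k * dird (e i) (dird (e i) (fstCoeff W e k k)) z)
      - (dird (e k) (dird (e k) (sndCoeff W V e i i)) z
        - κ i * dird (e k) (dird (e k) (fstCoeff W e i i)) z)
      = (κ i * κ k - 1) * (κ k - κ i) := by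
  -- The fourth derivatives agree by commutation and cancel in the difference. The second
  -- derivatives of `g` in the statement correct for the use of partial instead of covariant
  -- derivatives.
  have h4 : dird (e i) (dird (e i) (dird (e k) (dird (e k) W))) z
      = dird (e k) (dird (e k) (dird (e i) (dird (e i) W))) z := by
    have a1 : dird (e i) (dird (e k) (dird (e k) W)) =ᶠ[𝓝 z] dird (e k) (dird (e k) (dird (e i) W)) :=
      (dird_comm (dird_contDiffAt h.smooth (e k)) (e i) (e k)).trans
        (dird_congr (dird_comm h.smooth (e i) (e k)) (e k))
    have hWi := dird_contDiffAt h.smooth (e i)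
    have a2 : dird (e i) (dird (e k) (dird (e k) (dird (e i) W))) =ᶠ[𝓝 z]
        dird (e k) (dird (e k) (dird (e i) (dird (e i) W))) :=
      (dird_comm (dird_contDiffAt hWi (e k)) (e i) (e k)).trans
        (dird_congr (dird_comm hWi (e i) (e k)) (e k))
    rw [(dird_congr a1 (e i)).self_of_nhds, a2.self_of_nhds]
  rw [h.dird_dird_snd hik, h.dird_dird_snd hik.symm, h4]
  ring

variable {f : E → ℝ} {τ : E} (hf : ContDiffAt ℝ ∞ f z)
  (hW : dird τ W =ᶠ[𝓝 z] fun y => -(f y • V y))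
include hf hW

omit h in
theorem _root_.HypFlow.HypGerm.dird_time_dird (h : HypGerm W V e z) (i : Fin n) :
    dird τ (dird (e i) W) =ᶠ[𝓝 z] fun y => -(dird (e i) f y • V y + f y • dird (e i) V y) := by
  filter_upwards [dird_comm h.smooth τ (e i), dird_congr hW (e i),
    dird_smul hf h.smooth_normal (e i)] with y h1 h2 h3
  rw [h1, h2, dird_neg_apply, h3]

theorem dird_time_fst (i j : Fin n) : dird τ (fstCoeff W e i j) z
    = if i = j then -(2 * f z * κ i) else 0 := by
  have hi : ∀ i, dird τ (dird (e i) W) z = -(dird (e i) f z • V z + f z • dird (e i) V z) :=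
    fun i => (h.dird_time_dird hf hW i).self_of_nhds
  have h1 := (dird_lor_self (dird_contDiffAt h.smooth (e i)) (dird_contDiffAt h.smooth (e j))
    τ)
  refine h1.trans ?_
  have gij := h.fst_eq i j
  simp only [fstCoeff] at gij
  rw [hi, hi, h.dird_normal, h.dird_normal]
  simp only [lor_neg_left, lor_neg_right, lor_add_left, lor_add_right, lor_smul_left,
    lor_smul_right, gij, (h.normal_dird j).self_of_nhds, lor_comm _ (V z),
    (h.normal_dird i).self_of_nhds]
  split_ifs with hij
  · subst hij; ring
  · ring

/-- The last term `-f` is the contribution of the ambient curvature -1. It arises because `∂_τ V`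
has a component along `W`, forced by differentiating `lor V W = 0`. -/
theorem dird_time_snd (i : Fin n) : dird τ (sndCoeff W V e i i) z
    = dird (e i) (dird (e i) f) z - f z * κ i ^ 2 - f z := by
  have h1 : sndCoeff W V e i i =ᶠ[𝓝 z] fun y => -lor (V y) (dird (e i) (dird (e i) W) y) :=
    h.lor_dird_normal_dird (e i) i
  rw [(dird_congr h1 τ).self_of_nhds, dird_neg_apply, (dird_lor_self h.smooth_normal
    (dird_contDiffAt (dird_contDiffAt h.smooth (e i)) (e i)) τ)]
  have h2 : dird τ (dird (e i) (dird (e i) W)) z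
      = -((dird (e i) (dird (e i) f) z • V z + dird (e i) f z • dird (e i) V z)
        + (dird (e i) f z • dird (e i) V z + f z • dird (e i) (dird (e i) V) z)) := by
    rw [(dird_comm (dird_contDiffAt h.smooth (e i)) τ (e i)).self_of_nhds,
      (dird_congr (h.dird_time_dird hf hW i) (e i)).self_of_nhds, dird_neg_apply]
    have hfi := dird_contDiffAt hf (e i)
    have hVi := dird_contDiffAt h.smooth_normal (e i)
    rw [← (dird_smul_self hfi h.smooth_normal (e i)),
      ← (dird_smul_self hf hVi (e i))]
    congr 1
    simp only [dird]
    rw [fderiv_fun_add]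
    · rfl
    · exact (hfi.smul h.smooth_normal).differentiableAt (by simp)
    · exact (hf.smul hVi).differentiableAt (by simp)
  have h3 : lor (dird τ V z) (W z) = f z := by
    have e1 := (h.lor_dird_normal_add τ).self_of_nhds
    rw [hW.self_of_nhds, lor_neg_right, lor_smul_right, h.norm_normal.self_of_nhds] at e1
    linarith
  have h4 : lor (dird τ V z) (V z) = 0 := by
    rw [lor_comm, (h.lor_normal_dird_normal τ).self_of_nhds]
  rw [h2, h.dird_dird]
  simp only [if_true, lor_neg_right, lor_add_right, lor_smul_right, h3, h4,
    h.norm_normal.self_of_nhds, (h.lor_normal_dird_normal (e i)).self_of_nhds,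
    h.lor_normal_dird_dird_normal]
  ring

end HypGermNormal

end germ

/-! ### Jets of forms along curves -/

/-- The value of a bilinear form with coefficients `A`. -/
def bilin {n : ℕ} (A : Fin n → Fin n → ℝ) (v w : Fin n → ℝ) : ℝ := ∑ i, ∑ j, v i * w j * A i j

/-- The basis vector with index `p`, perturbed linearly in the direction `-R`. -/
def perturb {n : ℕ} (p : Fin n) (R : Fin n → ℝ) (s : ℝ) (i : Fin n) : ℝ :=
  (if i = p then 1 else 0) - s * R i

/-- Second order expansion of a varying form on vectors that also move linearly. The first order
terms in `R` and `S` are the freedom exploited at a first zero. -/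
theorem hasJet_bilin_perturb {n : ℕ} (p q : Fin n) (R S : Fin n → ℝ)
    {H : Fin n → Fin n → ℝ → ℝ} {a b c : Fin n → Fin n → ℝ}
    (h : ∀ i j, HasJet (H i j) (a i j) (b i j) (c i j)) :
    HasJet (fun s => bilin (fun i j => H i j s) (perturb p R s) (perturb q S s)) (a p q)
      (b p q - ∑ i, R i * a i q - ∑ j, S j * a p j)
      (c p q - 2 * ∑ i, R i * b i q - 2 * ∑ j, S j * b p j
        + 2 * ∑ i, ∑ j, R i * S j * a i j) := by
  have hp : ∀ (p : Fin n) (R : Fin n → ℝ) i, HasJet (fun s => perturb p R s i)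
      (if i = p then 1 else 0) (-R i) 0 := fun p R i =>
    (((HasJet.const _).sub (HasJet.id.mul (HasJet.const (R i)))).congr fun s => rfl).congr_jet
      (by ring) (by ring) (by ring)
  have hs : HasJet (fun s => bilin (fun i j => H i j s) (perturb p R s) (perturb q S s)) _ _ _ :=
    HasJet.sum Finset.univ fun i _ => HasJet.sum Finset.univ fun j _ =>
      ((hp p R i).mul (hp q S j)).mul (h i j)
  refine hs.congr_jet ?_ ?_ ?_
  · simp
  · simp only [ite_mul, one_mul, zero_mul, mul_ite, mul_one, mul_zero, add_mul,
      Finset.sum_add_distrib, Finset.sum_ite_eq', Finset.mem_univ, if_true]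
    simp only [Finset.sum_ite_irrel, Finset.sum_const_zero, Finset.sum_ite_eq', Finset.mem_univ,
      if_true, neg_mul, Finset.sum_neg_distrib]
    ring
  · simp only [ite_mul, one_mul, zero_mul, mul_ite, mul_one, mul_zero, add_mul, zero_add, add_zero,
      Finset.sum_add_distrib, Finset.sum_ite_eq', Finset.mem_univ, if_true, mul_add]
    simp only [Finset.sum_ite_irrel, Finset.sum_const_zero, Finset.sum_ite_eq', Finset.mem_univ,
      if_true, neg_mul, mul_neg, Finset.sum_neg_distrib, neg_neg, Finset.mul_sum, mul_assoc]
    ring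

/-! ### Cumulative weights -/

/-- The partial sums of `d`. -/
def cumul {n : ℕ} (d : Fin n → ℝ) (k : Fin n) : ℝ := ∑ m : Fin n, if (m : ℕ) ≤ k then d m else 0

theorem cumul_mono {n : ℕ} {d : Fin n → ℝ} (hd : ∀ m, 0 ≤ d m) : Monotone (cumul d) := by
  intro k l hkl
  refine Finset.sum_le_sum fun m _ => ?_
  have := Fin.le_def.1 hkl
  split_ifs with h1 h2
  · exact le_rfl
  · omega
  · exact hd m
  · exact le_rfl

theorem cumul_nonneg {n : ℕ} {d : Fin n → ℝ} (hd : ∀ m, 0 ≤ d m) (k : Fin n) : 0 ≤ cumul d k :=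
  Finset.sum_nonneg fun m _ => by split_ifs; exacts [hd m, le_rfl]

/-- `d` consists of the first weight and the successive increments. This is Abel summation in
preparation: sums weighted by `w` become nonnegative combinations of tail sums. -/
theorem exists_cumul_eq {n : ℕ} {w : Fin n → ℝ} (hw : ∀ k, 0 ≤ w k) (hm : Monotone w) :
    ∃ d : Fin n → ℝ, (∀ m, 0 ≤ d m) ∧ cumul d = w := by
  induction n with
  | zero => exact ⟨fun _ => 0, fun m => m.elim0, funext fun k => k.elim0⟩
  | succ n ih =>
    obtain ⟨d, hd, hde⟩ := ih (w := fun k => w k.succ - w 0)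
      (fun k => sub_nonneg.2 (hm (Fin.zero_le _)))
      (fun k l hkl => sub_le_sub_right (hm (Fin.succ_le_succ_iff.2 hkl)) _)
    refine ⟨Fin.cons (w 0) d, fun m => ?_, funext fun k => ?_⟩
    · refine Fin.cases ?_ (fun m => ?_) m
      · simpa using hw 0
      · simpa using hd m
    · refine Fin.cases ?_ (fun k => ?_) k
      · simp [cumul]
      · have := congrFun hde k
        simp only [cumul, Fin.val_fin_le] at this
        simp [cumul, Fin.sum_univ_succ, this]

theorem sum_mul_tail {n : ℕ} (d φ : Fin n → ℝ) :
    ∑ m : Fin n, d m * ∑ k : Fin n, (if (m : ℕ) ≤ k then φ k else 0) = ∑ k, cumul d k * φ k := by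
  simp only [cumul, Finset.mul_sum, Finset.sum_mul]
  rw [Finset.sum_comm]
  refine Finset.sum_congr rfl fun k _ => Finset.sum_congr rfl fun m _ => ?_
  split_ifs <;> ring

/-- A pair `(k, l)` lies in the tail from `m` exactly when `m ≤ min k l`; this is the source of the
weight at `min k l` in the gradient terms. -/
theorem sum_mul_tail_tail {n : ℕ} (d : Fin n → ℝ) (ψ : Fin n → Fin n → ℝ) :
    ∑ m : Fin n, d m * ∑ k : Fin n, (if (m : ℕ) ≤ k then
      ∑ l : Fin n, (if (m : ℕ) ≤ l then ψ k l else 0) else 0)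
      = ∑ k, ∑ l, cumul d (min k l) * ψ k l := by
  simp only [cumul, Finset.mul_sum, Finset.sum_mul]
  rw [Finset.sum_comm]
  refine Finset.sum_congr rfl fun k _ => Eq.trans ?_ Finset.sum_comm
  refine Finset.sum_congr rfl fun m _ => ?_
  have hmin : ∀ l : Fin n, ((m : ℕ) ≤ (min k l : Fin n)) ↔ ((m : ℕ) ≤ k ∧ (m : ℕ) ≤ l) := by
    intro l
    have h1 : ((min k l : Fin n) : ℕ) = min (k : ℕ) l := by
      rcases le_total k l with h | h
      · rw [min_eq_left h, min_eq_left (Fin.le_def.1 h)]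
      · rw [min_eq_right h, min_eq_right (Fin.le_def.1 h)]
    rw [h1, le_min_iff]
  simp only [hmin, ite_mul, zero_mul]
  by_cases hk : (m : ℕ) ≤ k
  · simp only [hk, if_true, true_and, Finset.mul_sum, mul_ite, mul_zero]
  · simp only [hk, if_false, false_and, mul_zero, Finset.sum_const_zero]

/-! ### The smooth barrier below log F and the pinching form -/

section germ

variable {E : Type*} [NormedAddCommGroup E] [NormedSpace ℝ E] {n : ℕ}

/-- The matrix of the first fundamental form of a germ. -/
def fstMat (W : E → Mink n) (e : Fin n → E) (y : E) : Matrix (Fin n) (Fin n) ℝ :=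
  Matrix.of fun i j => fstCoeff W e i j y

/-- The matrix of the second fundamental form of a germ. -/
def sndMat (W V : E → Mink n) (e : Fin n → E) (y : E) : Matrix (Fin n) (Fin n) ℝ :=
  Matrix.of fun i j => sndCoeff W V e i j y

/-- The weighted sum of the logarithms of the determinants of the second fundamental form on the
flag of coordinate subspaces. -/
def logFlag (W V : E → Mink n) (e : Fin n → E) (d : Fin n → ℝ) (y : E) : ℝ :=
  ∑ m : Fin n, d m * (Real.log ((sndMat W V e y).submatrix (tailIdx (m : ℕ)) (tailIdx m)).det
    - Real.log ((fstMat W e y).submatrix (tailIdx (m : ℕ)) (tailIdx m)).det)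

/-- At the base point both forms are diagonal, so `hasJet_log_det` applies to each block of the
flag, and Abel summation collects the blocks. The derivatives of `g` are kept because `v` may be the
time direction. -/
theorem HypGermNormal.hasJet_logFlag {W V : E → Mink n} {e : Fin n → E} {z : E} {κ : Fin n → ℝ}
    (h : HypGermNormal W V e z κ) (hκ : ∀ i, 0 < κ i) (d : Fin n → ℝ) (v : E) :
    HasJet (fun s : ℝ => logFlag W V e d (z + s • v)) (∑ k, cumul d k * Real.log (κ k))
      (∑ k, cumul d k * (dird v (sndCoeff W V e k k) z / κ k - dird v (fstCoeff W e k k) z))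
      (∑ k, cumul d k * (dird v (dird v (sndCoeff W V e k k)) z / κ k
          - dird v (dird v (fstCoeff W e k k)) z)
        - ∑ k, ∑ l, cumul d (min k l) * (dird v (sndCoeff W V e k l) z
          * dird v (sndCoeff W V e l k) z / (κ k * κ l)
          - dird v (fstCoeff W e k l) z * dird v (fstCoeff W e l k) z)) := by
  have hS : ∀ m : ℕ, HasJet (fun s : ℝ => Real.log
      ((sndMat W V e (z + s • v)).submatrix (tailIdx m) (tailIdx m)).det) _ _ _ := fun m =>
    hasJet_log_det (a := fun a => κ (tailIdx m a)) (fun a => hκ _) fun a b =>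
      (hasJet_line (h.snd_contDiffAt (tailIdx m a) (tailIdx m b)) v).congr_jet
        (by rw [h.snd_eq, Matrix.diagonal_apply]; simp only [(tailIdx_injective m).eq_iff]) rfl rfl
  have hG : ∀ m : ℕ, HasJet (fun s : ℝ => Real.log
      ((fstMat W e (z + s • v)).submatrix (tailIdx m) (tailIdx m)).det) _ _ _ := fun m =>
    hasJet_log_det (a := fun _ => 1) (fun a => zero_lt_one) fun a b =>
      (hasJet_line (h.fst_contDiffAt (tailIdx m a) (tailIdx m b)) v).congr_jet
        (by rw [h.fst_eq, Matrix.diagonal_apply]; simp only [(tailIdx_injective m).eq_iff]) rfl rfl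
  have hsum := HasJet.sum Finset.univ fun (m : Fin n) _ => ((hS m).sub (hG m)).const_mul (d m)
  have hdouble : ∀ (m : ℕ) (ψ : Fin n → Fin n → ℝ), ∑ a, ∑ b, ψ (tailIdx m a) (tailIdx m b)
      = ∑ k : Fin n, (if m ≤ k then ∑ l : Fin n, (if m ≤ l then ψ k l else 0) else 0) := by
    intro m ψ
    rw [← sum_tailIdx m fun k => ∑ l : Fin n, (if m ≤ l then ψ k l else 0)]
    exact Finset.sum_congr rfl fun a _ => sum_tailIdx m fun l => ψ (tailIdx m a) l
  refine HasJet.congr_jet (φ := fun s : ℝ => logFlag W V e d (z + s • v)) hsum ?_ ?_ ?_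
  · rw [← sum_mul_tail]
    refine Finset.sum_congr rfl fun m _ => ?_
    rw [← sum_tailIdx (m : ℕ) fun k => Real.log (κ k)]
    simp
  · rw [← sum_mul_tail]
    refine Finset.sum_congr rfl fun m _ => ?_
    rw [← sum_tailIdx (m : ℕ) fun k =>
      dird v (sndCoeff W V e k k) z / κ k - dird v (fstCoeff W e k k) z, ← Finset.sum_sub_distrib]
    simp
  · rw [← sum_mul_tail, ← sum_mul_tail_tail, ← Finset.sum_sub_distrib]
    refine Finset.sum_congr rfl fun m _ => ?_
    rw [← sum_tailIdx (m : ℕ) fun k => dird v (dird v (sndCoeff W V e k k)) z / κ k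
          - dird v (dird v (fstCoeff W e k k)) z, ← mul_sub,
      ← hdouble (m : ℕ) fun k l => dird v (sndCoeff W V e k l) z
          * dird v (sndCoeff W V e l k) z / (κ k * κ l)
          - dird v (fstCoeff W e k l) z * dird v (fstCoeff W e l k) z]
    simp only [Finset.sum_sub_distrib, div_one, mul_one]
    ring

/-- The pinching quantity on the pair of tangent vectors with coordinates `v` and `w`. -/
def pinchForm (c : ℝ) (f : E → ℝ) (W V : E → Mink n) (e : Fin n → E) (v w : Fin n → ℝ) (y : E) : ℝ :=
  bilin (fun i j => sndCoeff W V e i j y) v v * bilin (fun i j => sndCoeff W V e i j y) w w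
    - bilin (fun i j => sndCoeff W V e i j y) v w ^ 2
    - (1 + c * f y ^ 2) * (bilin (fun i j => fstCoeff W e i j y) v v
      * bilin (fun i j => fstCoeff W e i j y) w w - bilin (fun i j => fstCoeff W e i j y) v w ^ 2)

end germ

/-! ### The maximum principle in adapted coordinates -/

section flow

variable {E : Type*} [NormedAddCommGroup E] [NormedSpace ℝ E] {m : ℕ}

/-- The maximum principle: the pinching quantity has no first zero. -/
theorem HypGermNormal.false_of_first_zero {W V : E → Mink (m + 3)} {e : Fin (m + 3) → E} {z τ : E}
    {κ d : Fin (m + 3) → ℝ} (h : HypGermNormal W V e z κ) {f : E → ℝ} (hf : ContDiffAt ℝ ∞ f z)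
    (hW : dird τ W =ᶠ[𝓝 z] fun y => -(f y • V y)) (hκ : ∀ i, 0 < κ i) (hm : Monotone κ)
    (hd : ∀ k, 0 ≤ d k) (hds : ∑ k, cumul d k = 1) (hF : 0 < f z) {c : ℝ} (hc : 0 < c)
    (hcF : c * f z ^ 2 = κ 0 * κ 1 - 1)
    (hlog : ∀ᶠ y in 𝓝 z, 0 < f y ∧ logFlag W V e d y - ∑ k, cumul d k * Real.log (κ k)
      ≤ Real.log (f y) - Real.log (f z))
    (hZs : ∀ k, ∀ᶠ s : ℝ in 𝓝 0, ∀ v w, 0 ≤ pinchForm c f W V e v w (z + s • e k))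
    (hZt : ∀ᶠ s : ℝ in 𝓝[<] 0, ∀ v w, 0 ≤ pinchForm c f W V e v w (z + s • τ)) : False := by
  have hsnd : ∀ i j v, HasJet (fun s : ℝ => sndCoeff W V e i j (z + s • v)) (if i = j then κ i else 0)
      (dird v (sndCoeff W V e i j) z) (dird v (dird v (sndCoeff W V e i j)) z) := fun i j v =>
    (hasJet_line (h.snd_contDiffAt i j) v).congr_jet (h.snd_eq i j) rfl rfl
  have hfst : ∀ i j v, HasJet (fun s : ℝ => fstCoeff W e i j (z + s • v)) (if i = j then 1 else 0)
      (dird v (fstCoeff W e i j) z) (dird v (dird v (fstCoeff W e i j)) z) := fun i j v =>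
    (hasJet_line (h.fst_contDiffAt i j) v).congr_jet (h.fst_eq i j) rfl rfl
  have h01 : (0 : Fin (m + 3)) ≠ 1 := by simp
  have hP : 1 + c * f z ^ 2 = κ 0 * κ 1 := by rw [hcF]; ring
  -- The difference between `log f` and the barrier has a two-sided minimum 0 at `z` along every
  -- line, in space and in time.
  have hlogjet : ∀ v, HasJet (fun s : ℝ => Real.log (f (z + s • v)) - Real.log (f z)
      - (logFlag W V e d (z + s • v) - ∑ k, cumul d k * Real.log (κ k))) 0 _ _ := fun v =>
    ((((hasJet_line hf v).log hF).sub (HasJet.const _)).sub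
      ((h.hasJet_logFlag hκ d v).sub (HasJet.const _))).congr_jet (by ring) rfl rfl
  have hlognn : ∀ v, ∀ᶠ s : ℝ in 𝓝 0, 0 ≤ Real.log (f (z + s • v)) - Real.log (f z)
      - (logFlag W V e d (z + s • v) - ∑ k, cumul d k * Real.log (κ k)) := fun v => by
    filter_upwards [(tendsto_line z v).eventually hlog] with s hs
    linarith [hs.2]
  have hspace : ∀ k (r s : Fin (m + 1) → ℝ),
      κ 1 * dird (e k) (sndCoeff W V e 0 0) z + κ 0 * dird (e k) (sndCoeff W V e 1 1) z
        = 2 * c * f z * dird (e k) f z ∧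
      0 ≤ κ 1 * (dird (e k) (dird (e k) (sndCoeff W V e 0 0)) z
          - 4 * ∑ j, r j * dird (e k) (sndCoeff W V e 0 j.succ.succ) z
          + 2 * ∑ j, r j ^ 2 * κ j.succ.succ)
        + κ 0 * (dird (e k) (dird (e k) (sndCoeff W V e 1 1)) z
          - 4 * ∑ j, s j * dird (e k) (sndCoeff W V e 1 j.succ.succ) z
          + 2 * ∑ j, s j ^ 2 * κ j.succ.succ)
        + 2 * dird (e k) (sndCoeff W V e 0 0) z * dird (e k) (sndCoeff W V e 1 1) z
        - 2 * dird (e k) (sndCoeff W V e 0 1) z ^ 2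
        - κ 0 * κ 1 * (dird (e k) (dird (e k) (fstCoeff W e 0 0)) z + 2 * ∑ j, r j ^ 2
          + (dird (e k) (dird (e k) (fstCoeff W e 1 1)) z + 2 * ∑ j, s j ^ 2))
        - 2 * c * (dird (e k) f z ^ 2 + f z * dird (e k) (dird (e k) f) z) := by
    intro k r s
    -- The test vectors `e_0` and `e_1` move only towards the eigenvectors with index at least 2. As
    -- `h` and `g` are diagonal at `z`, this leaves the first order condition unaffected.
    set R : (Fin (m + 1) → ℝ) → Fin (m + 3) → ℝ := fun r => Fin.cons 0 (Fin.cons 0 r) with hRdef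
    have hR0 : ∀ r, R r 0 = 0 := fun r => rfl
    have hR1 : ∀ r, R r 1 = 0 := fun r => rfl
    have hRj : ∀ r j, R r j.succ.succ = r j := fun r j => rfl
    have hRsum : ∀ r (x : Fin (m + 3) → ℝ), ∑ i, R r i * x i = ∑ j, r j * x j.succ.succ :=
      fun r x => by rw [sum_univ_two_add, hR0, hR1]; simp [hRj]
    have hRq : ∀ r (x : Fin (m + 3) → ℝ), ∑ i, ∑ j, R r i * R r j * (if i = j then x i else 0)
        = ∑ j, r j ^ 2 * x j.succ.succ := fun r x => by
      simp only [mul_ite, mul_zero, Finset.sum_ite_eq, Finset.mem_univ, if_true]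
      rw [sum_univ_two_add, hR0, hR1]
      simp [hRj, sq]
    have hz : ∀ r (x : Fin (m + 3) → ℝ) p, (p = 0 ∨ p = 1) →
        ∑ i, R r i * (if i = p then x i else 0) = 0 := fun r x p hp => by
      simp only [mul_ite, mul_zero, Finset.sum_ite_eq', Finset.mem_univ, if_true]
      rcases hp with rfl | rfl <;> simp [hR0, hR1]
    have hz' : ∀ r (x : Fin (m + 3) → ℝ) p, (p = 0 ∨ p = 1) →
        ∑ i, R r i * (if p = i then x p else 0) = 0 := fun r x p hp => by
      simp only [mul_ite, mul_zero, Finset.sum_ite_eq, Finset.mem_univ, if_true]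
      rcases hp with rfl | rfl <;> simp [hR0, hR1]
    have jS : ∀ p r, (p = 0 ∨ p = 1) → HasJet (fun t : ℝ => bilin
        (fun i j => sndCoeff W V e i j (z + t • e k)) (perturb p (R r) t) (perturb p (R r) t))
        (κ p) (dird (e k) (sndCoeff W V e p p) z)
        (dird (e k) (dird (e k) (sndCoeff W V e p p)) z
          - 4 * ∑ j, r j * dird (e k) (sndCoeff W V e p j.succ.succ) z
          + 2 * ∑ j, r j ^ 2 * κ j.succ.succ) := by
      intro p r hp
      refine (hasJet_bilin_perturb p p (R r) (R r) fun i j => hsnd i j (e k)).congr_jet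
        (by simp) ?_ ?_
      · rw [hz r κ p hp, hz' r κ p hp]; ring
      · rw [hRq, hRsum, hRsum]
        have : ∀ j, dird (e k) (sndCoeff W V e j p) z = dird (e k) (sndCoeff W V e p j) z :=
          fun j => h.dird_snd_symm' j p k
        simp only [this]
        ring
    have jF : ∀ p r, (p = 0 ∨ p = 1) → HasJet (fun t : ℝ => bilin
        (fun i j => fstCoeff W e i j (z + t • e k)) (perturb p (R r) t) (perturb p (R r) t))
        1 0 (dird (e k) (dird (e k) (fstCoeff W e p p)) z + 2 * ∑ j, r j ^ 2) := by
      intro p r hp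
      refine (hasJet_bilin_perturb p p (R r) (R r) fun i j => hfst i j (e k)).congr_jet
        (by simp) ?_ ?_
      · rw [hz r (fun _ => 1) p hp, hz' r (fun _ => 1) p hp, h.dird_fst]; ring
      · rw [hRq r fun _ => 1, hRsum, hRsum]
        simp only [h.dird_fst, mul_zero, Finset.sum_const_zero, mul_one]
        ring
    have jS01 := (hasJet_bilin_perturb 0 1 (R r) (R s) fun i j => hsnd i j (e k)).congr_jet
      (if_neg h01) (b' := dird (e k) (sndCoeff W V e 0 1) z)
      (by rw [hz r κ 1 (Or.inr rfl), hz' s κ 0 (Or.inl rfl)]; ring) rfl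
    have jF01 := (hasJet_bilin_perturb 0 1 (R r) (R s) fun i j => hfst i j (e k)).congr_jet
      (if_neg h01) (b' := 0)
      (by rw [hz r (fun _ => 1) 1 (Or.inr rfl), hz' s (fun _ => 1) 0 (Or.inl rfl), h.dird_fst]
          ring) rfl
    have hjet : HasJet (fun t : ℝ =>
        pinchForm c f W V e (perturb 0 (R r) t) (perturb 1 (R s) t) (z + t • e k)) _ _ _ :=
      (((jS 0 r (Or.inl rfl)).mul (jS 1 s (Or.inr rfl))).sub jS01.sq).sub
        (((HasJet.const 1).add ((hasJet_line hf (e k)).sq.const_mul c)).mul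
          (((jF 0 r (Or.inl rfl)).mul (jF 1 s (Or.inr rfl))).sub jF01.sq))
    have hnn := (hjet.congr_jet (by rw [hP]; ring) rfl rfl).nonneg (by
      filter_upwards [hZs k] with t ht using ht _ _)
    refine ⟨by linarith [hnn.1], ?_⟩
    have h2 := hnn.2
    rw [hP] at h2
    refine h2.trans_eq ?_
    ring
  -- With the test vectors fixed, the form is nonnegative at earlier times and zero at `z`, so its
  -- time derivative is nonpositive.
  have htime : κ 1 * dird τ (sndCoeff W V e 0 0) z + κ 0 * dird τ (sndCoeff W V e 1 1) z
      - κ 0 * κ 1 * (dird τ (fstCoeff W e 0 0) z + dird τ (fstCoeff W e 1 1) z)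
      - 2 * c * f z * dird τ f z ≤ 0 := by
    have jS : ∀ p q, HasJet (fun t : ℝ => bilin (fun i j => sndCoeff W V e i j (z + t • τ))
        (perturb p 0 t) (perturb q 0 t)) _ (dird τ (sndCoeff W V e p q) z) _ := fun p q =>
      (hasJet_bilin_perturb p q 0 0 fun i j => hsnd i j τ).congr_jet rfl (by simp) rfl
    have jF : ∀ p q, HasJet (fun t : ℝ => bilin (fun i j => fstCoeff W e i j (z + t • τ))
        (perturb p 0 t) (perturb q 0 t)) _ (dird τ (fstCoeff W e p q) z) _ := fun p q =>
      (hasJet_bilin_perturb p q 0 0 fun i j => hfst i j τ).congr_jet rfl (by simp) rfl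
    have hjet : HasJet (fun t : ℝ =>
        pinchForm c f W V e (perturb 0 0 t) (perturb 1 0 t) (z + t • τ)) _ _ _ :=
      (((jS 0 0).mul (jS 1 1)).sub (jS 0 1).sq).sub
        (((HasJet.const 1).add ((hasJet_line hf τ).sq.const_mul c)).mul
          (((jF 0 0).mul (jF 1 1)).sub (jF 0 1).sq))
    have hjet' := hjet.congr_jet (a' := 0) (by simp [hP]) rfl rfl
    have hd' := hjet'.hasDerivAt
    obtain ⟨φ', -, h0, -⟩ := hjet'
    have hle := nonpos_of_hasDerivAt_left hd' h0 (by
      filter_upwards [hZt] with t ht using ht _ _)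
    simp only [if_true, if_neg h01, hP] at hle
    linarith
  have hwm := cumul_mono hd
  have hw0 := cumul_nonneg hd
  refine false_of_jet_conditions (κ := κ) (w := cumul d) (f := fun k => dird (e k) f z)
    (ff := fun k => dird (e k) (dird (e k) f) z) (F := f z) (c := c) (ft := dird τ f z)
    (T := fun k i j => dird (e k) (sndCoeff W V e i j) z)
    (hh := fun i k => dird (e k) (dird (e k) (sndCoeff W V e i i)) z)
    (gg := fun i k => dird (e k) (dird (e k) (fstCoeff W e i i)) z)
    hκ hm hw0 hwm hds hF hc hcF (fun k i j => h.dird_snd_symm i j k)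
    (fun k i j => h.dird_snd_symm' i j k) (fun k => (hspace k 0 0).1)
    (fun k r s => (hspace k r s).2) ?_ ?_ ?_ ?_
  · intro i _
    have h1 := ((hlogjet (e i)).nonneg (hlognn (e i))).2
    have h2 : ∑ k, ∑ l, cumul d (min k l) * (dird (e i) (sndCoeff W V e k l) z
          * dird (e i) (sndCoeff W V e l k) z / (κ k * κ l)
          - dird (e i) (fstCoeff W e k l) z * dird (e i) (fstCoeff W e l k) z)
        = ∑ k, ∑ l, cumul d (min k l) * dird (e i) (sndCoeff W V e k l) z ^ 2 / (κ k * κ l) := by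
      refine Finset.sum_congr rfl fun k _ => Finset.sum_congr rfl fun l _ => ?_
      rw [h.dird_fst, h.dird_snd_symm' l k i]
      ring
    rw [h2] at h1
    linarith
  -- The barrier inequality holds also at later times, hence the time derivative of `log f` equals
  -- that of the barrier.
  · have h1 := ((hlogjet τ).nonneg (hlognn τ)).1
    have h2 : dird τ f z = f z * ∑ k, cumul d k * (dird τ (sndCoeff W V e k k) z / κ k
        - dird τ (fstCoeff W e k k) z) := by
      have : dird τ f z / f z = ∑ k, cumul d k * (dird τ (sndCoeff W V e k k) z / κ k
        - dird τ (fstCoeff W e k k) z) := by linarith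
      rw [← this]
      field_simp
    rw [h2, Finset.mul_sum]
    refine (Finset.sum_congr rfl fun k _ => ?_).le
    rw [h.dird_time_snd hf hW, h.dird_time_fst hf hW, if_pos rfl]
    have := (hκ k).ne'
    field_simp
    ring
  · rw [h.dird_time_snd hf hW, h.dird_time_snd hf hW, h.dird_time_fst hf hW,
      h.dird_time_fst hf hW, if_pos rfl, if_pos rfl] at htime
    linarith
  · intro i k hik
    exact h.simons hik

end flow

/-! ### Quadratic changes of coordinates -/

section quad

variable {E Y : Type*} [NormedAddCommGroup E] [NormedSpace ℝ E] [NormedAddCommGroup Y]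
  [NormedSpace ℝ Y]

theorem dird_add_left (v w : E) (f : E → Y) (z : E) :
    dird (v + w) f z = dird v f z + dird w f z := by simp [dird]

theorem dird_smul_left (c : ℝ) (v : E) (f : E → Y) (z : E) :
    dird (c • v) f z = c • dird v f z := by simp [dird]

theorem dird_sum_left {ι : Type*} (s : Finset ι) (v : ι → E) (f : E → Y) (z : E) :
    dird (∑ i ∈ s, v i) f z = ∑ i ∈ s, dird (v i) f z := by simp [dird, map_sum]

theorem dird_add_apply {f g : E → Y} {z : E} (hf : DifferentiableAt ℝ f z)
    (hg : DifferentiableAt ℝ g z) (v : E) :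
    dird v (fun y => f y + g y) z = dird v f z + dird v g z := by
  simp [dird, fderiv_fun_add hf hg]

theorem dird_sum_apply {ι : Type*} {s : Finset ι} {f : ι → E → Y} {z : E}
    (hf : ∀ i ∈ s, DifferentiableAt ℝ (f i) z) (v : E) :
    dird v (fun y => ∑ i ∈ s, f i y) z = ∑ i ∈ s, dird v (f i) z := by
  simp [dird, fderiv_fun_sum hf, sum_apply]

/-- A quadratic map with prescribed derivatives at the origin. -/
def quadMap (z : E) (A : E →L[ℝ] E) (B : E →L[ℝ] E →L[ℝ] E) (y : E) : E :=
  z + A y + (1 / 2 : ℝ) • B y y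

variable {z : E} {A : E →L[ℝ] E} {B : E →L[ℝ] E →L[ℝ] E}

theorem quadMap_zero : quadMap z A B 0 = z := by simp [quadMap]

theorem contDiff_quadMap : ContDiff ℝ ∞ (quadMap z A B) := by
  have h1 : ContDiff ℝ ∞ fun y => B y := B.contDiff
  have h2 : ContDiff ℝ ∞ fun y => B y y := h1.clm_apply contDiff_id
  exact (contDiff_const.add A.contDiff).add (contDiff_const.smul h2)

theorem tendsto_quadMap : Filter.Tendsto (quadMap z A B) (𝓝 0) (𝓝 z) := by
  have := (contDiff_quadMap (z := z) (A := A) (B := B)).continuous.tendsto 0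
  rwa [quadMap_zero] at this

theorem fderiv_quadMap (hB : ∀ v w, B v w = B w v) (y v : E) :
    fderiv ℝ (quadMap z A B) y v = A v + B y v := by
  have h1 : HasFDerivAt (fun y => B y y) _ y :=
    B.hasFDerivAt_of_bilinear (hasFDerivAt_id y) (hasFDerivAt_id y)
  have h2 := ((hasFDerivAt_const z y).add A.hasFDerivAt).add (h1.const_smul (1 / 2 : ℝ))
  have h3 := congrArg (fun L => L v) h2.fderiv
  refine h3.trans ?_
  have h4 : (ContinuousLinearMap.compL ℝ E E E (B y) (ContinuousLinearMap.id ℝ E)) v = B y v := rfl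
  simp only [zero_add, add_apply, smul_apply,
    ContinuousLinearMap.precompR_apply, ContinuousLinearMap.precompL_apply,
    ContinuousLinearMap.id_apply]
  rw [h4, hB v y, ← two_smul ℝ (B y v), smul_smul]
  norm_num

theorem dird_comp_quadMap (hB : ∀ v w, B v w = B w v) {f : E → Y} {y : E}
    (hf : DifferentiableAt ℝ f (quadMap z A B y)) (v : E) :
    dird v (fun y => f (quadMap z A B y)) y = dird (A v + B y v) f (quadMap z A B y) := by
  have h := fderiv_comp y hf (contDiff_quadMap.differentiable (by simp) y)
  have h2 := congrArg (fun L => L v) h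
  refine h2.trans ?_
  simp only [ContinuousLinearMap.comp_apply, fderiv_quadMap hB, dird]

theorem eventually_dird_comp_quadMap (hB : ∀ v w, B v w = B w v) {f : E → Y}
    (hf : ContDiffAt ℝ ∞ f z) (v : E) :
    dird v (fun y => f (quadMap z A B y)) =ᶠ[𝓝 0]
      fun y => dird (A v + B y v) f (quadMap z A B y) := by
  filter_upwards [tendsto_quadMap.eventually (eventually_differentiableAt hf)] with y hy
    using dird_comp_quadMap hB hy v

end quad

/-! ### Behaviour of the fundamental forms under changes of coordinates -/

section germ

variable {E : Type*} [NormedAddCommGroup E] [NormedSpace ℝ E] {n : ℕ}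

theorem lor_dird_sum (W V : E → Mink n) (e : Fin n → E) (z : E) (v w : Fin n → ℝ) :
    lor (dird (∑ k, v k • e k) V z) (dird (∑ k, w k • e k) W z)
      = bilin (fun i j => sndCoeff W V e i j z) v w := by
  simp only [dird_sum_left, dird_smul_left, lor_sum_left, lor_sum_right, lor_smul_left,
    lor_smul_right, bilin, sndCoeff, Finset.mul_sum]
  rw [Finset.sum_comm]
  exact Finset.sum_congr rfl fun i _ => Finset.sum_congr rfl fun j _ => by ring

open Matrix in
theorem bilin_eq_dotProduct (A : Matrix (Fin n) (Fin n) ℝ) (v w : Fin n → ℝ) :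
    bilin (fun i j => A i j) v w = v ⬝ᵥ (A *ᵥ w) := by
  simp only [bilin, dotProduct, mulVec, Finset.mul_sum]
  exact Finset.sum_congr rfl fun i _ => Finset.sum_congr rfl fun j _ => by ring

open Matrix in
theorem bilin_columns (A J : Matrix (Fin n) (Fin n) ℝ) (i j : Fin n) :
    bilin (fun i j => A i j) (fun k => J k i) (fun k => J k j) = (Jᵀ * A * J) i j := by
  rw [bilin_eq_dotProduct, Matrix.mul_assoc]
  rfl

theorem HypGerm.sndMat_isHermitian {W V : E → Mink n} {e : Fin n → E} {z : E}
    (h : HypGerm W V e z) : ∀ᶠ y in 𝓝 z, (sndMat W V e y).IsHermitian := by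
  have : ∀ᶠ y in 𝓝 z, ∀ i j, sndCoeff W V e i j y = sndCoeff W V e j i y := by
    rw [Filter.eventually_all]; intro i
    rw [Filter.eventually_all]; intro j
    exact h.second_symm i j
  filter_upwards [this] with y hy
  ext i j
  simpa [sndMat] using hy j i

theorem fstMat_isHermitian (W : E → Mink n) (e : Fin n → E) (y : E) :
    (fstMat W e y).IsHermitian := by
  ext i j
  simpa [fstMat, fstCoeff] using lor_comm _ _

theorem tendsto_sndMat {W V : E → Mink n} {e : Fin n → E} {z : E}
    (hW : ContDiffAt ℝ ∞ W z) (hV : ContDiffAt ℝ ∞ V z) :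
    Filter.Tendsto (sndMat W V e) (𝓝 z) (𝓝 (sndMat W V e z)) := by
  refine tendsto_pi_nhds.2 fun i => tendsto_pi_nhds.2 fun j => ?_
  exact (contDiffAt_lor (dird_contDiffAt hV _) (dird_contDiffAt hW _)).continuousAt

theorem HypGerm.posDef {W V : E → Mink n} {e : Fin n → E} {z : E} (h : HypGerm W V e z)
    (hp : (fstMat W e z).PosDef) : ∀ᶠ y in 𝓝 z, (fstMat W e y).PosDef :=
  eventually_posDef (tendsto_sndMat h.smooth h.smooth) hp
    (Filter.Eventually.of_forall fun y => fstMat_isHermitian W e y)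

/-- By `hspan` the new coordinate vectors remain combinations of the `e k`, so they stay tangent to
the hypersurfaces and do not pick up a time component. -/
theorem HypGerm.comp_quadMap {X N : E → Mink n} {e : Fin n → E} {z : E} (h : HypGerm X N e z)
    {A : E →L[ℝ] E} {B : E →L[ℝ] E →L[ℝ] E} (hB : ∀ v w, B v w = B w v)
    (hspan : ∀ y j, ∃ c : Fin n → ℝ, A (e j) + B y (e j) = ∑ k, c k • e k) :
    HypGerm (fun y => X (quadMap z A B y)) (fun y => N (quadMap z A B y)) e 0 where
  smooth := by
    have := h.smooth
    rw [← quadMap_zero (z := z) (A := A) (B := B)] at this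
    exact this.comp 0 contDiff_quadMap.contDiffAt
  smooth_normal := by
    have := h.smooth_normal
    rw [← quadMap_zero (z := z) (A := A) (B := B)] at this
    exact this.comp 0 contDiff_quadMap.contDiffAt
  norm := tendsto_quadMap.eventually h.norm
  norm_normal := tendsto_quadMap.eventually h.norm_normal
  normal := tendsto_quadMap.eventually h.normal
  normal_dird := fun i => by
    have : ∀ᶠ y in 𝓝 z, ∀ i, lor (N y) (dird (e i) X y) = 0 := Filter.eventually_all.2 h.normal_dird
    filter_upwards [eventually_dird_comp_quadMap hB h.smooth (e i),
      (tendsto_quadMap (A := A) (B := B)).eventually this] with y h1 h2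
    obtain ⟨c, hc⟩ := hspan y i
    rw [h1, hc]
    simp [dird_sum_left, dird_smul_left, lor_sum_right, lor_smul_right, h2]

end germ

/-! ### The maximum principle in arbitrary coordinates -/

section flow

variable {n : ℕ}

/-- The spatial coordinate functionals on space-time. -/
def spaceProj (n : ℕ) (i : Fin n) : (ℝ × Coord n) →L[ℝ] ℝ :=
  (EuclideanSpace.proj i).comp (ContinuousLinearMap.snd ℝ ℝ (Coord n))

/-- The spatial coordinate vectors of space-time. -/
def spaceVec (n : ℕ) (i : Fin n) : ℝ × Coord n := (0, EuclideanSpace.single i 1)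

/-- The time direction of space-time. -/
def timeVec (n : ℕ) : ℝ × Coord n := (1, 0)

@[simp] theorem spaceProj_spaceVec (i j : Fin n) :
    spaceProj n i (spaceVec n j) = if i = j then 1 else 0 := by
  simp [spaceProj, spaceVec]

@[simp] theorem spaceProj_timeVec (i : Fin n) : spaceProj n i (timeVec n) = 0 := by
  simp [spaceProj, timeVec]

@[simp] theorem fst_spaceVec (i : Fin n) : (spaceVec n i).1 = 0 := rfl

@[simp] theorem fst_timeVec : (timeVec n).1 = 1 := rfl

/-- The linear part of the change of coordinates with columns `p`. -/
def frameMap (p : Fin n → ℝ × Coord n) : (ℝ × Coord n) →L[ℝ] (ℝ × Coord n) :=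
  (ContinuousLinearMap.fst ℝ ℝ (Coord n)).smulRight (timeVec n)
    + ∑ j, (spaceProj n j).smulRight (p j)

@[simp] theorem frameMap_spaceVec (p : Fin n → ℝ × Coord n) (j : Fin n) :
    frameMap p (spaceVec n j) = p j := by
  simp [frameMap, sum_apply]

@[simp] theorem frameMap_timeVec (p : Fin n → ℝ × Coord n) :
    frameMap p (timeVec n) = timeVec n := by
  simp [frameMap, sum_apply]

/-- The quadratic part of the change of coordinates. -/
def frameQuad (Q : Fin n → Fin n → ℝ × Coord n) :
    (ℝ × Coord n) →L[ℝ] (ℝ × Coord n) →L[ℝ] (ℝ × Coord n) :=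
  ∑ i, ∑ j, (spaceProj n i).smulRight ((spaceProj n j).smulRight (Q i j))

theorem frameQuad_apply (Q : Fin n → Fin n → ℝ × Coord n) (v w : ℝ × Coord n) :
    frameQuad Q v w = ∑ i, ∑ j, (spaceProj n i v * spaceProj n j w) • Q i j := by
  simp [frameQuad, sum_apply, smul_smul]

theorem frameQuad_comm {Q : Fin n → Fin n → ℝ × Coord n} (hQ : ∀ i j, Q i j = Q j i)
    (v w : ℝ × Coord n) : frameQuad Q v w = frameQuad Q w v := by
  rw [frameQuad_apply, frameQuad_apply, Finset.sum_comm]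
  refine Finset.sum_congr rfl fun i _ => Finset.sum_congr rfl fun j _ => ?_
  rw [hQ, mul_comm]

@[simp] theorem frameQuad_spaceVec (Q : Fin n → Fin n → ℝ × Coord n) (v : ℝ × Coord n)
    (j : Fin n) : frameQuad Q v (spaceVec n j) = ∑ i, spaceProj n i v • Q i j := by
  simp [frameQuad_apply]

@[simp] theorem frameQuad_timeVec (Q : Fin n → Fin n → ℝ × Coord n) (v : ℝ × Coord n) :
    frameQuad Q v (timeVec n) = 0 := by
  simp [frameQuad_apply]

/-- The columns of the matrix `P` as vectors of space-time. -/
def frameVec (P : Matrix (Fin n) (Fin n) ℝ) (j : Fin n) : ℝ × Coord n := ∑ k, P k j • spaceVec n k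

@[simp] theorem fst_frameVec (P : Matrix (Fin n) (Fin n) ℝ) (j : Fin n) :
    (frameVec P j).1 = 0 := by
  simp [frameVec, Prod.fst_sum]

/-- Normal coordinates that diagonalize the second fundamental form. -/
theorem HypGerm.exists_normal {X N : ℝ × Coord n → Mink n} {z : ℝ × Coord n}
    (h : HypGerm X N (spaceVec n) z) {P : Matrix (Fin n) (Fin n) ℝ} {κ : Fin n → ℝ}
    (hG : P.transpose * fstMat X (spaceVec n) z * P = 1)
    (hH : P.transpose * sndMat X N (spaceVec n) z * P = Matrix.diagonal κ) :
    ∃ (Θ : ℝ × Coord n → ℝ × Coord n) (J : ℝ × Coord n → Matrix (Fin n) (Fin n) ℝ),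
      Filter.Tendsto Θ (𝓝 0) (𝓝 z) ∧ Θ 0 = z ∧ ContDiffAt ℝ ∞ Θ 0 ∧
      (∀ (s : ℝ) k, (Θ (s • spaceVec n k)).1 = z.1) ∧ (∀ s : ℝ, (Θ (s • timeVec n)).1 = z.1 + s) ∧
      HypGermNormal (fun y => X (Θ y)) (fun y => N (Θ y)) (spaceVec n) 0 κ ∧
      (∀ᶠ y in 𝓝 0, fstMat (fun y => X (Θ y)) (spaceVec n) y
        = (J y).transpose * fstMat X (spaceVec n) (Θ y) * J y) ∧
      (∀ᶠ y in 𝓝 0, sndMat (fun y => X (Θ y)) (fun y => N (Θ y)) (spaceVec n) y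
        = (J y).transpose * sndMat X N (spaceVec n) (Θ y) * J y) ∧
      (∀ᶠ y in 𝓝 0, dird (timeVec n) (fun y => X (Θ y)) y = dird (timeVec n) X (Θ y)) := by
  set e := spaceVec n with he
  set p := frameVec P with hp
  set b : Fin n → Fin n → Fin n → ℝ := fun i j k =>
    lor (dird (p i) (dird (p j) X) z) (dird (p k) X z) with hb
  -- The frame `p` is orthonormal at `z`, so `b i j q` are the tangential components of the second
  -- derivatives of `X`; the quadratic term subtracts them. It involves no time variable, so time
  -- slices and the time direction are preserved.
  set Q : Fin n → Fin n → ℝ × Coord n := fun i j => -∑ q, b i j q • p q with hQ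
  have hQs : ∀ i j, Q i j = Q j i := fun i j => by
    simp only [hQ, hb, (dird_comm h.smooth (p i) (p j)).eq_of_nhds]
  set A := frameMap p with hA
  set B := frameQuad Q with hB
  have hBs : ∀ v w, B v w = B w v := frameQuad_comm hQs
  have hAe : ∀ j, A (e j) = p j := frameMap_spaceVec p
  have hBe : ∀ y j, B y (e j) = ∑ i, spaceProj n i y • Q i j := frameQuad_spaceVec Q
  have hQe : ∀ i j, Q i j = ∑ k, (-∑ q, b i j q * P k q) • e k := fun i j => by
    simp only [hQ, hp, frameVec, Finset.smul_sum, smul_smul, neg_smul, Finset.sum_smul,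
      Finset.sum_neg_distrib]
    rw [Finset.sum_comm]
  set J : ℝ × Coord n → Matrix (Fin n) (Fin n) ℝ := fun y => Matrix.of fun k j =>
    P k j + ∑ i, spaceProj n i y * (-∑ q, b i j q * P k q) with hJ
  have hJe : ∀ y j, A (e j) + B y (e j) = ∑ k, J y k j • e k := fun y j => by
    rw [hAe, hBe]
    simp only [hQe, hJ, Matrix.of_apply, add_smul, Finset.sum_add_distrib, Finset.smul_sum,
      smul_smul, Finset.sum_smul, hp, frameVec]
    rw [Finset.sum_comm (s := Finset.univ) (t := Finset.univ)]
  have hd : ∀ j, dird (e j) (fun y => X (quadMap z A B y)) =ᶠ[𝓝 0]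
      fun y => dird (∑ k, J y k j • e k) X (quadMap z A B y) := fun j => by
    filter_upwards [eventually_dird_comp_quadMap hBs h.smooth (e j)] with y hy
    rw [hy, hJe]
  have hd' : ∀ j, dird (e j) (fun y => N (quadMap z A B y)) =ᶠ[𝓝 0]
      fun y => dird (∑ k, J y k j • e k) N (quadMap z A B y) := fun j => by
    filter_upwards [eventually_dird_comp_quadMap hBs h.smooth_normal (e j)] with y hy
    rw [hy, hJe]
  have hF : ∀ᶠ y in 𝓝 0, fstMat (fun y => X (quadMap z A B y)) e y
        = (J y).transpose * fstMat X e (quadMap z A B y) * J y := by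
    filter_upwards [Filter.eventually_all.2 hd] with y hy
    ext i j
    rw [← bilin_columns]
    simp only [fstMat, Matrix.of_apply, fstCoeff, hy]
    exact lor_dird_sum X X e _ _ _
  have hS : ∀ᶠ y in 𝓝 0, sndMat (fun y => X (quadMap z A B y)) (fun y => N (quadMap z A B y)) e y
        = (J y).transpose * sndMat X N e (quadMap z A B y) * J y := by
    filter_upwards [Filter.eventually_all.2 hd, Filter.eventually_all.2 hd'] with y hy hy'
    ext i j
    rw [← bilin_columns]
    simp only [sndMat, Matrix.of_apply, sndCoeff, hy, hy']
    exact lor_dird_sum X N e _ _ _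
  have hJ0 : J 0 = P := by ext i j; simp [hJ]
  have hF0 : ∀ i j, fstCoeff (fun y => X (quadMap z A B y)) e i j 0 = if i = j then 1 else 0 := by
    intro i j
    have := hF.self_of_nhds
    rw [hJ0, quadMap_zero, hG] at this
    have := congrFun (congrFun this i) j
    rwa [Matrix.one_apply] at this
  have hd0 : ∀ j, dird (e j) (fun y => X (quadMap z A B y)) 0 = dird (p j) X z := fun j => by
    have := (hd j).eq_of_nhds
    rw [this, hJ0, quadMap_zero, hp, frameVec]
  refine ⟨quadMap z A B, J, tendsto_quadMap, quadMap_zero, contDiff_quadMap.contDiffAt, ?_, ?_,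
    ⟨h.comp_quadMap hBs fun y j => ⟨fun k => J y k j, hJe y j⟩, hF0, ?_, ?_⟩, hF, hS, ?_⟩
  · intro s k
    simp [quadMap, hAe, hBe, hQ, Prod.fst_sum, hp]
  · intro s
    simp [quadMap, hA, hB, frameQuad_timeVec]
  · intro i j
    have := hS.self_of_nhds
    rw [hJ0, quadMap_zero, hH] at this
    have := congrFun (congrFun this i) j
    rwa [Matrix.diagonal_apply] at this
  · intro i j k
    have h1 : dird (e j) (fun y => X (quadMap z A B y)) =ᶠ[𝓝 0] fun y =>
        dird (p j) X (quadMap z A B y)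
          + ∑ i, spaceProj n i y • dird (Q i j) X (quadMap z A B y) := by
      filter_upwards [eventually_dird_comp_quadMap hBs h.smooth (e j)] with y hy
      rw [hy, hAe, hBe, dird_add_left, dird_sum_left]
      simp only [dird_smul_left]
    have hc : ∀ v, ContDiffAt ℝ ∞ (fun y => dird v X (quadMap z A B y)) 0 := fun v => by
      have := dird_contDiffAt h.smooth v
      rw [← quadMap_zero (z := z) (A := A) (B := B)] at this
      exact this.comp 0 contDiff_quadMap.contDiffAt
    have hdf : ∀ v, DifferentiableAt ℝ (fun y => dird v X (quadMap z A B y)) 0 := fun v =>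
      (hc v).differentiableAt (by simp)
    have h2 : dird (e i) (dird (e j) (fun y => X (quadMap z A B y))) 0
        = dird (p i) (dird (p j) X) z + dird (Q i j) X z := by
      rw [(dird_congr h1 (e i)).eq_of_nhds]
      have h3 : dird (e i) (fun y => dird (p j) X (quadMap z A B y)) 0
          = dird (p i) (dird (p j) X) z := by
        rw [(eventually_dird_comp_quadMap hBs (dird_contDiffAt h.smooth (p j)) (e i)).eq_of_nhds,
          quadMap_zero, hAe]
        simp
      have h4 : ∀ l, dird (e i) (fun y => spaceProj n l y • dird (Q l j) X (quadMap z A B y)) 0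
          = spaceProj n l (e i) • dird (Q l j) X z := fun l => by
        rw [(dird_smul (spaceProj n l).contDiff.contDiffAt (hc (Q l j)) (e i)).eq_of_nhds]
        simp [dird, quadMap_zero]
      have hsm : ∀ l, DifferentiableAt ℝ
          (fun y => spaceProj n l y • dird (Q l j) X (quadMap z A B y)) 0 := fun l =>
        ((spaceProj n l).differentiableAt).smul (hdf _)
      rw [dird_add_apply (hdf _) (DifferentiableAt.fun_sum fun l _ => hsm l), h3,
        dird_sum_apply fun l _ => hsm l]
      simp only [h4]
      simp [he]
    have hpp : ∀ q k, lor (dird (p q) X z) (dird (p k) X z) = if q = k then 1 else 0 := by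
      intro q k
      have := hF0 q k
      simpa only [fstCoeff, hd0] using this
    rw [h2, hd0, lor_add_left]
    have h7 : dird (Q i j) X z = -∑ q, b i j q • dird (p q) X z := by
      simp only [hQ, ← neg_one_smul ℝ (∑ q, b i j q • p q), dird_smul_left, dird_sum_left]
      simp
    rw [h7, lor_neg_left, lor_sum_left]
    simp [lor_smul_left, hpp, hb]
  · filter_upwards [eventually_dird_comp_quadMap hBs h.smooth (timeVec n)] with y hy
    rw [hy, hA, hB, frameMap_timeVec, frameQuad_timeVec, add_zero]

open Matrix in
/-- The pinching condition is not violated for the first time at an interior point. -/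
theorem HypGerm.false_of_first_touching {m : ℕ} {X N : ℝ × Coord (m + 3) → Mink (m + 3)}
    {z : ℝ × Coord (m + 3)} (h : HypGerm X N (spaceVec (m + 3)) z)
    (hG : (fstMat X (spaceVec (m + 3)) z).PosDef) {F : (Fin (m + 3) → ℝ) → ℝ} (hF : IsSpeed F)
    {κ : ℝ × Coord (m + 3) → Fin (m + 3) → ℝ}
    (hκ : κ = fun y => genEig (fstMat X (spaceVec (m + 3)) y) (sndMat X N (spaceVec (m + 3)) y))
    (hev : ∀ᶠ y in 𝓝 z, dird (timeVec (m + 3)) X y = -(F (κ y) • N y))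
    (hpos : κ z ∈ posCone (m + 3)) {c : ℝ} (hc : 0 < c)
    (hzero : c * F (κ z) ^ 2 = κ z 0 * κ z 1 - 1)
    (hpin : ∀ᶠ y in 𝓝 z, y.1 ≤ z.1 → c * F (κ y) ^ 2 ≤ κ y 0 * κ y 1 - 1) : False := by
  set e := spaceVec (m + 3) with he
  have hGe := h.posDef hG
  have hHe := h.sndMat_isHermitian
  have hHz : (sndMat X N e z).PosDef :=
    posDef_of_genEig_pos hG hHe.self_of_nhds fun i => by
      have := hpos i
      rwa [hκ] at this
  have hHp : ∀ᶠ y in 𝓝 z, (sndMat X N e y).PosDef :=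
    eventually_posDef (tendsto_sndMat h.smooth h.smooth_normal) hHz hHe
  obtain ⟨hmono, P, -, hP1, hP2⟩ := exists_simultaneous_diagonal hG hHe.self_of_nhds
  obtain ⟨Θ, J, hΘ, hΘ0, hΘs, hsp, hti, hn, hfst, hsnd, hdt⟩ := h.exists_normal hP1 hP2
  have hκz : genEig (fstMat X e z) (sndMat X N e z) = κ z := by rw [hκ]
  rw [hκz] at hn hmono
  have hκp : ∀ᶠ y in 𝓝 z, κ y ∈ posCone (m + 3) := by
    filter_upwards [hGe, hHp] with y h1 h2 i
    rw [hκ]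
    exact genEig_pos_of_posDef h1 h2 i
  have hκm : ∀ᶠ y in 𝓝 z, Monotone (κ y) := by
    filter_upwards [hGe, hHe] with y h1 h2
    rw [hκ]
    exact genEig_monotone h1 h2
  -- The weights are frozen at the touching point.
  obtain ⟨d, hd, hdw⟩ := exists_cumul_eq (hF.logGrad_nonneg hpos) (hF.logGrad_mono hpos hmono)
  -- The normal speed equals `F(κ)` near the point and is smooth by construction, so no smoothness
  -- of the eigenvalues is needed.
  set f : ℝ × Coord (m + 3) → ℝ := fun y =>
    -lor (dird (timeVec (m + 3)) (fun y => X (Θ y)) y) (N (Θ y)) with hf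
  have hfe : ∀ᶠ y in 𝓝 0, f y = F (κ (Θ y)) := by
    filter_upwards [hdt, hΘ.eventually hev, hΘ.eventually h.norm_normal] with y h1 h2 h3
    rw [hf]
    simp only [h1, h2, lor_neg_left, lor_smul_left, h3]
    ring
  have hf0 : f 0 = F (κ z) := by rw [hfe.self_of_nhds, hΘ0]
  have hpf : ∀ᶠ y in 𝓝 0, (Θ y).1 ≤ z.1 → ∀ v w, 0 ≤
      pinchForm c f (fun y => X (Θ y)) (fun y => N (Θ y)) e v w y := by
    filter_upwards [hfst, hsnd, hΘ.eventually hpin, hΘ.eventually hGe, hΘ.eventually hHe,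
      hΘ.eventually hκp, hΘ.eventually hκm, hfe] with y h1 h2 h3 h4 h5 h6 h7 h8 hle v w
    have hb1 : ∀ v w, bilin (fun i j => fstCoeff (fun y => X (Θ y)) e i j y) v w
        = (J y *ᵥ v) ⬝ᵥ (fstMat X e (Θ y) *ᵥ (J y *ᵥ w)) := fun v w => by
      rw [← dotProduct_transpose_mul_mul, ← h1, ← bilin_eq_dotProduct]
      rfl
    have hb2 : ∀ v w, bilin (fun i j => sndCoeff (fun y => X (Θ y)) (fun y => N (Θ y)) e i j y) v w
        = (J y *ᵥ v) ⬝ᵥ (sndMat X N e (Θ y) *ᵥ (J y *ᵥ w)) := fun v w => by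
      rw [← dotProduct_transpose_mul_mul, ← h2, ← bilin_eq_dotProduct]
      rfl
    -- The two smallest curvatures have the smallest product, so the pinching at nearby points
    -- passes to all pairs of vectors through `gram_two_le`.
    have h01 : ∀ a b : Fin (m + 3), a ≠ b → κ (Θ y) 0 * κ (Θ y) 1 ≤ κ (Θ y) a * κ (Θ y) b := by
      have key : ∀ a b : Fin (m + 3), a < b →
          κ (Θ y) 0 * κ (Θ y) 1 ≤ κ (Θ y) a * κ (Θ y) b := fun a b hab => by
        have hb : (1 : Fin (m + 3)) ≤ b := by
          rw [Fin.le_def]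
          have := Fin.lt_def.1 hab
          simp only [Fin.val_one]
          omega
        exact mul_le_mul (h7 (Fin.zero_le _)) (h7 hb) (h6 1).le (h6 a).le
      intro a b hab
      rcases lt_or_gt_of_ne hab with h | h
      · exact key a b h
      · rw [mul_comm (κ (Θ y) a)]; exact key b a h
    have hgram := gram_two_le h4 h5 (1 + c * f y ^ 2) (fun a b hab => by
      have := h01 a b hab
      have h9 := h3 hle
      rw [hκ] at this h9
      rw [h8, hκ]
      linarith) (J y *ᵥ v) (J y *ᵥ w)
    simp only [pinchForm, hb1, hb2]
    linarith
  refine hn.false_of_first_zero (τ := timeVec (m + 3)) (d := d) (f := f) ?_ ?_ hpos hmono hd ?_ ?_ hc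
    ?_ ?_ ?_ ?_
  · exact (contDiffAt_lor (dird_contDiffAt hn.smooth _) hn.smooth_normal).neg
  · filter_upwards [hfe, hdt, hΘ.eventually hev] with y h1 h2 h3
    rw [h2, h3, h1]
  · rw [hdw]; exact hF.sum_logGrad hpos
  · rw [hf0]; exact hF.pos _ hpos
  · rw [hf0]; exact hzero
  · have hpd : ∀ᶠ y in 𝓝 0, (fstMat (fun y => X (Θ y)) e y).PosDef := hn.toHypGerm.posDef (by
      have : fstMat (fun y => X (Θ y)) e 0 = 1 := by
        ext i j
        rw [Matrix.one_apply]
        exact hn.fst_eq i j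
      rw [this]
      exact Matrix.PosDef.one)
    filter_upwards [hfst, hsnd, hΘ.eventually hGe, hΘ.eventually hHp, hΘ.eventually hκp, hfe, hpd]
      with y h1 h2 h4 h5 h6 h8 h9
    rw [h1] at h9
    refine ⟨by rw [h8]; exact hF.pos _ h6, ?_⟩
    -- The barrier lies below `Σ w_k log κ_k`, with the frozen weights, by interlacing on each
    -- block. That sum is in turn controlled by the tangent inequality for `log F` at the touching
    -- point.
    have hl : logFlag (fun y => X (Θ y)) (fun y => N (Θ y)) e d y
        ≤ ∑ k, cumul d k * Real.log (κ (Θ y) k) := by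
      rw [← sum_mul_tail, logFlag]
      refine Finset.sum_le_sum fun k _ => mul_le_mul_of_nonneg_left ?_ (hd k)
      rw [h1, h2, hκ]
      exact log_det_tail_le h4 h5 (J y) h9 k
    have hF2 := hF.log_le hpos h6
    rw [hf0, h8]
    rw [hdw] at hl ⊢
    simp only [mul_sub, Finset.sum_sub_distrib] at hF2
    linarith
  · intro k
    filter_upwards [(tendsto_line 0 (e k)).eventually hpf] with s hs
    refine hs ?_
    rw [zero_add, hsp]
  · have h1 : ∀ᶠ s : ℝ in 𝓝[<] 0, _ :=
      ((tendsto_line 0 (timeVec (m + 3))).eventually hpf).filter_mono nhdsWithin_le_nhds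
    filter_upwards [h1, self_mem_nhdsWithin] with s hs hs0
    refine hs ?_
    rw [zero_add, hti]
    have : s < 0 := hs0
    linarith

end flow

/-! ### Minkowski space -/

/-- The orthogonal complement of a timelike vector is spacelike, by Cauchy–Schwarz in the spatial
components. Hence the first fundamental form is positive definite. -/
theorem lor_self_pos_of_orthogonal {n : ℕ} {p v : Mink n} (hp : lor p p = -1) (hpv : lor p v = 0)
    (hv : v ≠ 0) : 0 < lor v v := by
  simp only [lor] at *
  set a := ∑ i : Fin (n + 1), p i.succ * p i.succ with ha
  set b := ∑ i : Fin (n + 1), v i.succ * v i.succ with hb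
  have hcs : (∑ i : Fin (n + 1), p i.succ * v i.succ) ^ 2 ≤ a * b := by
    have := Finset.sum_mul_sq_le_sq_mul_sq Finset.univ (fun i : Fin (n + 1) => p i.succ)
      (fun i => v i.succ)
    simpa only [pow_two] using this
  have hb0 : 0 ≤ b := Finset.sum_nonneg fun i _ => mul_self_nonneg _
  have ha0 : 0 ≤ a := Finset.sum_nonneg fun i _ => mul_self_nonneg _
  have h1 : (p 0 * v 0) ^ 2 ≤ a * b := by
    have : p 0 * v 0 = ∑ i : Fin (n + 1), p i.succ * v i.succ := by linarith
    rwa [this]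
  have hp0 : p 0 * p 0 = 1 + a := by linarith
  rcases hb0.eq_or_lt with h0 | h0
  · exfalso
    apply hv
    have hz : ∀ i : Fin (n + 1), v i.succ = 0 := fun i => by
      have := (Finset.sum_eq_zero_iff_of_nonneg fun i _ => mul_self_nonneg (v (Fin.succ i))).1
        h0.symm i (Finset.mem_univ _)
      simpa using this
    have hv0 : v 0 = 0 := by
      rw [← h0, mul_zero] at h1
      have h2 : p 0 * v 0 = 0 := pow_eq_zero_iff (two_ne_zero) |>.1 (le_antisymm h1 (sq_nonneg _))
      rcases mul_eq_zero.1 h2 with h3 | h3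
      · rw [h3] at hp0; linarith
      · exact h3
    ext i
    refine Fin.cases ?_ (fun i => ?_) i
    · simpa using hv0
    · simpa using hz i
  · have h2 : (1 + a) * (v 0 * v 0) ≤ a * b := by
      calc (1 + a) * (v 0 * v 0) = (p 0 * v 0) ^ 2 := by rw [← hp0]; ring
        _ ≤ _ := h1
    by_contra hcon
    nlinarith

/-! ### From the manifold to germs in a chart -/

section chart

variable {n : ℕ} {M : Type*} [TopologicalSpace M] [ChartedSpace (EuclideanSpace ℝ (Fin n)) M]

/-- The coordinate basis of the model space. -/
def basisVec (n : ℕ) (i : Fin n) : Coord n := EuclideanSpace.single i 1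

theorem sum_smul_basisVec (v : Coord n) : ∑ k, v k • basisVec n k = v := by
  ext j
  simp [basisVec, Pi.single_apply]

/-- The differential as a linear map of coordinates. -/
def diffL (Y : M → Mink n) (x : M) : Coord n →L[ℝ] Mink n := mfderiv (𝓡 n) 𝓘(ℝ, Mink n) Y x

theorem diffL_sum_coordVec (Y : M → Mink n) (x : M) (v : Coord n) :
    diffL Y x v = ∑ k, v k • diff Y x (coordVec x k) := by
  conv_lhs => rw [← sum_smul_basisVec v]
  rw [map_sum]
  simp only [map_smul]
  rfl

/-- `Y` in the chart around `x₀`. -/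
def inChart (x₀ : M) (Y : M → Mink n) (u : Coord n) : Mink n := Y ((extChartAt (𝓡 n) x₀).symm u)

variable [IsManifold (𝓡 n) ∞ M]

/-- A single `D`, the differential of the inverse chart, serves all maps `Y`. Hence the first and
second forms transform by the same matrix. -/
theorem exists_fderiv_inChart (x₀ : M) {u : Coord n} (hu : u ∈ (extChartAt (𝓡 n) x₀).target) :
    ∃ D : Coord n ≃L[ℝ] Coord n, ∀ Y : M → Mink n, ContMDiff (𝓡 n) 𝓘(ℝ, Mink n) ∞ Y →
      ∀ v, dird v (inChart x₀ Y) u = diffL Y ((extChartAt (𝓡 n) x₀).symm u) (D v) := by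
  have : IsManifold (𝓡 n) 1 M := IsManifold.of_le (n := ∞) (by simp)
  obtain ⟨D, hD⟩ := isInvertible_mfderivWithin_extChartAt_symm (I := 𝓡 n) hu
  refine ⟨D, fun Y hY v => ?_⟩
  have h1 : MDifferentiableAt (𝓡 n) 𝓘(ℝ, Mink n) Y ((extChartAt (𝓡 n) x₀).symm u) :=
    (hY _).mdifferentiableAt (by simp)
  have h2 := mdifferentiableWithinAt_extChartAt_symm (I := 𝓡 n) hu
  rw [ModelWithCorners.Boundaryless.range_eq_univ, mdifferentiableWithinAt_univ] at h2
  rw [ModelWithCorners.Boundaryless.range_eq_univ, mfderivWithin_univ] at hD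
  have h3 := mfderiv_comp u h1 h2
  rw [dird, ← mfderiv_eq_fderiv]
  refine (congrArg (fun L : Coord n →L[ℝ] Mink n => L v) h3).trans ?_
  exact congrArg (fun L : Coord n →L[ℝ] Coord n => diffL Y _ (L v)) hD.symm

theorem contDiffAt_inChart {Y : M → Mink n} (hY : ContMDiff (𝓡 n) 𝓘(ℝ, Mink n) ∞ Y) (x₀ : M)
    {u : Coord n} (hu : u ∈ (extChartAt (𝓡 n) x₀).target) :
    ContDiffAt ℝ ∞ (inChart x₀ Y) u := by
  have h := hY.comp_contMDiffOn (contMDiffOn_extChartAt_symm (I := 𝓡 n) (n := ∞) x₀)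
  exact (contMDiffOn_iff_contDiffOn.1 h).contDiffAt ((isOpen_extChartAt_target x₀).mem_nhds hu)

/-- The matrix of a linear map of coordinates. -/
def coordMatrix (D : Coord n ≃L[ℝ] Coord n) : Matrix (Fin n) (Fin n) ℝ :=
  Matrix.of fun k i => D (basisVec n i) k

theorem isUnit_det_coordMatrix (D : Coord n ≃L[ℝ] Coord n) : IsUnit (coordMatrix D).det := by
  have h : coordMatrix D.symm * coordMatrix D = 1 := by
    ext i j
    have h1 := congrArg D.symm (sum_smul_basisVec (D (basisVec n j)))
    simp only [map_sum, map_smul, ContinuousLinearEquiv.symm_apply_apply] at h1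
    have h2 := congrArg (fun v : Coord n => v i) h1
    simp only [Matrix.mul_apply, coordMatrix, Matrix.of_apply]
    have h3 : (∑ k, D (basisVec n j) k • D.symm (basisVec n k)) i
        = ∑ k, D (basisVec n j) k * D.symm (basisVec n k) i := by simp
    rw [h3] at h2
    rw [Matrix.one_apply]
    refine Eq.trans ?_ (h2.trans ?_)
    · exact Finset.sum_congr rfl fun k _ => mul_comm _ _
    · simp [basisVec]
  have h2 := congrArg Matrix.det h
  rw [Matrix.det_mul, Matrix.det_one] at h2
  exact IsUnit.of_mul_eq_one_right _ h2

variable {X ν : M → Mink n}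

theorem IsHypImmersion.hypGerm (hX : IsHypImmersion X) (hν : IsUnitNormal X ν)
    (hs : ContMDiff (𝓡 n) 𝓘(ℝ, Mink n) ∞ ν) (x₀ : M) {u : Coord n}
    (hu : u ∈ (extChartAt (𝓡 n) x₀).target) :
    HypGerm (inChart x₀ X) (inChart x₀ ν) (basisVec n) u where
  smooth := contDiffAt_inChart hX.smooth x₀ hu
  smooth_normal := contDiffAt_inChart hs x₀ hu
  norm := Filter.Eventually.of_forall fun y => (hX.mem_hyp _).1
  norm_normal := Filter.Eventually.of_forall fun y => (hν _).2.2
  normal := Filter.Eventually.of_forall fun y => (hν _).1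
  normal_dird := fun i => by
    filter_upwards [(isOpen_extChartAt_target x₀).mem_nhds hu] with y hy
    obtain ⟨D, hD⟩ := exists_fderiv_inChart x₀ hy
    rw [hD X hX.smooth]
    exact (hν _).2.1 _

theorem IsHypImmersion.lor_diff (hX : IsHypImmersion X) (x : M) (v : TangentSpace (𝓡 n) x) :
    lor (X x) (diff X x v) = 0 := by
  have hu := mem_extChartAt_target (I := 𝓡 n) x
  obtain ⟨D, hD⟩ := exists_fderiv_inChart x hu
  have h0 : D (D.symm v) = v := D.apply_symm_apply v
  have h1 := hD X hX.smooth (D.symm v)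
  rw [h0] at h1
  have hc := contDiffAt_inChart hX.smooth x hu
  have h2 := (dird_const_of_eventuallyEq (f := fun u => lor (inChart x X u) (inChart x X u)) (c := -1)
    (z := extChartAt (𝓡 n) x x) (Filter.Eventually.of_forall fun y => (hX.mem_hyp _).1) (D.symm v)).eq_of_nhds
  rw [(dird_lor hc hc _).eq_of_nhds, lor_comm, h1, inChart] at h2
  have h3 : (extChartAt (𝓡 n) x).symm (extChartAt (𝓡 n) x x) = x := extChartAt_to_inv x
  rw [h3] at h2
  have h4 : lor (X x) (diffL X x v) = 0 := by linarith
  exact h4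

theorem secondForm_apply (hX : IsHypImmersion X) (x : M) (i j : Fin n) :
    secondForm X ν x i j = lor (diff ν x (coordVec x i)) (diff X x (coordVec x j)) := by
  simp [secondForm, covDeriv, lor_add_left, lor_smul_left, hX.lor_diff]

theorem inChart_forms (hX : IsHypImmersion X) (hs : ContMDiff (𝓡 n) 𝓘(ℝ, Mink n) ∞ ν)
    (x₀ : M) {u : Coord n} (hu : u ∈ (extChartAt (𝓡 n) x₀).target) :
    ∃ J : Matrix (Fin n) (Fin n) ℝ, IsUnit J.det ∧
      fstMat (inChart x₀ X) (basisVec n) u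
        = J.transpose * firstForm X ((extChartAt (𝓡 n) x₀).symm u) * J ∧
      sndMat (inChart x₀ X) (inChart x₀ ν) (basisVec n) u
        = J.transpose * secondForm X ν ((extChartAt (𝓡 n) x₀).symm u) * J := by
  obtain ⟨D, hD⟩ := exists_fderiv_inChart x₀ hu
  set x := (extChartAt (𝓡 n) x₀).symm u
  have hb : ∀ (Y Z : M → Mink n) (v w : Coord n), lor (diffL Y x v) (diffL Z x w)
      = bilin (fun i j => lor (diff Y x (coordVec x i)) (diff Z x (coordVec x j))) v w := by
    intro Y Z v w
    rw [diffL_sum_coordVec Y x v, diffL_sum_coordVec Z x w]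
    simp only [lor_sum_left, lor_sum_right, lor_smul_left, lor_smul_right, bilin, Finset.mul_sum]
    rw [Finset.sum_comm]
    exact Finset.sum_congr rfl fun i _ => Finset.sum_congr rfl fun j _ => by ring
  refine ⟨coordMatrix D, isUnit_det_coordMatrix D, ?_, ?_⟩
  · ext i j
    rw [← bilin_columns]
    simp only [fstMat, fstCoeff, Matrix.of_apply, hD X hX.smooth]
    exact hb X X _ _
  · ext i j
    rw [← bilin_columns]
    simp only [sndMat, sndCoeff, Matrix.of_apply, hD X hX.smooth, hD ν hs, secondForm_apply hX]
    exact hb ν X _ _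

theorem princCurv_eq_genEig_inChart (hX : IsHypImmersion X)
    (hs : ContMDiff (𝓡 n) 𝓘(ℝ, Mink n) ∞ ν) (x₀ : M) {u : Coord n}
    (hu : u ∈ (extChartAt (𝓡 n) x₀).target) :
    princCurv X ν ((extChartAt (𝓡 n) x₀).symm u)
      = genEig (fstMat (inChart x₀ X) (basisVec n) u)
        (sndMat (inChart x₀ X) (inChart x₀ ν) (basisVec n) u) := by
  obtain ⟨J, hJ, h1, h2⟩ := inChart_forms hX hs x₀ hu
  rw [h1, h2, genEig_transpose_mul_mul _ _ _ hJ]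
  rfl

theorem IsHypImmersion.posDef_fstMat (hX : IsHypImmersion X) (x₀ : M) {u : Coord n}
    (hu : u ∈ (extChartAt (𝓡 n) x₀).target) :
    (fstMat (inChart x₀ X) (basisVec n) u).PosDef := by
  obtain ⟨D, hD⟩ := exists_fderiv_inChart x₀ hu
  refine posDef_iff_quadratic.2 ⟨fstMat_isHermitian _ _ _, fun y hy => ?_⟩
  rw [← bilin_eq_dotProduct]
  have := lor_dird_sum (inChart x₀ X) (inChart x₀ X) (basisVec n) u y y
  refine lt_of_lt_of_eq ?_ this
  rw [hD X hX.smooth]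
  refine lor_self_pos_of_orthogonal (hX.mem_hyp _).1 (hX.lor_diff _ _) fun h0 => hy ?_
  have h1 : D (∑ k, y k • basisVec n k) = 0 := hX.injective_diff _ (h0.trans
      (map_zero (diffL X _)).symm)
  have h2 : ∑ k, y k • basisVec n k = 0 := D.map_eq_zero_iff.1 h1
  ext j
  have h3 := congrArg (fun v : Coord n => v j) h2
  simpa [basisVec, Pi.single_apply] using h3

end chart

/-! ### Smooth families of hypersurfaces -/

section family

variable {n : ℕ} {M : Type*} [TopologicalSpace M] [ChartedSpace (EuclideanSpace ℝ (Fin n)) M]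

/-- A smooth family of immersed hypersurfaces with unit normal. -/
structure IsHypFamily (T : ℝ) (X ν : ℝ → M → Mink n) : Prop where
  smooth : ContMDiffOn (𝓘(ℝ, ℝ).prod (𝓡 n)) 𝓘(ℝ, Mink n) ∞ (fun q : ℝ × M => X q.1 q.2)
    (Ico 0 T ×ˢ univ)
  smooth_normal : ContMDiffOn (𝓘(ℝ, ℝ).prod (𝓡 n)) 𝓘(ℝ, Mink n) ∞
    (fun q : ℝ × M => ν q.1 q.2) (Ico 0 T ×ˢ univ)
  immersion : ∀ t ∈ Ico 0 T, IsHypImmersion (X t)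
  normal : ∀ t ∈ Ico 0 T, IsUnitNormal (X t) (ν t)

theorem IsFlow.isHypFamily {F : (Fin n → ℝ) → ℝ} {X₀ : M → Mink n} {T : ℝ} {X ν : ℝ → M → Mink n}
    (h : IsFlow F X₀ T X ν) : IsHypFamily T X ν :=
  ⟨h.smooth, h.smooth_normal, h.immersion, h.normal⟩

/-- A fixed hypersurface as a constant family: continuity and ordering of the curvatures then need
to be proved for families only. -/
theorem IsHypFamily.const {X ν : M → Mink n} (hX : IsHypImmersion X) (hν : IsUnitNormal X ν)
    (hs : ContMDiff (𝓡 n) 𝓘(ℝ, Mink n) ∞ ν) (T : ℝ) :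
    IsHypFamily T (fun _ => X) (fun _ => ν) :=
  ⟨(hX.smooth.comp contMDiff_snd).contMDiffOn, (hs.comp contMDiff_snd).contMDiffOn,
    fun _ _ => hX, fun _ _ => hν⟩

/-- The family `Y` in the chart around `x₀`. -/
def famInChart (x₀ : M) (Y : ℝ → M → Mink n) (q : ℝ × Coord n) : Mink n := inChart x₀ (Y q.1) q.2

theorem contMDiff_slice {T : ℝ} {Y : ℝ → M → Mink n}
    (hY : ContMDiffOn (𝓘(ℝ, ℝ).prod (𝓡 n)) 𝓘(ℝ, Mink n) ∞ (fun q : ℝ × M => Y q.1 q.2)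
      (Ico 0 T ×ˢ univ)) {t : ℝ} (ht : t ∈ Ico 0 T) : ContMDiff (𝓡 n) 𝓘(ℝ, Mink n) ∞ (Y t) := by
  have h1 : ContMDiff (𝓡 n) (𝓘(ℝ, ℝ).prod (𝓡 n)) ∞ (fun x : M => (t, x)) :=
    contMDiff_const.prodMk contMDiff_id
  rw [← contMDiffOn_univ] at h1 ⊢
  exact hY.comp h1 fun x _ => ⟨ht, mem_univ _⟩

theorem prod_target_mem_nhds {T : ℝ} {z : ℝ × Coord n} {x₀ : M} (hz : z.1 ∈ Ioo 0 T)
    (hu : z.2 ∈ (extChartAt (𝓡 n) x₀).target) :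
    Ioo 0 T ×ˢ (extChartAt (𝓡 n) x₀).target ∈ 𝓝 z := by
  have : IsOpen (Ioo 0 T ×ˢ (extChartAt (𝓡 n) x₀).target) :=
    isOpen_Ioo.prod (isOpen_extChartAt_target x₀)
  exact this.mem_nhds ⟨hz, hu⟩

variable [IsManifold (𝓡 n) ∞ M]

theorem contDiffOn_famInChart {T : ℝ} {Y : ℝ → M → Mink n}
    (hY : ContMDiffOn (𝓘(ℝ, ℝ).prod (𝓡 n)) 𝓘(ℝ, Mink n) ∞ (fun q : ℝ × M => Y q.1 q.2)
      (Ico 0 T ×ˢ univ)) (x₀ : M) :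
    ContDiffOn ℝ ∞ (famInChart x₀ Y) (Ico 0 T ×ˢ (extChartAt (𝓡 n) x₀).target) := by
  rw [← contMDiffOn_iff_contDiffOn]
  have h1 : ContMDiffOn 𝓘(ℝ, ℝ × Coord n) 𝓘(ℝ, ℝ) ∞ (Prod.fst : ℝ × Coord n → ℝ)
      (Ico 0 T ×ˢ (extChartAt (𝓡 n) x₀).target) := contDiff_fst.contMDiff.contMDiffOn
  have h2 : ContMDiffOn 𝓘(ℝ, ℝ × Coord n) 𝓘(ℝ, Coord n) ∞ (Prod.snd : ℝ × Coord n → Coord n)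
      (Ico 0 T ×ˢ (extChartAt (𝓡 n) x₀).target) := contDiff_snd.contMDiff.contMDiffOn
  have h3 := (contMDiffOn_extChartAt_symm (I := 𝓡 n) (n := ∞) x₀).comp h2 fun q hq => hq.2
  exact hY.comp (h1.prodMk h3) fun q hq => ⟨hq.1, mem_univ _⟩

theorem hasFDerivAt_slice (t : ℝ) (u : Coord n) :
    HasFDerivAt (fun u : Coord n => (t, u)) (ContinuousLinearMap.inr ℝ ℝ (Coord n)) u :=
  hasFDerivAt_prodMk_right t u

/-- At time 0 the family is smooth only from one side. Expressing the slice derivative through the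
derivative within the half-open domain gives joint continuity up to the initial time. -/
theorem dird_inChart_eq {T : ℝ} {Y : ℝ → M → Mink n}
    (hY : ContMDiffOn (𝓘(ℝ, ℝ).prod (𝓡 n)) 𝓘(ℝ, Mink n) ∞ (fun q : ℝ × M => Y q.1 q.2)
      (Ico 0 T ×ˢ univ)) (x₀ : M) {q : ℝ × Coord n}
    (hq : q ∈ Ico 0 T ×ˢ (extChartAt (𝓡 n) x₀).target) (v : Coord n) :
    dird v (inChart x₀ (Y q.1)) q.2 = fderivWithin ℝ (famInChart x₀ Y)
      (Ico 0 T ×ˢ (extChartAt (𝓡 n) x₀).target) q (0, v) := by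
  have h1 := ((contDiffOn_famInChart hY x₀).differentiableOn (by simp) q hq).hasFDerivWithinAt
  have h2 : HasFDerivWithinAt (fun u : Coord n => (q.1, u)) (ContinuousLinearMap.inr ℝ ℝ (Coord n))
      (extChartAt (𝓡 n) x₀).target q.2 := (hasFDerivAt_slice q.1 q.2).hasFDerivWithinAt
  have h3 := (HasFDerivWithinAt.comp q.2 (g := famInChart x₀ Y) h1 h2
    (t := Ico 0 T ×ˢ (extChartAt (𝓡 n) x₀).target) (fun u hu => ⟨hq.1, hu⟩)).hasFDerivAt ((isOpen_extChartAt_target x₀).mem_nhds hq.2)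
  exact congrArg (fun L => L v) h3.fderiv

theorem continuousOn_dird_inChart {T : ℝ} {Y : ℝ → M → Mink n}
    (hY : ContMDiffOn (𝓘(ℝ, ℝ).prod (𝓡 n)) 𝓘(ℝ, Mink n) ∞ (fun q : ℝ × M => Y q.1 q.2)
      (Ico 0 T ×ˢ univ)) (x₀ : M) (v : Coord n) :
    ContinuousOn (fun q : ℝ × Coord n => dird v (inChart x₀ (Y q.1)) q.2)
      (Ico 0 T ×ˢ (extChartAt (𝓡 n) x₀).target) := by
  have hu : UniqueDiffOn ℝ (Ico 0 T ×ˢ (extChartAt (𝓡 n) x₀).target) :=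
    (uniqueDiffOn_Ico 0 T).prod (isOpen_extChartAt_target x₀).uniqueDiffOn
  have h := ((contDiffOn_famInChart hY x₀).continuousOn_fderivWithin hu (by simp)).clm_apply
    (continuousOn_const (c := ((0 : ℝ), v)))
  exact h.congr fun q hq => dird_inChart_eq hY x₀ hq v

variable {T : ℝ} {X ν : ℝ → M → Mink n}

theorem contDiffAt_famInChart {Y : ℝ → M → Mink n}
    (hY : ContMDiffOn (𝓘(ℝ, ℝ).prod (𝓡 n)) 𝓘(ℝ, Mink n) ∞ (fun q : ℝ × M => Y q.1 q.2)
      (Ico 0 T ×ˢ univ)) (x₀ : M) {z : ℝ × Coord n} (hz : z.1 ∈ Ioo 0 T)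
    (hu : z.2 ∈ (extChartAt (𝓡 n) x₀).target) : ContDiffAt ℝ ∞ (famInChart x₀ Y) z :=
  (contDiffOn_famInChart hY x₀).contDiffAt (Filter.mem_of_superset (prod_target_mem_nhds hz hu)
    (prod_mono Ioo_subset_Ico_self subset_rfl))

theorem dird_famInChart {Y : ℝ → M → Mink n}
    (hY : ContMDiffOn (𝓘(ℝ, ℝ).prod (𝓡 n)) 𝓘(ℝ, Mink n) ∞ (fun q : ℝ × M => Y q.1 q.2)
      (Ico 0 T ×ˢ univ)) (x₀ : M) {z : ℝ × Coord n} (hz : z.1 ∈ Ioo 0 T)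
    (hu : z.2 ∈ (extChartAt (𝓡 n) x₀).target) (i : Fin n) :
    dird (spaceVec n i) (famInChart x₀ Y) z = dird (basisVec n i) (inChart x₀ (Y z.1)) z.2 := by
  rw [dird_inChart_eq hY x₀ ⟨Ioo_subset_Ico_self hz, hu⟩, fderivWithin_of_mem_nhds
    (Filter.mem_of_superset (prod_target_mem_nhds hz hu) (prod_mono Ioo_subset_Ico_self subset_rfl))]
  rfl

namespace IsHypFamily

variable (h : IsHypFamily T X ν)
include h

theorem hypGerm_slice {t : ℝ} (ht : t ∈ Ico 0 T) (x₀ : M) {u : Coord n}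
    (hu : u ∈ (extChartAt (𝓡 n) x₀).target) :
    HypGerm (inChart x₀ (X t)) (inChart x₀ (ν t)) (basisVec n) u :=
  (h.immersion t ht).hypGerm (h.normal t ht) (contMDiff_slice h.smooth_normal ht) x₀ hu

theorem continuousOn_princCurv (i : Fin n) :
    ContinuousOn (fun q : ℝ × M => princCurv (X q.1) (ν q.1) q.2 i) (Ico 0 T ×ˢ univ) := by
  rintro ⟨t₀, x₀⟩ ⟨ht₀, -⟩
  set φ := extChartAt (𝓡 n) x₀ with hφ
  have hx₀ : x₀ ∈ φ.source := mem_extChartAt_source x₀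
  have hev : ∀ᶠ q : ℝ × M in 𝓝[Ico 0 T ×ˢ univ] (t₀, x₀), q.1 ∈ Ico 0 T ∧ q.2 ∈ φ.source := by
    have h3 : ∀ᶠ q : ℝ × M in 𝓝 (t₀, x₀), q.2 ∈ φ.source :=
      continuousAt_snd.preimage_mem_nhds (extChartAt_source_mem_nhds (I := 𝓡 n) x₀)
    filter_upwards [self_mem_nhdsWithin, h3.filter_mono nhdsWithin_le_nhds] with q h1 h2
      using ⟨h1.1, h2⟩
  have hmap : Filter.Tendsto (fun q : ℝ × M => (q.1, φ q.2)) (𝓝[Ico 0 T ×ˢ univ] (t₀, x₀))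
      (𝓝[Ico 0 T ×ˢ φ.target] (t₀, φ x₀)) := by
    refine tendsto_nhdsWithin_iff.2 ⟨?_, ?_⟩
    · have h1 : ContinuousAt φ x₀ := continuousAt_extChartAt x₀
      have h2 : ContinuousAt (fun q : ℝ × M => (q.1, φ q.2)) (t₀, x₀) :=
        continuousAt_fst.prodMk (ContinuousAt.comp (f := Prod.snd) (x := (t₀, x₀)) h1 continuousAt_snd)
      exact h2.tendsto.mono_left nhdsWithin_le_nhds
    · filter_upwards [hev] with q h1 using ⟨h1.1, φ.map_source h1.2⟩
  have hpc : ∀ t ∈ Ico 0 T, ∀ x ∈ φ.source, princCurv (X t) (ν t) x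
      = genEig (fstMat (inChart x₀ (X t)) (basisVec n) (φ x))
        (sndMat (inChart x₀ (X t)) (inChart x₀ (ν t)) (basisVec n) (φ x)) := fun t ht x hx => by
    have := princCurv_eq_genEig_inChart (h.immersion t ht) (contMDiff_slice h.smooth_normal ht) x₀
      (φ.map_source hx)
    rwa [φ.left_inv hx] at this
  have hd : ∀ {Y : ℝ → M → Mink n}, ContMDiffOn (𝓘(ℝ, ℝ).prod (𝓡 n)) 𝓘(ℝ, Mink n) ∞
      (fun q : ℝ × M => Y q.1 q.2) (Ico 0 T ×ˢ univ) → ∀ v,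
      Filter.Tendsto (fun q : ℝ × M => dird v (inChart x₀ (Y q.1)) (φ q.2))
        (𝓝[Ico 0 T ×ˢ univ] (t₀, x₀)) (𝓝 (dird v (inChart x₀ (Y t₀)) (φ x₀))) := fun hY v =>
    Filter.Tendsto.comp (continuousOn_dird_inChart hY x₀ v (t₀, φ x₀)
      ⟨ht₀, φ.map_source hx₀⟩) hmap
  have hlor : ∀ {A B : ℝ × M → Mink n} {a b : Mink n},
      Filter.Tendsto A (𝓝[Ico 0 T ×ˢ univ] (t₀, x₀)) (𝓝 a) →
      Filter.Tendsto B (𝓝[Ico 0 T ×ˢ univ] (t₀, x₀)) (𝓝 b) →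
      Filter.Tendsto (fun q => lor (A q) (B q)) (𝓝[Ico 0 T ×ˢ univ] (t₀, x₀)) (𝓝 (lor a b)) :=
    fun hA hB => ((lorL n).continuous₂.tendsto _).comp (hA.prodMk_nhds hB)
  have hw : Filter.Tendsto (fun q : ℝ × M => princCurv (X q.1) (ν q.1) q.2 i)
      (𝓝[Ico 0 T ×ˢ univ] (t₀, x₀)) (𝓝 (princCurv (X t₀) (ν t₀) x₀ i)) := by
    rw [hpc t₀ ht₀ x₀ hx₀]
    refine Filter.Tendsto.congr' (f₁ := fun q : ℝ × M =>
      genEig (fstMat (inChart x₀ (X q.1)) (basisVec n) (φ q.2))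
        (sndMat (inChart x₀ (X q.1)) (inChart x₀ (ν q.1)) (basisVec n) (φ q.2)) i) ?_ ?_
    · filter_upwards [hev] with q hq
      rw [hpc q.1 hq.1 q.2 hq.2]
    · refine tendsto_genEig ?_ ?_ ((h.immersion t₀ ht₀).posDef_fstMat x₀ (φ.map_source hx₀))
        (h.hypGerm_slice ht₀ x₀ (φ.map_source hx₀)).sndMat_isHermitian.self_of_nhds
        (Filter.Eventually.of_forall fun q => fstMat_isHermitian _ _ _) ?_ i
      · exact tendsto_pi_nhds.2 fun a => tendsto_pi_nhds.2 fun b =>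
          hlor (hd h.smooth _) (hd h.smooth _)
      · exact tendsto_pi_nhds.2 fun a => tendsto_pi_nhds.2 fun b =>
          hlor (hd h.smooth_normal _) (hd h.smooth _)
      · filter_upwards [hev] with q hq
        exact (h.hypGerm_slice hq.1 x₀ (φ.map_source hq.2)).sndMat_isHermitian.self_of_nhds
  exact hw

theorem fstMat_famInChart (x₀ : M) {z : ℝ × Coord n} (hz : z.1 ∈ Ioo 0 T)
    (hu : z.2 ∈ (extChartAt (𝓡 n) x₀).target) :
    fstMat (famInChart x₀ X) (spaceVec n) z = fstMat (inChart x₀ (X z.1)) (basisVec n) z.2 := by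
  ext i j
  simp only [fstMat, Matrix.of_apply, fstCoeff, dird_famInChart h.smooth x₀ hz hu]

theorem sndMat_famInChart (x₀ : M) {z : ℝ × Coord n} (hz : z.1 ∈ Ioo 0 T)
    (hu : z.2 ∈ (extChartAt (𝓡 n) x₀).target) :
    sndMat (famInChart x₀ X) (famInChart x₀ ν) (spaceVec n) z
      = sndMat (inChart x₀ (X z.1)) (inChart x₀ (ν z.1)) (basisVec n) z.2 := by
  ext i j
  simp only [sndMat, Matrix.of_apply, sndCoeff, dird_famInChart h.smooth x₀ hz hu,
    dird_famInChart h.smooth_normal x₀ hz hu]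

theorem hypGerm (x₀ : M) {z : ℝ × Coord n} (hz : z.1 ∈ Ioo 0 T)
    (hu : z.2 ∈ (extChartAt (𝓡 n) x₀).target) :
    HypGerm (famInChart x₀ X) (famInChart x₀ ν) (spaceVec n) z where
  smooth := contDiffAt_famInChart h.smooth x₀ hz hu
  smooth_normal := contDiffAt_famInChart h.smooth_normal x₀ hz hu
  norm := by
    filter_upwards [prod_target_mem_nhds hz hu] with y hy
    exact ((h.immersion y.1 (Ioo_subset_Ico_self hy.1)).mem_hyp _).1
  norm_normal := by
    filter_upwards [prod_target_mem_nhds hz hu] with y hy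
    exact (h.normal y.1 (Ioo_subset_Ico_self hy.1) _).2.2
  normal := by
    filter_upwards [prod_target_mem_nhds hz hu] with y hy
    exact (h.normal y.1 (Ioo_subset_Ico_self hy.1) _).1
  normal_dird := fun i => by
    filter_upwards [prod_target_mem_nhds hz hu] with y hy
    rw [dird_famInChart h.smooth x₀ hy.1 hy.2]
    exact ((h.hypGerm_slice (Ioo_subset_Ico_self hy.1) x₀ hy.2).normal_dird i).self_of_nhds

theorem princCurv_famInChart (x₀ : M) {z : ℝ × Coord n} (hz : z.1 ∈ Ioo 0 T)
    (hu : z.2 ∈ (extChartAt (𝓡 n) x₀).target) :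
    princCurv (X z.1) (ν z.1) ((extChartAt (𝓡 n) x₀).symm z.2)
      = genEig (fstMat (famInChart x₀ X) (spaceVec n) z)
        (sndMat (famInChart x₀ X) (famInChart x₀ ν) (spaceVec n) z) := by
  have ht := Ioo_subset_Ico_self hz
  rw [h.fstMat_famInChart x₀ hz hu, h.sndMat_famInChart x₀ hz hu,
    princCurv_eq_genEig_inChart (h.immersion _ ht) (contMDiff_slice h.smooth_normal ht) x₀ hu]

theorem monotone_princCurv {t : ℝ} (ht : t ∈ Ico 0 T) (x : M) :
    Monotone (princCurv (X t) (ν t) x) := by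
  have hu := mem_extChartAt_target (I := 𝓡 n) x
  have h1 := princCurv_eq_genEig_inChart (h.immersion t ht) (contMDiff_slice h.smooth_normal ht) x hu
  rw [extChartAt_to_inv] at h1
  rw [h1]
  exact genEig_monotone ((h.immersion t ht).posDef_fstMat x hu)
    (h.hypGerm_slice ht x hu).sndMat_isHermitian.self_of_nhds

end IsHypFamily

theorem IsFlow.dird_time {F : (Fin n → ℝ) → ℝ} {X₀ : M → Mink n} (h : IsFlow F X₀ T X ν) (x₀ : M)
    {z : ℝ × Coord n} (hz : z.1 ∈ Ioo 0 T) (hu : z.2 ∈ (extChartAt (𝓡 n) x₀).target) :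
    dird (timeVec n) (famInChart x₀ X) z
      = -(F (princCurv (X z.1) (ν z.1) ((extChartAt (𝓡 n) x₀).symm z.2)) • famInChart x₀ ν z) := by
  have h1 := (contDiffAt_famInChart h.smooth x₀ hz hu).differentiableAt (by simp)
  have h2 : HasDerivAt (fun s : ℝ => (s, z.2)) (timeVec n) z.1 :=
    (hasDerivAt_id z.1).prodMk (hasDerivAt_const z.1 z.2)
  have h3 := HasFDerivAt.comp_hasDerivAt (l := famInChart x₀ X) z.1 h1.hasFDerivAt h2
  have h4 := (h.evolution z.1 (Ioo_subset_Ico_self hz) ((extChartAt (𝓡 n) x₀).symm z.2)).hasDerivAt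
    (Ico_mem_nhds hz.1 hz.2)
  exact h3.unique h4

/-- The touching point is read in its own chart. Positivity of `t` gives a full space-time
neighbourhood there. -/
theorem IsFlow.false_of_first_touching {m : ℕ} {M : Type*} [TopologicalSpace M]
    [ChartedSpace (EuclideanSpace ℝ (Fin (m + 3))) M] [IsManifold (𝓡 (m + 3)) ∞ M]
    {T : ℝ} {X ν : ℝ → M → Mink (m + 3)} {F : (Fin (m + 3) → ℝ) → ℝ} {X₀ : M → Mink (m + 3)}
    (h : IsFlow F X₀ T X ν) (hF : IsSpeed F) {t : ℝ} (ht : t ∈ Ioo 0 T) (x : M)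
    (hpos : princCurv (X t) (ν t) x ∈ posCone (m + 3)) {c : ℝ} (hc : 0 < c)
    (hzero : c * F (princCurv (X t) (ν t) x) ^ 2
      = princCurv (X t) (ν t) x 0 * princCurv (X t) (ν t) x 1 - 1)
    (hpin : ∀ s ∈ Ioc 0 t, ∀ y, c * F (princCurv (X s) (ν s) y) ^ 2
      ≤ princCurv (X s) (ν s) y 0 * princCurv (X s) (ν s) y 1 - 1) : False := by
  set φ := extChartAt (𝓡 (m + 3)) x
  have hu : φ x ∈ φ.target := mem_extChartAt_target x
  have hx : φ.symm (φ x) = x := extChartAt_to_inv x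
  have hfam := h.isHypFamily
  have hκ : ∀ z : ℝ × Coord (m + 3), z ∈ Ioo 0 T ×ˢ φ.target →
      genEig (fstMat (famInChart x X) (spaceVec (m + 3)) z)
        (sndMat (famInChart x X) (famInChart x ν) (spaceVec (m + 3)) z)
        = princCurv (X z.1) (ν z.1) (φ.symm z.2) := fun z hz =>
    (hfam.princCurv_famInChart x hz.1 hz.2).symm
  have hz : (t, φ x) ∈ Ioo 0 T ×ˢ φ.target := ⟨ht, hu⟩
  have hnhds : Ioo 0 T ×ˢ φ.target ∈ 𝓝 (t, φ x) := prod_target_mem_nhds (z := (t, φ x)) ht hu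
  have hκt := hκ _ hz
  simp only [hx] at hκt
  refine (hfam.hypGerm x (z := (t, φ x)) ht hu).false_of_first_touching ?_ hF rfl ?_ ?_ hc ?_ ?_
  · rw [hfam.fstMat_famInChart x (z := (t, φ x)) ht hu]
    exact (h.immersion t (Ioo_subset_Ico_self ht)).posDef_fstMat x hu
  · filter_upwards [hnhds] with y hy
    rw [hκ y hy]
    exact h.dird_time x hy.1 hy.2
  · rw [hκt]; exact hpos
  · simp only [hκt]; exact hzero
  · filter_upwards [hnhds] with y hy hle
    simp only [hκ y hy]
    exact hpin y.1 ⟨hy.1.1, hle⟩ _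

end family

/-! ### The Gauss equation -/

section gauss

variable {E : Type*} [NormedAddCommGroup E] [NormedSpace ℝ E] {n : ℕ}

theorem contDiffAt_det {ι : Type*} [Fintype ι] [DecidableEq ι] {A : E → Matrix ι ι ℝ} {z : E}
    (hA : ∀ i j, ContDiffAt ℝ ∞ (fun y => A y i j) z) : ContDiffAt ℝ ∞ (fun y => (A y).det) z := by
  simp only [Matrix.det_apply]
  refine ContDiffAt.sum fun σ _ => ?_
  exact (contDiffAt_prod fun i _ => hA _ _).const_smul _

theorem contDiffAt_inv_apply {ι : Type*} [Fintype ι] [DecidableEq ι] {A : E → Matrix ι ι ℝ} {z : E}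
    (hA : ∀ i j, ContDiffAt ℝ ∞ (fun y => A y i j) z) (hz : (A z).det ≠ 0) (i j : ι) :
    ContDiffAt ℝ ∞ (fun y => (A y)⁻¹ i j) z := by
  have h1 : ContDiffAt ℝ ∞ (fun y => (A y).adjugate i j) z := by
    simp only [Matrix.adjugate_apply]
    refine contDiffAt_det fun a b => ?_
    by_cases h : a = j
    · subst h
      simp only [Matrix.updateRow_self]
      exact contDiffAt_const
    · simp only [Matrix.updateRow_ne h]
      exact hA a b
  have h2 : ContDiffAt ℝ ∞ (fun y => ((A y).det)⁻¹ * (A y).adjugate i j) z :=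
    ((contDiffAt_det hA).inv hz).mul h1
  refine h2.congr_of_eventuallyEq (Filter.Eventually.of_forall fun y => ?_)
  simp only [Matrix.inv_def, Matrix.smul_apply, Ring.inverse_eq_inv', smul_eq_mul]

/-- The Christoffel symbols of the metric induced by the germ `W`, computed from its second
derivatives. -/
def germGamma (W : E → Mink n) (e : Fin n → E) (k i j : Fin n) (y : E) : ℝ :=
  ∑ l, (fstMat W e y)⁻¹ k l * lor (dird (e i) (dird (e j) W) y) (dird (e l) W y)

namespace HypGerm

variable {W V : E → Mink n} {e : Fin n → E} {z : E} (h : HypGerm W V e z)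
  (hp : (fstMat W e z).PosDef)
include h

theorem sndCoeff_eq (i j : Fin n) :
    ∀ᶠ y in 𝓝 z, sndCoeff W V e i j y = -lor (V y) (dird (e i) (dird (e j) W) y) :=
  h.lor_dird_normal_dird (e i) j

include hp

theorem contDiffAt_germGamma (k i j : Fin n) : ContDiffAt ℝ ∞ (germGamma W e k i j) z := by
  refine ContDiffAt.sum fun l _ => ContDiffAt.mul ?_ ?_
  · exact contDiffAt_inv_apply (fun a b => h.fst_contDiffAt a b) hp.det_pos.ne' k l
  · exact contDiffAt_lor (dird_contDiffAt (dird_contDiffAt h.smooth _) _)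
      (dird_contDiffAt h.smooth _)

theorem sum_germGamma_mul (i j p : Fin n) : ∀ᶠ y in 𝓝 z,
    ∑ m, germGamma W e m i j y * fstCoeff W e m p y
      = lor (dird (e i) (dird (e j) W) y) (dird (e p) W y) := by
  filter_upwards [h.posDef hp] with y hy
  have hu : IsUnit (fstMat W e y).det := hy.det_pos.ne'.isUnit
  set b : Fin n → ℝ := fun l => lor (dird (e i) (dird (e j) W) y) (dird (e l) W y) with hb
  have h1 : Matrix.vecMul (Matrix.mulVec (fstMat W e y)⁻¹ b) (fstMat W e y) = b := by
    have hs : (fstMat W e y).transpose = fstMat W e y := by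
      have := fstMat_isHermitian W e y
      rwa [Matrix.IsHermitian, Matrix.conjTranspose_eq_transpose_of_trivial] at this
    rw [← Matrix.mulVec_transpose, hs, Matrix.mulVec_mulVec, Matrix.mul_nonsing_inv _ hu,
      Matrix.one_mulVec]
  exact congrFun h1 p

/-- The Gauss formula. -/
theorem dird_dird_eq (i j : Fin n) : dird (e i) (dird (e j) W) =ᶠ[𝓝 z] fun y =>
    ∑ m, germGamma W e m i j y • dird (e m) W y + (-(sndCoeff W V e i j y) • V y
      + fstCoeff W e i j y • W y) := by
  have h0 : ∀ᶠ y in 𝓝 z, ∀ m, lor (V y) (dird (e m) W y) = 0 ∧ lor (W y) (dird (e m) W y) = 0 :=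
    Filter.eventually_all.2 fun m => (h.normal_dird m).and (h.lor_dird (e m))
  have h1 := Filter.eventually_all.2 fun p => h.sum_germGamma_mul hp i j p
  filter_upwards [h0, h1, h.sndCoeff_eq i j, h.lor_dird_dird (e i) (e j), h.norm, h.norm_normal,
    h.normal, h.posDef hp] with y h0 h1 h2 h3 h4 h5 h6 h7
  have a1 : ∀ m, lor (dird (e m) W y) (V y) = 0 := fun m => by rw [lor_comm]; exact (h0 m).1
  have a2 : ∀ m, lor (dird (e m) W y) (W y) = 0 := fun m => by rw [lor_comm]; exact (h0 m).2
  refine eq_of_lor_eq h4 h5 h6 (fun m => (h0 m).2) (fun m => (h0 m).1) h7.det_pos.ne'.isUnit ?_ ?_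
    fun p => ?_
  · rw [lor_comm, h3]
    simp [lor_add_left, lor_sum_left, lor_smul_left, lor_neg_left, a2, h4, h6, fstCoeff]
  · rw [lor_comm]
    simp only [lor_add_left, lor_sum_left, lor_smul_left, a1, h5, lor_comm (W y) (V y), h6]
    simp [h2]
  · rw [← h1 p]
    simp [lor_add_left, lor_sum_left, lor_smul_left, lor_neg_left, h0, fstCoeff]

/-- Differentiate the Gauss formula once more and take the tangential part: the normal term
contributes a product of second forms and the position term, which carries the ambient curvature, a
product of first forms. -/
theorem lor_dird_dird_dird (i j k p : Fin n) :
    lor (dird (e i) (dird (e j) (dird (e k) W)) z) (dird (e p) W z)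
      = ∑ m, fstCoeff W e m p z * (dird (e i) (germGamma W e m j k) z
          + ∑ l, germGamma W e m i l z * germGamma W e l j k z)
        - sndCoeff W V e j k z * sndCoeff W V e i p z
        + fstCoeff W e j k z * fstCoeff W e i p z := by
  rw [(dird_congr (h.dird_dird_eq hp j k) (e i)).eq_of_nhds]
  have c1 : ∀ m, ContDiffAt ℝ ∞ (dird (e m) W) z := fun m => dird_contDiffAt h.smooth (e m)
  have c2 := fun m => h.contDiffAt_germGamma hp m j k
  have c3 := h.snd_contDiffAt j k
  have c4 := h.fst_contDiffAt j k
  have d1 : ∀ m, DifferentiableAt ℝ (fun y => germGamma W e m j k y • dird (e m) W y) z := fun m =>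
    ((c2 m).smul (c1 m)).differentiableAt (by simp)
  have d2 : DifferentiableAt ℝ (fun y => -(sndCoeff W V e j k y) • V y) z :=
    (c3.neg.smul h.smooth_normal).differentiableAt (by simp)
  have d3 : DifferentiableAt ℝ (fun y => fstCoeff W e j k y • W y) z :=
    (c4.smul h.smooth).differentiableAt (by simp)
  rw [dird_add_apply (DifferentiableAt.fun_sum fun m _ => d1 m) (d2.fun_add d3),
    dird_sum_apply fun m _ => d1 m, dird_add_apply d2 d3]
  have e1 : ∀ m, dird (e i) (fun y => germGamma W e m j k y • dird (e m) W y) z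
      = dird (e i) (germGamma W e m j k) z • dird (e m) W z
        + germGamma W e m j k z • dird (e i) (dird (e m) W) z := fun m =>
    dird_smul_self (c2 m) (c1 m) (e i)
  have e2 := dird_smul_self c3.neg h.smooth_normal (e i)
  have e3 := dird_smul_self c4 h.smooth (e i)
  rw [e2, e3]
  simp only [e1]
  have f1 := (h.normal_dird p).self_of_nhds
  have f2 := (h.lor_dird (e p)).self_of_nhds
  have f3 : ∀ m, lor (dird (e i) (dird (e m) W) z) (dird (e p) W z)
      = ∑ l, germGamma W e l i m z * fstCoeff W e l p z := fun m =>
    ((h.sum_germGamma_mul hp i m p).self_of_nhds).symm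
  simp only [lor_add_left, lor_sum_left, lor_smul_left, f1, f2, f3, mul_add,
    Finset.sum_add_distrib, Finset.mul_sum]
  rw [Finset.sum_comm (s := Finset.univ) (t := Finset.univ)
    (f := fun m l => germGamma W e m j k z * (germGamma W e l i m z * fstCoeff W e l p z))]
  have g1 : ∑ m, dird (e i) (germGamma W e m j k) z * lor (dird (e m) W z) (dird (e p) W z)
      = ∑ m, fstCoeff W e m p z * dird (e i) (germGamma W e m j k) z :=
    Finset.sum_congr rfl fun m _ => mul_comm _ _
  have g2 : ∑ l, ∑ m, germGamma W e m j k z * (germGamma W e l i m z * fstCoeff W e l p z)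
      = ∑ m, ∑ l, fstCoeff W e m p z * (germGamma W e m i l z * germGamma W e l j k z) :=
    Finset.sum_congr rfl fun m _ => Finset.sum_congr rfl fun l _ => by ring
  rw [g1, g2]
  simp only [sndCoeff, fstCoeff]
  ring

/-- The Gauss equation. -/
theorem gauss (i j k p : Fin n) :
    ∑ l, fstCoeff W e l p z * (dird (e i) (germGamma W e l j k) z
        - dird (e j) (germGamma W e l i k) z
        + ∑ m, (germGamma W e l i m z * germGamma W e m j k z
          - germGamma W e l j m z * germGamma W e m i k z))
      = sndCoeff W V e j k z * sndCoeff W V e i p z - sndCoeff W V e i k z * sndCoeff W V e j p z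
        - (fstCoeff W e j k z * fstCoeff W e i p z - fstCoeff W e i k z * fstCoeff W e j p z) := by
  have h1 := h.lor_dird_dird_dird hp i j k p
  have h2 := h.lor_dird_dird_dird hp j i k p
  rw [(dird_comm (dird_contDiffAt h.smooth (e k)) (e j) (e i)).eq_of_nhds, h1] at h2
  have h3 : ∑ l, fstCoeff W e l p z * (dird (e i) (germGamma W e l j k) z
        - dird (e j) (germGamma W e l i k) z
        + ∑ m, (germGamma W e l i m z * germGamma W e m j k z
          - germGamma W e l j m z * germGamma W e m i k z))
      = ∑ m, fstCoeff W e m p z * (dird (e i) (germGamma W e m j k) z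
          + ∑ l, germGamma W e m i l z * germGamma W e l j k z)
        - ∑ m, fstCoeff W e m p z * (dird (e j) (germGamma W e m i k) z
          + ∑ l, germGamma W e m j l z * germGamma W e l i k z) := by
    rw [← Finset.sum_sub_distrib]
    refine Finset.sum_congr rfl fun l _ => ?_
    rw [Finset.sum_sub_distrib]
    ring
  rw [h3]
  linarith

end HypGerm

end gauss

/-! ### Sectional curvature in terms of the fundamental forms -/

section sectional

variable {n : ℕ} {W V : Coord n → Mink n} {u : Coord n}

/-- In the combination of derivatives of `g` all products cancel in pairs except two equal copies of
`lor (∂_i ∂_j W) (∂_l W)`. -/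
theorem HypGerm.christoffel_eq (h : HypGerm W V (basisVec n) u) (k i j : Fin n) :
    christoffel (fstMat W (basisVec n)) k i j =ᶠ[𝓝 u] germGamma W (basisVec n) k i j := by
  have h1 : ∀ i j l, ∀ᶠ y in 𝓝 u, pd i (fun w => fstMat W (basisVec n) w j l) y
      = lor (dird (basisVec n i) (dird (basisVec n j) W) y) (dird (basisVec n l) W y)
        + lor (dird (basisVec n j) W y) (dird (basisVec n i) (dird (basisVec n l) W) y) :=
    fun i j l => dird_lor (dird_contDiffAt h.smooth _) (dird_contDiffAt h.smooth _) _
  have h2 : ∀ᶠ y in 𝓝 u, ∀ l, dird (basisVec n l) (dird (basisVec n i) W) y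
      = dird (basisVec n i) (dird (basisVec n l) W) y :=
    Filter.eventually_all.2 fun l => dird_comm h.smooth _ _
  have h3 : ∀ᶠ y in 𝓝 u, ∀ l, dird (basisVec n l) (dird (basisVec n j) W) y
      = dird (basisVec n j) (dird (basisVec n l) W) y :=
    Filter.eventually_all.2 fun l => dird_comm h.smooth _ _
  filter_upwards [h2, h3, Filter.eventually_all.2 (h1 i j), Filter.eventually_all.2 (h1 j i),
    Filter.eventually_all.2 fun l => h1 l i j] with y h2 h3 h4 h5 h6
  simp only [christoffel, germGamma, h4, h5, h6, Finset.mul_sum]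
  refine Finset.sum_congr rfl fun l _ => ?_
  rw [h2 l, h3 l, h2 j, lor_comm (dird (basisVec n i) (dird (basisVec n l) W) y)]
  ring

/-- The Gauss equation contracted with `v, w, w, v`: the Gram determinant of `h` minus that of `g`,
divided by that of `g`. -/
theorem HypGerm.secCurv_eq (h : HypGerm W V (basisVec n) u)
    (hp : (fstMat W (basisVec n) u).PosDef) (v w : Coord n) :
    secCurv (fstMat W (basisVec n)) u v w =
      ((bilin (fun i j => sndCoeff W V (basisVec n) i j u) v v
          * bilin (fun i j => sndCoeff W V (basisVec n) i j u) w w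
          - bilin (fun i j => sndCoeff W V (basisVec n) i j u) v w ^ 2)
        - (bilin (fun i j => fstCoeff W (basisVec n) i j u) v v
          * bilin (fun i j => fstCoeff W (basisVec n) i j u) w w
          - bilin (fun i j => fstCoeff W (basisVec n) i j u) v w ^ 2))
      / (bilin (fun i j => fstCoeff W (basisVec n) i j u) v v
          * bilin (fun i j => fstCoeff W (basisVec n) i j u) w w
          - bilin (fun i j => fstCoeff W (basisVec n) i j u) v w ^ 2) := by
  set S := fun i j => sndCoeff W V (basisVec n) i j u with hS
  set G := fun i j => fstCoeff W (basisVec n) i j u with hG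
  have hm : ∀ v w : Coord n, metricVal (fstMat W (basisVec n)) u v w = bilin G v w := fun v w =>
    Finset.sum_congr rfl fun i _ => Finset.sum_congr rfl fun j _ => by
      simp only [fstMat, Matrix.of_apply, hG]
      ring
  have hSs : ∀ i j, S i j = S j i := fun i j => (h.second_symm i j).self_of_nhds
  have hGs : ∀ i j, G i j = G j i := fun i j => lor_comm _ _
  have hr : ∀ l k i j, riem (fstMat W (basisVec n)) l k i j u
      = dird (basisVec n i) (germGamma W (basisVec n) l j k) u
        - dird (basisVec n j) (germGamma W (basisVec n) l i k) u
        + ∑ m, (germGamma W (basisVec n) l i m u * germGamma W (basisVec n) m j k u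
          - germGamma W (basisVec n) l j m u * germGamma W (basisVec n) m i k u) := by
    intro l k i j
    have hc := fun k i j => (h.christoffel_eq k i j).eq_of_nhds
    simp only [riem, hc]
    congr 2
    · exact (dird_congr (h.christoffel_eq l j k) (basisVec n i)).eq_of_nhds
    · exact (dird_congr (h.christoffel_eq l i k) (basisVec n j)).eq_of_nhds
  have hsum : ∀ i j k p, ∑ l, fstMat W (basisVec n) u l p * riem (fstMat W (basisVec n)) l k i j u
      = S j k * S i p - S i k * S j p - (G j k * G i p - G i k * G j p) := fun i j k p => by
    rw [← h.gauss hp i j k p]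
    exact Finset.sum_congr rfl fun l _ => by rw [hr]; rfl
  rw [secCurv, hm, hm, hm]
  congr 1
  have h1 : ∀ i j k, ∑ l, ∑ p, fstMat W (basisVec n) u l p
        * riem (fstMat W (basisVec n)) l k i j u * v i * w j * w k * v p
      = ∑ p, (S j k * S i p - S i k * S j p - (G j k * G i p - G i k * G j p))
        * v i * w j * w k * v p := fun i j k => by
    rw [Finset.sum_comm]
    refine Finset.sum_congr rfl fun p _ => ?_
    rw [← hsum]
    simp only [Finset.sum_mul]
  simp only [h1]
  have h4 : ∀ A : Fin n → Fin n → ℝ, (∀ i j, A i j = A j i) →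
      ∑ i, ∑ j, ∑ k, ∑ p, (A j k * A i p - A i k * A j p) * v i * w j * w k * v p
      = bilin A v v * bilin A w w - bilin A v w ^ 2 := by
    intro A hA
    have e1 : bilin A v v * bilin A w w
        = ∑ i, ∑ j, ∑ k, ∑ p, A j k * A i p * v i * w j * w k * v p := by
      simp only [bilin]
      rw [Finset.sum_mul]
      refine Finset.sum_congr rfl fun i _ => ?_
      rw [Finset.mul_sum]
      refine Finset.sum_congr rfl fun j _ => ?_
      rw [Finset.mul_sum]
      refine Finset.sum_congr rfl fun k _ => ?_
      rw [Finset.sum_mul]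
      exact Finset.sum_congr rfl fun p _ => by ring
    have e2 : bilin A v w ^ 2
        = ∑ i, ∑ j, ∑ k, ∑ p, A i k * A j p * v i * w j * w k * v p := by
      have : bilin A v w = ∑ j, ∑ p, v p * w j * A j p := by
        rw [bilin, Finset.sum_comm]
        exact Finset.sum_congr rfl fun j _ => Finset.sum_congr rfl fun p _ => by rw [hA p j]
      rw [pow_two]
      nth_rewrite 2 [this]
      rw [bilin, Finset.sum_mul]
      refine Finset.sum_congr rfl fun i _ => ?_
      rw [Finset.mul_sum]
      refine Finset.sum_congr rfl fun j _ => ?_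
      rw [Finset.sum_mul_sum]
      exact Finset.sum_congr rfl fun k _ => Finset.sum_congr rfl fun p _ => by ring
    rw [e1, e2, ← Finset.sum_sub_distrib]
    refine Finset.sum_congr rfl fun i _ => ?_
    rw [← Finset.sum_sub_distrib]
    refine Finset.sum_congr rfl fun j _ => ?_
    rw [← Finset.sum_sub_distrib]
    refine Finset.sum_congr rfl fun k _ => ?_
    rw [← Finset.sum_sub_distrib]
    refine Finset.sum_congr rfl fun p _ => ?_
    ring
  rw [← h4 S hSs, ← h4 G hGs, ← Finset.sum_sub_distrib]
  refine Finset.sum_congr rfl fun i _ => ?_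
  rw [← Finset.sum_sub_distrib]
  refine Finset.sum_congr rfl fun j _ => ?_
  rw [← Finset.sum_sub_distrib]
  refine Finset.sum_congr rfl fun k _ => ?_
  rw [← Finset.sum_sub_distrib]
  refine Finset.sum_congr rfl fun p _ => ?_
  ring

end sectional

/-! ### Outward normals -/

section outward

variable {n : ℕ}

theorem geod_neg_neg (p v : Mink n) (s : ℝ) : geod p (-v) s = geod p v (-s) := by
  simp [geod]

theorem IsOutward.not_neg {K : Set (Mink n)} {p v : Mink n} (h : IsOutward K p v) :
    ¬ IsOutward K p (-v) := by
  intro h'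
  obtain ⟨s, h1, h2⟩ := (h.and h').exists
  exact h2.2 (by rw [geod_neg_neg]; exact h1.1)

theorem geod_neg_mem_hyp {p v : Mink n} (hp : p ∈ hyp n) (hvp : lor v p = 0) (hv : lor v v = 1)
    (hv0 : v 0 ≤ 0) {s : ℝ} (hs : 0 ≤ s) :
    geod p v (-s) ∈ hyp n ∧ Real.cosh s * p 0 ≤ geod p v (-s) 0 := by
  have hpv : lor p v = 0 := by rw [lor_comm]; exact hvp
  have h0 : Real.cosh s * p 0 ≤ geod p v (-s) 0 := by
    have h1 : geod p v (-s) 0 = Real.cosh s * p 0 - Real.sinh s * v 0 := by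
      simp [geod, sub_eq_add_neg]
    have h2 := Real.sinh_nonneg_iff.2 hs
    nlinarith
  refine ⟨⟨?_, lt_of_lt_of_le (mul_pos (Real.cosh_pos s) hp.2) h0⟩, h0⟩
  have h3 := Real.cosh_sq s
  simp only [geod, Real.cosh_neg, Real.sinh_neg, lor_add_left, lor_add_right, lor_smul_left,
    lor_smul_right, hp.1, hvp, hpv, hv]
  nlinarith

/-- The outward normal at a point of maximal height points upwards. -/
theorem IsOutward.zero_lt {K : Set (Mink n)} {p v : Mink n} (h : IsOutward K p v)
    (hp : p ∈ hyp n) (hvp : lor v p = 0) (hv : lor v v = 1) (hmax : ∀ q ∈ K, q 0 ≤ p 0) :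
    0 < v 0 := by
  by_contra! hv0
  obtain ⟨s₀, hs₀, hs₀'⟩ := (h.and self_mem_nhdsWithin).exists
  have hs₀' : 0 < s₀ := hs₀'
  obtain ⟨-, hb⟩ := hs₀.1
  -- If `v` did not point upwards, the backward geodesic would rise above the maximal height of `K`
  -- and never return. It would then lie in a single component of the complement and be unbounded,
  -- although it starts in the enclosed region.
  have hsub : (fun s => geod p v (-s)) '' Ici s₀ ⊆ hyp n \ K := by
    rintro _ ⟨s, hs, rfl⟩
    have hs : s₀ ≤ s := hs
    obtain ⟨h1, h2⟩ := geod_neg_mem_hyp hp hvp hv hv0 (hs₀'.le.trans hs)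
    refine ⟨h1, fun hK => ?_⟩
    have h3 := hmax _ hK
    have h4 : 1 < Real.cosh s := Real.one_lt_cosh.2 (hs₀'.trans_le hs).ne'
    have h5 := hp.2
    nlinarith
  have hcont : Continuous fun s => geod p v (-s) := by
    unfold geod
    fun_prop
  have hpre : IsPreconnected ((fun s => geod p v (-s)) '' Ici s₀) :=
    isPreconnected_Ici.image _ hcont.continuousOn
  have hcomp := hpre.subset_connectedComponentIn (mem_image_of_mem _ self_mem_Ici) hsub
  obtain ⟨R, hR⟩ := (hb.subset hcomp).exists_norm_le
  set s := max s₀ (R / p 0 + 1) with hsdef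
  have hs : s₀ ≤ s := le_max_left _ _
  have h1 := hR _ (mem_image_of_mem _ hs)
  have h2 := (geod_neg_mem_hyp hp hvp hv hv0 (hs₀'.le.trans hs)).2
  have h3 : geod p v (-s) 0 ≤ R := (le_abs_self _).trans ((PiLp.norm_apply_le _ 0).trans h1)
  have h4 : s < Real.cosh s := by
    have := Real.self_lt_sinh_iff.2 (hs₀'.trans_le hs)
    exact this.trans (Real.sinh_lt_cosh s)
  have h5 : R / p 0 + 1 ≤ s := le_max_right _ _
  have h6 := hp.2
  have h7 : R < s * p 0 := by
    have : R / p 0 < s := by linarith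
    rwa [div_lt_iff₀ h6] at this
  nlinarith

end outward

/-! ### Convexity of the initial hypersurface -/

section initial

variable {n : ℕ} {M : Type*} [TopologicalSpace M] [ChartedSpace (EuclideanSpace ℝ (Fin n)) M]
  [IsManifold (𝓡 n) ∞ M] {X ν : M → Mink n}

theorem exists_chart_forms (hX : IsHypImmersion X) (hν : IsUnitNormal X ν)
    (hs : ContMDiff (𝓡 n) 𝓘(ℝ, Mink n) ∞ ν) (x : M) :
    HypGerm (inChart x X) (inChart x ν) (basisVec n) (extChartAt (𝓡 n) x x) ∧
    (fstMat (inChart x X) (basisVec n) (extChartAt (𝓡 n) x x)).PosDef ∧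
    princCurv X ν x = genEig (fstMat (inChart x X) (basisVec n) (extChartAt (𝓡 n) x x))
      (sndMat (inChart x X) (inChart x ν) (basisVec n) (extChartAt (𝓡 n) x x)) := by
  have hu := mem_extChartAt_target (I := 𝓡 n) x
  have h1 := princCurv_eq_genEig_inChart hX hs x hu
  rw [extChartAt_to_inv] at h1
  exact ⟨hX.hypGerm hν hs x hu, hX.posDef_fstMat x hu, h1⟩

/-- For the plane of two eigenvectors the formula for the sectional curvature reduces to `κ_a κ_b -
1`. -/
theorem one_lt_princCurv_mul (hX : IsHypImmersion X) (hν : IsUnitNormal X ν)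
    (hs : ContMDiff (𝓡 n) 𝓘(ℝ, Mink n) ∞ ν) (hsec : HasPosSecCurv X) (x : M) {a b : Fin n}
    (hab : a ≠ b) : 1 < princCurv X ν x a * princCurv X ν x b := by
  obtain ⟨hg, hG, hκ⟩ := exists_chart_forms hX hν hs x
  obtain ⟨-, P, hP, hP1, hP2⟩ := exists_simultaneous_diagonal hG hg.sndMat_isHermitian.self_of_nhds
  rw [← hκ] at hP2
  have hli : LinearIndependent ℝ ![(WithLp.toLp 2 fun k => P k a : Coord n),
      WithLp.toLp 2 fun k => P k b] := by
    rw [LinearIndependent.pair_iff]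
    intro s t hst
    have h1 : P.mulVec (Pi.single a s + Pi.single b t) = 0 := by
      ext k
      have := congrArg (fun v : Coord n => v k) hst
      simpa [Matrix.mulVec_add, mul_comm] using this
    have h2 : Pi.single a s + Pi.single b t = (0 : Fin n → ℝ) :=
      Matrix.mulVec_injective_iff_isUnit.2 ((Matrix.isUnit_iff_isUnit_det _).2 hP)
        (h1.trans (Matrix.mulVec_zero P).symm)
    exact ⟨by simpa [Pi.single_apply, hab] using congrFun h2 a,
      by simpa [Pi.single_apply, hab.symm] using congrFun h2 b⟩
  have hpos := hsec x _ _ hli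
  have hb1 : ∀ i j, bilin (fun i j => fstCoeff (inChart x X) (basisVec n) i j
      (extChartAt (𝓡 n) x x)) (fun k => P k i) (fun k => P k j) = (1 : Matrix _ _ ℝ) i j := by
    intro i j
    rw [← hP1]
    exact bilin_columns (fstMat (inChart x X) (basisVec n) (extChartAt (𝓡 n) x x)) P i j
  have hb2 : ∀ i j, bilin (fun i j => sndCoeff (inChart x X) (inChart x ν) (basisVec n) i j
      (extChartAt (𝓡 n) x x)) (fun k => P k i) (fun k => P k j)
      = Matrix.diagonal (princCurv X ν x) i j := by
    intro i j
    rw [← hP2]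
    exact bilin_columns
      (sndMat (inChart x X) (inChart x ν) (basisVec n) (extChartAt (𝓡 n) x x)) P i j
  have hsc := hg.secCurv_eq hG (WithLp.toLp 2 fun k => P k a) (WithLp.toLp 2 fun k => P k b)
  simp only [hb1, hb2, Matrix.diagonal_apply_eq, Matrix.diagonal_apply_ne _ hab,
    Matrix.one_apply_eq, Matrix.one_apply_ne hab] at hsc
  have h3 : secCurv (coordMetric X x) (extChartAt (𝓡 n) x x) (WithLp.toLp 2 fun k => P k a)
      (WithLp.toLp 2 fun k => P k b) = _ := hsc
  rw [h3] at hpos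
  norm_num at hpos
  exact hpos

/-- The second fundamental form at a point of maximal height, with respect to a normal that points
upwards, has a positive value. -/
theorem exists_princCurv_pos (hX : IsHypImmersion X) (hν : IsUnitNormal X ν)
    (hs : ContMDiff (𝓡 n) 𝓘(ℝ, Mink n) ∞ ν) {x : M} (hmax : ∀ y, X y 0 ≤ X x 0)
    (hup : 0 < ν x 0) (hn : 0 < n) : ∃ i, 0 < princCurv X ν x i := by
  obtain ⟨hg, hG, hκ⟩ := exists_chart_forms hX hν hs x
  set u := extChartAt (𝓡 n) x x
  set W := inChart x X
  set V := inChart x ν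
  have hWx : W u = X x := congrArg X (extChartAt_to_inv x)
  have hVx : V u = ν x := congrArg ν (extChartAt_to_inv x)
  set i₀ : Fin n := ⟨0, hn⟩
  set π : Mink n →L[ℝ] ℝ := EuclideanSpace.proj 0
  have hφ : ContDiffAt ℝ ∞ (fun y => W y 0) u := π.contDiff.contDiffAt.comp u hg.smooth
  have hdφ : ∀ v (A : Coord n → Mink n), ContDiffAt ℝ ∞ A u →
      dird v (fun y => A y 0) =ᶠ[𝓝 u] fun y => dird v A y 0 := fun v A hA => by
    filter_upwards [eventually_differentiableAt hA] with y hy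
    have h1 : fderiv ℝ (fun y => π (A y)) y = π.comp (fderiv ℝ A y) :=
      (π.hasFDerivAt.comp y hy.hasFDerivAt).fderiv
    exact congrArg (fun L => L v) h1
  have hfirst : ∀ v, dird v W u 0 = 0 := fun v => by
    rw [← (hdφ v W hg.smooth).eq_of_nhds, dird]
    have hloc : IsLocalMax (fun y => W y 0) u := Filter.Eventually.of_forall fun y => by
      simp only [hWx]
      exact hmax _
    rw [hloc.fderiv_eq_zero]
    simp
  have hjet := hasJet_line hφ (basisVec n i₀)
  have hneg := ((HasJet.const (W u 0)).sub hjet).congr_jet (a' := 0) (by simp) rfl rfl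
  have hsecond := (hneg.nonneg (Filter.Eventually.of_forall fun s => by
    simp only [hWx, sub_nonneg]
    exact hmax _)).2
  rw [((dird_congr (hdφ (basisVec n i₀) W hg.smooth) (basisVec n i₀)).trans
    (hdφ (basisVec n i₀) _ (dird_contDiffAt hg.smooth _))).eq_of_nhds,
    (hg.dird_dird_eq hG i₀ i₀).eq_of_nhds] at hsecond
  have hG0 : 0 < fstCoeff W (basisVec n) i₀ i₀ u := hG.diag_pos (i := i₀)
  have hX0 := (hX.mem_hyp x).2
  have hsum : (∑ m, germGamma W (basisVec n) m i₀ i₀ u • dird (basisVec n m) W u) 0 = 0 := by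
    simp [hfirst]
  -- By the Gauss formula the second derivative of the height is `-h ν₀ + g X₀`, its tangential part
  -- vanishing at the maximum. It is nonpositive while `g`, `X₀` and `ν₀` are positive, so `h` is
  -- positive.
  have hS : 0 < sndCoeff W V (basisVec n) i₀ i₀ u := by
    have h2 : (∑ m, germGamma W (basisVec n) m i₀ i₀ u • dird (basisVec n m) W u
        + (-sndCoeff W V (basisVec n) i₀ i₀ u • V u + fstCoeff W (basisVec n) i₀ i₀ u • W u)) 0
        = -sndCoeff W V (basisVec n) i₀ i₀ u * ν x 0 + fstCoeff W (basisVec n) i₀ i₀ u * X x 0 := by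
      rw [PiLp.add_apply, hsum, hWx, hVx]
      simp
    rw [h2] at hsecond
    by_contra! hcon
    nlinarith [mul_pos hG0 hX0]
  -- The largest eigenvalue: one positive direction suffices.
  refine ⟨⟨n - 1, by omega⟩, ?_⟩
  rw [hκ]
  refine lt_genEig_of_pos hG hg.sndMat_isHermitian.self_of_nhds _ (k := 1) (by simp; omega)
    (Matrix.of fun i _ => if i = i₀ then 1 else 0) 0 fun y hy => ?_
  have hy0 : y 0 ≠ 0 := fun h => hy (by ext i; fin_cases i; exact h)
  have hv : (Matrix.of fun (i : Fin n) (_ : Fin 1) => if i = i₀ then (1 : ℝ) else 0).mulVec y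
      = fun i => if i = i₀ then y 0 else 0 := by
    ext i
    simp [Matrix.mulVec, dotProduct]
  rw [hv, zero_smul, sub_zero, ← bilin_eq_dotProduct]
  have : bilin (fun i j => sndMat W V (basisVec n) u i j) (fun i => if i = i₀ then y 0 else 0)
      (fun i => if i = i₀ then y 0 else 0) = y 0 * y 0 * sndCoeff W V (basisVec n) i₀ i₀ u := by
    simp [bilin, sndMat]
  rw [this]
  exact mul_pos (mul_self_pos.2 hy0) hS

theorem IsUnitNormal.eq_or_eq_neg {ν' : M → Mink n} (hX : IsHypImmersion X)
    (hν : IsUnitNormal X ν) (hν' : IsUnitNormal X ν') (x : M) : ν' x = ν x ∨ ν' x = -ν x := by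
  have hu := mem_extChartAt_target (I := 𝓡 n) x
  obtain ⟨D, hD⟩ := exists_fderiv_inChart x hu
  have hpd := hX.posDef_fstMat x hu
  have hE : ∀ (μ : M → Mink n), IsUnitNormal X μ → ∀ i,
      lor (μ x) (dird (basisVec n i) (inChart x X) (extChartAt (𝓡 n) x x)) = 0 := fun μ hμ i => by
    rw [hD X hX.smooth, extChartAt_to_inv]
    exact (hμ x).2.1 _
  have hXE : ∀ i, lor (X x) (dird (basisVec n i) (inChart x X) (extChartAt (𝓡 n) x x)) = 0 :=
    fun i => by
      rw [hD X hX.smooth, extChartAt_to_inv]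
      exact hX.lor_diff x _
  have heq : ν' x = lor (ν' x) (ν x) • ν x := by
    refine eq_of_lor_eq (hX.mem_hyp x).1 (hν x).2.2 (hν x).1 hXE (hE ν hν) hpd.det_pos.ne'.isUnit
      ?_ ?_ fun i => ?_
    · rw [lor_smul_left, (hν' x).1, (hν x).1, mul_zero]
    · rw [lor_smul_left, (hν x).2.2, mul_one]
    · rw [lor_smul_left, hE ν hν, hE ν' hν', mul_zero]
  have h1 : lor (ν' x) (ν x) * lor (ν' x) (ν x) = 1 := by
    have := (hν' x).2.2
    nth_rewrite 2 [heq] at this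
    rwa [lor_smul_right] at this
  rcases mul_self_eq_one_iff.1 h1 with h2 | h2
  · left; rw [heq, h2, one_smul]
  · right; rw [heq, h2, neg_one_smul]

/-- Makes the initial normal of every flow the same, so that the constant depends on the initial
hypersurface only. -/
theorem IsUnitNormal.eq_of_isOutward {ν' : M → Mink n} {K : Set (Mink n)} (hX : IsHypImmersion X)
    (hν : IsUnitNormal X ν) (hν' : IsUnitNormal X ν') (ho : ∀ x, IsOutward K (X x) (ν x))
    (ho' : ∀ x, IsOutward K (X x) (ν' x)) : ν' = ν := by
  ext1 x
  rcases IsUnitNormal.eq_or_eq_neg hX hν hν' x with h | h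
  · exact h
  · have := ho' x
    rw [h] at this
    exact absurd this (ho x).not_neg

/-- Since products of distinct principal curvatures exceed 1, the open condition `0 < κ_0` coincides
with the closed condition `0 ≤ κ_{n-1}`. It holds at a highest point, hence everywhere by
connectedness. -/
theorem princCurv_pos_of_isOutward {m : ℕ} {M : Type*} [TopologicalSpace M]
    [ChartedSpace (EuclideanSpace ℝ (Fin (m + 3))) M] [IsManifold (𝓡 (m + 3)) ∞ M]
    [CompactSpace M] [ConnectedSpace M] {X ν : M → Mink (m + 3)}
    (hX : IsHypImmersion X) (hν : IsUnitNormal X ν)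
    (hs : ContMDiff (𝓡 (m + 3)) 𝓘(ℝ, Mink (m + 3)) ∞ ν) (hsec : HasPosSecCurv X)
    (ho : ∀ x, IsOutward (range X) (X x) (ν x)) (x : M) : 0 < princCurv X ν x 0 := by
  have hfam := IsHypFamily.const hX hν hs 1
  have h0 : (0 : ℝ) ∈ Ico (0 : ℝ) 1 := by simp
  have hcont : ∀ i, Continuous fun x => princCurv X ν x i := fun i => by
    have := hfam.continuousOn_princCurv i
    rw [← continuousOn_univ]
    exact this.comp (f := fun x : M => ((0 : ℝ), x)) (by fun_prop) fun x _ => ⟨h0, mem_univ _⟩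
  have hmono : ∀ x, Monotone (princCurv X ν x) := fun x => hfam.monotone_princCurv h0 x
  have hdich : ∀ x, 0 < princCurv X ν x 0 ↔ 0 ≤ princCurv X ν x (Fin.last (m + 2)) := fun x => by
    have h1 := one_lt_princCurv_mul hX hν hs hsec x (a := 0) (b := Fin.last (m + 2))
      (by simp [Fin.ext_iff])
    have h2 := hmono x (Fin.zero_le (Fin.last (m + 2)))
    constructor
    · intro h; linarith
    · intro h; by_contra! hcon; nlinarith
  have hclopen : IsClopen {x | 0 < princCurv X ν x 0} := by
    refine ⟨?_, isOpen_lt continuous_const (hcont 0)⟩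
    simp only [hdich]
    exact isClosed_le continuous_const (hcont _)
  have hne : {x | 0 < princCurv X ν x 0}.Nonempty := by
    obtain ⟨x₁, -, hx₁⟩ := isCompact_univ.exists_isMaxOn (univ_nonempty (α := M))
      (f := fun x => X x 0) (by
        have := hX.smooth.continuous
        exact ((EuclideanSpace.proj (0 : Fin (m + 3 + 2)) : Mink (m + 3) →L[ℝ] ℝ).continuous.comp
          this).continuousOn)
    have hmax : ∀ y, X y 0 ≤ X x₁ 0 := fun y => hx₁ (mem_univ y)
    have hup := (ho x₁).zero_lt (hX.mem_hyp x₁) (hν x₁).1 (hν x₁).2.2 (by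
      rintro _ ⟨y, rfl⟩
      exact hmax y)
    obtain ⟨i, hi⟩ := exists_princCurv_pos hX hν hs hmax hup (by omega)
    exact ⟨x₁, (hdich x₁).2 (hi.le.trans (hmono x₁ (Fin.le_last i)))⟩
  have := hclopen.eq_univ hne
  exact (this ▸ mem_univ x : x ∈ {x | 0 < princCurv X ν x 0})

end initial

/-! ### Preservation of the pinching -/

section main

variable {m : ℕ} {M : Type*} [TopologicalSpace M] [ChartedSpace (EuclideanSpace ℝ (Fin (m + 3))) M]
  [IsManifold (𝓡 (m + 3)) ∞ M]

theorem IsSpeed.continuousWithinAt_pinching {F : (Fin (m + 3) → ℝ) → ℝ} (hF : IsSpeed F)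
    {T : ℝ} {X ν : ℝ → M → Mink (m + 3)} (h : IsHypFamily T X ν) (c : ℝ) {q : ℝ × M}
    (hq : q.1 ∈ Ico 0 T) (hpos : princCurv (X q.1) (ν q.1) q.2 ∈ posCone (m + 3)) :
    ContinuousWithinAt (fun q : ℝ × M => princCurv (X q.1) (ν q.1) q.2 0
      * princCurv (X q.1) (ν q.1) q.2 1 - 1 - c * F (princCurv (X q.1) (ν q.1) q.2) ^ 2)
      (Ico 0 T ×ˢ univ) q := by
  have h1 := fun i => h.continuousOn_princCurv i q ⟨hq, mem_univ _⟩
  have h2 : ContinuousWithinAt (fun q : ℝ × M => princCurv (X q.1) (ν q.1) q.2)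
      (Ico 0 T ×ˢ univ) q := continuousWithinAt_pi.2 h1
  have h3 : ContinuousWithinAt (fun q : ℝ × M => F (princCurv (X q.1) (ν q.1) q.2))
      (Ico 0 T ×ˢ univ) q :=
    ContinuousAt.comp_continuousWithinAt
      (f := fun q : ℝ × M => princCurv (X q.1) (ν q.1) q.2) (g := F)
      ((hF.contDiffAt hpos).continuousAt) h2
  exact (((h1 0).mul (h1 1)).sub continuousWithinAt_const).sub
    (continuousWithinAt_const.mul (h3.pow 2))

theorem IsHypFamily.mem_posCone_iff {T : ℝ} {X ν : ℝ → M → Mink (m + 3)} (h : IsHypFamily T X ν)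
    {t : ℝ} (ht : t ∈ Ico 0 T) (x : M) :
    princCurv (X t) (ν t) x ∈ posCone (m + 3) ↔ 0 < princCurv (X t) (ν t) x 0 :=
  ⟨fun h0 => h0 0, fun h0 i => h0.trans_le (h.monotone_princCurv ht x (Fin.zero_le i))⟩

variable [CompactSpace M]

/-- The pinching inequality is preserved by the flow. -/
theorem IsFlow.pinching {F : (Fin (m + 3) → ℝ) → ℝ} {X₀ : M → Mink (m + 3)} {T : ℝ}
    {X ν : ℝ → M → Mink (m + 3)} (h : IsFlow F X₀ T X ν) (hF : IsSpeed F) {c : ℝ} (hc : 0 < c)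
    (h0 : ∀ x, 0 < princCurv (X 0) (ν 0) x 0 ∧ c * F (princCurv (X 0) (ν 0) x) ^ 2
      < princCurv (X 0) (ν 0) x 0 * princCurv (X 0) (ν 0) x 1 - 1) {t : ℝ} (ht : t ∈ Ico 0 T)
    (x : M) : 0 < princCurv (X t) (ν t) x 0 ∧ c * F (princCurv (X t) (ν t) x) ^ 2
      < princCurv (X t) (ν t) x 0 * princCurv (X t) (ν t) x 1 - 1 := by
  have hfam := h.isHypFamily
  set κ : ℝ × M → Fin (m + 3) → ℝ := fun q => princCurv (X q.1) (ν q.1) q.2 with hκ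
  set Z : ℝ × M → ℝ := fun q => κ q 0 * κ q 1 - 1 - c * F (κ q) ^ 2 with hZ
  suffices hgood : ∀ q ∈ Icc 0 t ×ˢ (univ : Set M), 0 < κ q 0 ∧ 0 < Z q by
    have := hgood (t, x) ⟨right_mem_Icc.2 ht.1, mem_univ _⟩
    exact ⟨this.1, sub_pos.1 this.2⟩
  by_contra! hbad
  have hsub : Icc 0 t ×ˢ (univ : Set M) ⊆ Ico 0 T ×ˢ univ :=
    prod_mono (Icc_subset_Ico_right ht.2) subset_rfl
  have hS : IsCompact (Icc 0 t ×ˢ (univ : Set M)) := isCompact_Icc.prod isCompact_univ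
  have hκc : ∀ i, ContinuousOn (fun q => κ q i) (Ico 0 T ×ˢ univ) := hfam.continuousOn_princCurv
  have hZc : ∀ q ∈ Ico 0 T ×ˢ (univ : Set M), κ q ∈ posCone (m + 3) →
      ContinuousWithinAt Z (Ico 0 T ×ˢ univ) q := fun q hq hp =>
    hF.continuousWithinAt_pinching hfam c hq.1 hp
  -- Nothing is known about `F` outside the positive cone, so `Z` is continuous only where `0 <
  -- κ_0`. The bad set is nevertheless closed, its complement being locally tested in that order,
  -- and it has a point of smallest time.
  set B := {q ∈ Icc 0 t ×ˢ (univ : Set M) | ¬(0 < κ q 0 ∧ 0 < Z q)} with hB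
  have hBc : IsCompact B := by
    refine hS.of_isClosed_subset ?_ fun q hq => hq.1
    rw [← isOpen_compl_iff, isOpen_iff_mem_nhds]
    intro q hq
    by_cases hqS : q ∈ Icc 0 t ×ˢ (univ : Set M)
    · have hg : 0 < κ q 0 ∧ 0 < Z q := by
        by_contra hcon
        exact hq ⟨hqS, hcon⟩
      have hqI := hsub hqS
      have e1 := (hκc 0 q hqI).eventually (lt_mem_nhds hg.1)
      have e2 := (hZc q hqI ((hfam.mem_posCone_iff hqI.1 q.2).2 hg.1)).eventually
        (lt_mem_nhds hg.2)
      rw [eventually_nhdsWithin_iff] at e1 e2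
      filter_upwards [e1, e2] with r h1 h2 hr
      exact hr.2 ⟨h1 (hsub hr.1), h2 (hsub hr.1)⟩
    · filter_upwards [(isClosed_Icc.prod isClosed_univ).isOpen_compl.mem_nhds hqS] with r h1 hr
      exact h1 hr.1
  have hBne : B.Nonempty := by
    obtain ⟨q, hq, hq'⟩ := hbad
    exact ⟨q, hq, fun hcon => (hq' hcon.1).not_gt hcon.2⟩
  obtain ⟨⟨s, y⟩, hsy, hmin⟩ := hBc.exists_isMinOn hBne continuous_fst.continuousOn
  have hsI := hsub hsy.1
  have hs0 : 0 < s := by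
    rcases hsy.1.1.1.eq_or_lt with h1 | h1
    · exfalso
      have h1 : 0 = s := h1
      subst h1
      exact hsy.2 ⟨(h0 y).1, sub_pos.2 (h0 y).2⟩
    · exact h1
  have hsT : s ∈ Ioo 0 T := ⟨hs0, hsI.1.2⟩
  have hearly : ∀ r ∈ Ico 0 s, ∀ w, 0 < κ (r, w) 0 ∧ 0 < Z (r, w) := fun r hr w => by
    by_contra hcon
    have := hmin (⟨⟨⟨hr.1, hr.2.le.trans hsy.1.1.2⟩, mem_univ _⟩, hcon⟩ : (r, w) ∈ B)
    exact absurd hr.2 (not_lt.2 this)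
  have hlim : ∀ (w : M) {g : ℝ × M → ℝ}, ContinuousWithinAt g (Ico 0 T ×ˢ univ) (s, w) →
      (∀ r ∈ Ico 0 s, 0 ≤ g (r, w)) → 0 ≤ g (s, w) := fun w g hg hr => by
    have hmap : Filter.Tendsto (fun r : ℝ => (r, w)) (𝓝[<] s) (𝓝[Ico 0 T ×ˢ univ] (s, w)) := by
      refine tendsto_nhdsWithin_iff.2 ⟨?_, ?_⟩
      · have : Continuous fun r : ℝ => (r, w) := by fun_prop
        exact (this.tendsto s).mono_left nhdsWithin_le_nhds
      · filter_upwards [Ioo_mem_nhdsLT hs0] with r hr using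
          ⟨⟨hr.1.le, hr.2.trans hsT.2⟩, mem_univ _⟩
    refine ge_of_tendsto (hg.tendsto.comp hmap) ?_
    filter_upwards [Ioo_mem_nhdsLT hs0] with r hr' using hr r ⟨hr'.1.le, hr'.2⟩
  -- Convexity is not lost at the first bad time: in the limit `κ_0 ≥ 0` and `κ_0 κ_1 ≥ 1`, which
  -- excludes `κ_0 = 0`.
  have hpos : ∀ w, κ (s, w) ∈ posCone (m + 3) := fun w => by
    have hw : (s, w) ∈ Ico 0 T ×ˢ (univ : Set M) := ⟨hsI.1, mem_univ _⟩
    have h1 := hlim w (hκc 0 _ hw) fun r hr => (hearly r hr w).1.le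
    have h2 : 0 ≤ κ (s, w) 0 * κ (s, w) 1 - 1 :=
      hlim w (g := fun q => κ q 0 * κ q 1 - 1)
        (((hκc 0 _ hw).mul (hκc 1 _ hw)).sub continuousWithinAt_const) fun r hr => by
          have h3 := (hearly r hr w).2
          have h4 := mul_nonneg hc.le (sq_nonneg (F (κ (r, w))))
          simp only [hZ] at h3
          linarith
    refine (hfam.mem_posCone_iff hsI.1 w).2 (h1.lt_of_ne fun h3 => ?_)
    rw [← h3] at h2
    norm_num at h2
  have hZs : ∀ w, 0 ≤ Z (s, w) := fun w =>
    hlim w (hZc _ ⟨hsI.1, mem_univ _⟩ (hpos w)) fun r hr => (hearly r hr w).2.le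
  have hzero : Z (s, y) = 0 := by
    refine le_antisymm ?_ (hZs y)
    by_contra! hcon
    exact hsy.2 ⟨hpos y 0, hcon⟩
  refine h.false_of_first_touching hF hsT y (hpos y) hc ?_ fun r hr w => ?_
  · simp only [hZ, hκ] at hzero
    linarith
  · rcases hr.2.eq_or_lt with h1 | h1
    · subst h1
      have := hZs w
      simp only [hZ, hκ] at this
      linarith
    · have := (hearly r ⟨hr.1.le, h1⟩ w).2
      simp only [hZ, hκ] at this
      linarith

theorem exists_pinching_initial [ConnectedSpace M] {X ν : M → Mink (m + 3)}
    (hX : IsHypImmersion X) (hν : IsUnitNormal X ν)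
    (hs : ContMDiff (𝓡 (m + 3)) 𝓘(ℝ, Mink (m + 3)) ∞ ν) (hsec : HasPosSecCurv X)
    (ho : ∀ x, IsOutward (range X) (X x) (ν x)) :
    ∃ c : ℝ, 0 < c ∧ ∀ F : (Fin (m + 3) → ℝ) → ℝ, IsSpeed F → ∀ x,
      c * F (princCurv X ν x) ^ 2 < princCurv X ν x 0 * princCurv X ν x 1 - 1 := by
  have hfam := IsHypFamily.const hX hν hs 1
  have h0 : (0 : ℝ) ∈ Ico (0 : ℝ) 1 := by simp
  have hcont : ∀ i, Continuous fun x => princCurv X ν x i := fun i => by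
    have := hfam.continuousOn_princCurv i
    rw [← continuousOn_univ]
    exact this.comp (f := fun x : M => ((0 : ℝ), x)) (by fun_prop) fun x _ => ⟨h0, mem_univ _⟩
  have hpos := princCurv_pos_of_isOutward hX hν hs hsec ho
  have hmono : ∀ x, Monotone (princCurv X ν x) := fun x => hfam.monotone_princCurv h0 x
  obtain ⟨x₁, -, hx₁⟩ := isCompact_univ.exists_isMinOn (univ_nonempty (α := M))
    (f := fun x => princCurv X ν x 0 * princCurv X ν x 1 - 1)
    ((((hcont 0).mul (hcont 1)).sub continuous_const).continuousOn)
  obtain ⟨x₂, -, hx₂⟩ := isCompact_univ.exists_isMaxOn (univ_nonempty (α := M))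
    (f := fun x => princCurv X ν x (Fin.last (m + 2))) (hcont _).continuousOn
  set a := princCurv X ν x₁ 0 * princCurv X ν x₁ 1 - 1 with ha
  set b := princCurv X ν x₂ (Fin.last (m + 2)) with hb
  have ha0 : 0 < a := by
    have := one_lt_princCurv_mul hX hν hs hsec x₁ (a := 0) (b := 1) (by simp)
    linarith
  have hb0 : 0 < b := (hpos x₂).trans_le (hmono x₂ (Fin.zero_le _))
  -- Here `a` is the minimum of `κ_0 κ_1 - 1` and `b` the maximum of the largest curvature. As every
  -- admissible `F` is at most `b`, this choice gives `c F² ≤ a / 2 < a`.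
  refine ⟨a / (2 * b ^ 2), by positivity, fun F hF x => ?_⟩
  have h1 : a ≤ princCurv X ν x 0 * princCurv X ν x 1 - 1 := hx₁ (mem_univ x)
  have h2 : princCurv X ν x (Fin.last (m + 2)) ≤ b := hx₂ (mem_univ x)
  have hcone : princCurv X ν x ∈ posCone (m + 3) := (hfam.mem_posCone_iff h0 x).2 (hpos x)
  have h3 : F (princCurv X ν x) ≤ b :=
    hF.le_of_forall_le hcone (fun i => (hmono x (Fin.le_last i)).trans h2) hb0
  have h4 := hF.pos _ hcone
  have h5 : F (princCurv X ν x) ^ 2 ≤ b ^ 2 := pow_le_pow_left₀ h4.le h3 2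
  calc a / (2 * b ^ 2) * F (princCurv X ν x) ^ 2 ≤ a / (2 * b ^ 2) * b ^ 2 :=
        mul_le_mul_of_nonneg_left h5 (by positivity)
    _ = a / 2 := by field_simp
    _ < a := by linarith
    _ ≤ _ := h1

end main

end HypFlow

end

theorem proposition4p2 {n : ℕ} (hn : 3 ≤ n) {M : Type*} [TopologicalSpace M]
    [ChartedSpace (EuclideanSpace ℝ (Fin n)) M] [IsManifold (𝓡 n) ∞ M]
    [CompactSpace M] [ConnectedSpace M]
    (X₀ : M → HypFlow.Mink n) (hX₀ : HypFlow.IsHypEmbedding X₀)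
    (hsec : HypFlow.HasPosSecCurv X₀) :
    ∃ C : ℝ, 0 < C ∧
      ∀ F : (Fin n → ℝ) → ℝ, HypFlow.IsSpeed F →
      ∀ (T : ℝ) (X ν : ℝ → M → HypFlow.Mink n), 0 < T → HypFlow.IsFlow F X₀ T X ν →
      ∀ t ∈ Set.Ico 0 T, ∀ x : M,
        HypFlow.princCurv (X t) (ν t) x ⟨n - 1, by omega⟩
          ≤ C * HypFlow.princCurv (X t) (ν t) x ⟨0, by omega⟩ := by
  obtain ⟨m, rfl⟩ : ∃ m, n = m + 3 := ⟨n - 3, by omega⟩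
  -- The constant must be chosen before the flow, hence from an outward normal of the initial
  -- hypersurface. If there is no smooth outward unit normal there is no flow either, since `ν 0`
  -- would be one, and any constant will do.
  by_cases hex : ∃ ν₀ : M → HypFlow.Mink (m + 3), HypFlow.IsUnitNormal X₀ ν₀ ∧
      ContMDiff (𝓡 (m + 3)) 𝓘(ℝ, HypFlow.Mink (m + 3)) ∞ ν₀ ∧
      ∀ x, HypFlow.IsOutward (range X₀) (X₀ x) (ν₀ x)
  · obtain ⟨ν₀, hν₀, hs₀, ho₀⟩ := hex
    have hX := hX₀.toIsHypImmersion
    obtain ⟨c, hc, hpin⟩ := HypFlow.exists_pinching_initial hX hν₀ hs₀ hsec ho₀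
    have hpos := HypFlow.princCurv_pos_of_isOutward hX hν₀ hs₀ hsec ho₀
    refine ⟨(c ^ (m + 3))⁻¹, by positivity, fun F hF T X ν hT hflow t ht x => ?_⟩
    have h0 : (0 : ℝ) ∈ Ico 0 T := ⟨le_rfl, hT⟩
    have hνeq : ν 0 = ν₀ := by
      have h1 := hflow.normal 0 h0
      rw [hflow.initial] at h1
      exact hν₀.eq_of_isOutward hX h1 ho₀ hflow.outward
    have hgood := hflow.pinching hF hc (fun y => by
      rw [hflow.initial, hνeq]
      exact ⟨hpos y, hpin F hF y⟩) ht x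
    have hfam := hflow.isHypFamily
    exact HypFlow.pinching_bound hF ((hfam.mem_posCone_iff ht x).2 hgood.1) (hfam.monotone_princCurv ht x) hc
      (by linarith [hgood.2])
  · refine ⟨1, one_pos, fun F hF T X ν hT hflow => absurd ?_ hex⟩
    have h0 : (0 : ℝ) ∈ Ico 0 T := ⟨le_rfl, hT⟩
    have h1 := hflow.normal 0 h0
    rw [hflow.initial] at h1
    exact ⟨ν 0, h1, HypFlow.contMDiff_slice hflow.smooth_normal h0, hflow.outward⟩
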